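/- **Theorem 3.1.** The *disjointness graph* of a family of sets has the members of the family as its vertices, two of them being joined by an edge if and only if they are disjoint. Let $d>2$ and $k\ge 1$, and let $G$ be the disjointness graph of a family of (closed) segments in $\mathbb{R}^d$ that lie in the union of $k$ two-dimensional planes. Then the chromatic number $\chi(G)$ and the clique number $\omega(G)$ satisfy $$\chi(G)\le (k-1)\,\omega(G)+\omega(G)^4 .$$ Moreover, there is a polynomial-time algorithm which, given $d$, $k$, finitely many segments in $\mathbb{R}^d$ (by their end points) and $k$ planes whose union contains them (each by one of its points and two linearly independent direction vectors), finds a complete subgraph $K\subseteq G$ and a proper coloring of $G$ with at most $$(k-1)\,|V(K)|+|V(K)|^4$$ colors. Here $d$, $k$ and the number $n$ of segments are part of the input, and the algorithm is a single program for a random access machine that may add, subtract, multiply, divide and compare coordinates. Its running time is polynomial in both standard senses: for arbitrary real coordinates, in $d$, $n$ and $k$, when every operation on real numbers is charged one unit (and every operation on integers the binary length of the integers involved); and for rational coordinates, in $d$, $n$, $k$ and the total binary length of the coordinates, when every operation is charged the binary length of the numbers involved. -/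

import Mathlib

namespace Geom

/-- A closed line segment, as a set of points (the two end points are allowed to coincide). -/
def IsSegment {E : Type*} [AddCommGroup E] [Module ℝ E] (s : Set E) : Prop :=
  ∃ x y : E, s = segment ℝ x y

/-- A two-dimensional plane. -/
def IsPlane {E : Type*} [AddCommGroup E] [Module ℝ E] (π : AffineSubspace ℝ E) : Prop :=
  Module.finrank ℝ π.direction = 2

/-- The disjointness graph of a family of sets: distinct indices are adjacent iff the
corresponding sets are disjoint. -/
def disjointnessGraph {ι E : Type*} (s : ι → Set E) : SimpleGraph ι where
  Adj i j := i ≠ j ∧ Disjoint (s i) (s j)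
  symm := ⟨fun _ _ h => ⟨h.1.symm, h.2.symm⟩⟩
  loopless := ⟨fun _ h => h.1 rfl⟩

/-- The clique number, with values in `ℕ∞` so that it is also meaningful for a graph with
infinitely many vertices. -/
noncomputable def cliqueNumber {V : Type*} (G : SimpleGraph V) : ℕ∞ :=
  ⨆ K : {K : Finset V // G.IsClique (K : Set V)}, (K.1.card : ℕ∞)

/-- For finite graphs this is the usual clique number. -/
theorem cliqueNumber_eq_cliqueNum {V : Type*} [Finite V] (G : SimpleGraph V) :
    cliqueNumber G = (G.cliqueNum : ℕ∞) := by
  apply le_antisymm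
  · refine iSup_le fun K => ?_
    exact_mod_cast SimpleGraph.IsClique.card_le_cliqueNum (tc := K.2)
  · obtain ⟨K, hK⟩ := G.exists_isNClique_cliqueNum
    rw [← hK.card_eq]
    exact le_iSup (fun K : {K : Finset V // G.IsClique (K : Set V)} => (K.1.card : ℕ∞))
      ⟨K, hK.isClique⟩

end Geom

/-! A random access machine over an ordered field `K`. Its memory consists of two-dimensional
tables of natural numbers and two-dimensional tables of elements of `K`; a program mentions
finitely many tables. Cells are addressed by computed indices. The only operations on elements
of `K` are field arithmetic and comparison; no element of `K` can be turned into an index. -/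

namespace Machine

/-- The contents of the memory: `nat a i j` and `num a i j` are the cells in row `i` and column `j`
of the `a`-th table of natural numbers and of the `a`-th table of elements of `K`. -/
structure State (K : Type*) where
  nat : ℕ → ℕ → ℕ → ℕ
  num : ℕ → ℕ → ℕ → K

/-- Expressions for natural numbers; subtraction is truncated. -/
inductive NatExpr : Type
  | const (n : ℕ)
  | read (a : ℕ) (i j : NatExpr)
  | add (x y : NatExpr)
  | sub (x y : NatExpr)
  | mul (x y : NatExpr)

/-- Expressions for elements of `K`. -/
inductive NumExpr : Type
  | const (q : ℚ)
  | read (a : ℕ) (i j : NatExpr)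
  | add (x y : NumExpr)
  | sub (x y : NumExpr)
  | mul (x y : NumExpr)
  | div (x y : NumExpr)

/-- Tests. -/
inductive Test : Type
  | natLt (x y : NatExpr)
  | numLt (x y : NumExpr)
  | not (b : Test)
  | and (b c : Test)

/-- Programs. -/
inductive Program : Type
  | skip
  | setNat (a : ℕ) (i j e : NatExpr)
  | setNum (a : ℕ) (i j : NatExpr) (e : NumExpr)
  | seq (P Q : Program)
  | ite (b : Test) (P Q : Program)
  | while (b : Test) (P : Program)

/-- The table `T` with the entry in row `i` and column `j` of its layer `a` replaced by `v`. -/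
def update {α : Type*} (T : ℕ → ℕ → ℕ → α) (a i j : ℕ) (v : α) : ℕ → ℕ → ℕ → α :=
  fun a' i' j' => if a' = a ∧ i' = i ∧ j' = j then v else T a' i' j'

/-- The charge for handling a natural number: its length in binary, plus one. -/
def natCost (n : ℕ) : ℕ := Nat.size n + 1

section

variable {K : Type*}

def NatExpr.eval (σ : State K) : NatExpr → ℕ
  | .const n => n
  | .read a i j => σ.nat a (i.eval σ) (j.eval σ)
  | .add x y => x.eval σ + y.eval σ
  | .sub x y => x.eval σ - y.eval σ
  | .mul x y => x.eval σ * y.eval σ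

/-- The charge for evaluating an expression is the sum of the charges for all the values that
occur in its evaluation, addresses included. -/
def NatExpr.cost (σ : State K) : NatExpr → ℕ
  | .const n => natCost n
  | .read a i j => i.cost σ + j.cost σ + natCost (σ.nat a (i.eval σ) (j.eval σ))
  | .add x y => x.cost σ + y.cost σ + natCost (x.eval σ + y.eval σ)
  | .sub x y => x.cost σ + y.cost σ + natCost (x.eval σ - y.eval σ)
  | .mul x y => x.cost σ + y.cost σ + natCost (x.eval σ * y.eval σ)

variable [Field K]

def NumExpr.eval (σ : State K) : NumExpr → K
  | .const q => (q : K)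
  | .read a i j => σ.num a (i.eval σ) (j.eval σ)
  | .add x y => x.eval σ + y.eval σ
  | .sub x y => x.eval σ - y.eval σ
  | .mul x y => x.eval σ * y.eval σ
  | .div x y => x.eval σ / y.eval σ

/-- The same for elements of `K`, where `w x` is the charge for handling `x`. -/
def NumExpr.cost (w : K → ℕ) (σ : State K) : NumExpr → ℕ
  | .const q => w (q : K)
  | .read a i j => i.cost σ + j.cost σ + w (σ.num a (i.eval σ) (j.eval σ))
  | .add x y => x.cost w σ + y.cost w σ + w (x.eval σ + y.eval σ)
  | .sub x y => x.cost w σ + y.cost w σ + w (x.eval σ - y.eval σ)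
  | .mul x y => x.cost w σ + y.cost w σ + w (x.eval σ * y.eval σ)
  | .div x y => x.cost w σ + y.cost w σ + w (x.eval σ / y.eval σ)

variable [LinearOrder K]

def Test.Holds (σ : State K) : Test → Prop
  | .natLt x y => x.eval σ < y.eval σ
  | .numLt x y => x.eval σ < y.eval σ
  | .not b => ¬ b.Holds σ
  | .and b c => b.Holds σ ∧ c.Holds σ

def Test.cost (w : K → ℕ) (σ : State K) : Test → ℕ
  | .natLt x y => x.cost σ + y.cost σ + 1
  | .numLt x y => x.cost w σ + y.cost w σ + 1
  | .not b => b.cost w σ + 1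
  | .and b c => b.cost w σ + c.cost w σ + 1

/-- `Runs w P σ σ' t`: started in the state `σ`, the program `P` halts in the state `σ'` after a
computation of total cost `t`. -/
inductive Runs (w : K → ℕ) : Program → State K → State K → ℕ → Prop
  | skip (σ : State K) : Runs w .skip σ σ 1
  | setNat (σ : State K) (a : ℕ) (i j e : NatExpr) :
      Runs w (.setNat a i j e) σ
        { σ with nat := update σ.nat a (i.eval σ) (j.eval σ) (e.eval σ) }
        (i.cost σ + j.cost σ + e.cost σ + 1)
  | setNum (σ : State K) (a : ℕ) (i j : NatExpr) (e : NumExpr) :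
      Runs w (.setNum a i j e) σ
        { σ with num := update σ.num a (i.eval σ) (j.eval σ) (e.eval σ) }
        (i.cost σ + j.cost σ + e.cost w σ + 1)
  | seq {P Q : Program} {σ₁ σ₂ σ₃ : State K} {s t : ℕ} :
      Runs w P σ₁ σ₂ s → Runs w Q σ₂ σ₃ t → Runs w (.seq P Q) σ₁ σ₃ (s + t)
  | ite_true {b : Test} {P Q : Program} {σ σ' : State K} {t : ℕ} :
      b.Holds σ → Runs w P σ σ' t → Runs w (.ite b P Q) σ σ' (b.cost w σ + 1 + t)
  | ite_false {b : Test} {P Q : Program} {σ σ' : State K} {t : ℕ} :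
      ¬ b.Holds σ → Runs w Q σ σ' t → Runs w (.ite b P Q) σ σ' (b.cost w σ + 1 + t)
  | while_true {b : Test} {P : Program} {σ₁ σ₂ σ₃ : State K} {s t : ℕ} :
      b.Holds σ₁ → Runs w P σ₁ σ₂ s → Runs w (.while b P) σ₂ σ₃ t →
      Runs w (.while b P) σ₁ σ₃ (b.cost w σ₁ + 1 + s + t)
  | while_false {b : Test} {P : Program} {σ : State K} :
      ¬ b.Holds σ → Runs w (.while b P) σ σ (b.cost w σ + 1)

end

/-- The real random access machine charges one unit for every operation on real numbers. -/
def realCost (_ : ℝ) : ℕ := 1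

/-- The bit model charges for a rational number the length of its reduced fraction in binary. -/
def ratCost (q : ℚ) : ℕ := Nat.size q.num.natAbs + Nat.size q.den + 1

end Machine

namespace Geom

open Machine

/-- The input of the algorithm: `n` segments in dimension `d`, given by their end points, and `k`
planes, each given by one of its points and two vectors spanning its direction. The coordinates
are in the field `K`. -/
structure Input (K : Type*) where
  d : ℕ
  n : ℕ
  k : ℕ
  left : Fin n → Fin d → K
  right : Fin n → Fin d → K
  base : Fin k → Fin d → K
  dir₁ : Fin k → Fin d → K
  dir₂ : Fin k → Fin d → K

namespace Input

variable {K : Type*}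

/-- The length of the input, where `w x` is the length of a number `x`. -/
def size (w : K → ℕ) (I : Input K) : ℕ :=
  I.d + I.n + I.k + (∑ i, ∑ j, (w (I.left i j) + w (I.right i j)))
    + ∑ i, ∑ j, (w (I.base i j) + w (I.dir₁ i j) + w (I.dir₂ i j))

/-- The entry in row `i` and column `j` of a rectangular array, and `0` outside of the array. -/
def entry [Zero K] {m d : ℕ} (f : Fin m → Fin d → K) (i j : ℕ) : K :=
  if h : i < m ∧ j < d then f ⟨i, h.1⟩ ⟨j, h.2⟩ else 0

/-- The initial contents of the memory: the numbers `d`, `n`, `k` are the first entries of row `0`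
of the table `0` of natural numbers, the five arrays of coordinates are the tables `0` to `4` of
elements of `K`, and all the other cells are zero. -/
def initial [Zero K] (I : Input K) : State K where
  nat
    | 0, 0, 0 => I.d
    | 0, 0, 1 => I.n
    | 0, 0, 2 => I.k
    | _, _, _ => 0
  num
    | 0 => entry I.left
    | 1 => entry I.right
    | 2 => entry I.base
    | 3 => entry I.dir₁
    | 4 => entry I.dir₂
    | _ => fun _ _ => 0

section

variable [Field K] (φ : K →+* ℝ) (I : Input K)

/-- The point of the real Euclidean space with given coordinates in `K`, where `φ` is the embedding
of `K` into the reals. -/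
noncomputable def point {d : ℕ} (x : Fin d → K) : EuclideanSpace ℝ (Fin d) :=
  WithLp.toLp 2 fun j => φ (x j)

/-- The `i`-th segment. -/
noncomputable def seg (i : Fin I.n) : Set (EuclideanSpace ℝ (Fin I.d)) :=
  segment ℝ (point φ (I.left i)) (point φ (I.right i))

/-- The `i`-th plane. -/
noncomputable def plane (i : Fin I.k) : AffineSubspace ℝ (EuclideanSpace ℝ (Fin I.d)) :=
  AffineSubspace.mk' (point φ (I.base i))
    (Submodule.span ℝ {point φ (I.dir₁ i), point φ (I.dir₂ i)})

/-- The input describes segments that lie in the union of `k ≥ 1` planes of a space of dimension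
`d > 2` (so the two vectors given for a plane are linearly independent). -/
def IsValid : Prop :=
  2 < I.d ∧ 1 ≤ I.k ∧ (∀ i, IsPlane (I.plane φ i)) ∧
    ∀ i, I.seg φ i ⊆ ⋃ j, (I.plane φ j : Set (EuclideanSpace ℝ (Fin I.d)))

end

/-- The set of vertices that a state of the memory describes: the vertices `i` for which the
entry in row `i` and column `0` of the table `1` of natural numbers is nonzero. -/
def outputClique (I : Input K) (σ : State K) : Finset (Fin I.n) :=
  Finset.univ.filter fun i => σ.nat 1 i 0 ≠ 0

/-- The color of the vertex `i` that a state of the memory describes: the entry in row `i` and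
column `0` of the table `2` of natural numbers. -/
def outputColor (I : Input K) (σ : State K) (i : Fin I.n) : ℕ :=
  σ.nat 2 i 0

/-- The state of the memory describes a complete subgraph of the disjointness graph of the
segments, on a vertex set `C`, and a proper coloring of this graph that uses only the colors
`0, 1, …, (k - 1) * |C| + |C| ^ 4 - 1`. -/
def IsCorrect [Field K] (φ : K →+* ℝ) (I : Input K) (σ : State K) : Prop :=
  (disjointnessGraph (I.seg φ)).IsClique (I.outputClique σ : Set (Fin I.n)) ∧
  (∀ i j, (disjointnessGraph (I.seg φ)).Adj i j → I.outputColor σ i ≠ I.outputColor σ j) ∧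
  ∀ i, I.outputColor σ i <
    (I.k - 1) * (I.outputClique σ).card + (I.outputClique σ).card ^ 4

end Input

/-- On every valid input with coordinates in `K`, the program `P` halts with a correct output, and
the cost of the computation is at most the value of the polynomial `p` at the length of the
input. -/
def SolvesInTime {K : Type*} [Field K] [LinearOrder K] (φ : K →+* ℝ) (w : K → ℕ)
    (P : Program) (p : Polynomial ℕ) : Prop :=
  ∀ I : Input K, I.IsValid φ → ∃ (σ : State K) (t : ℕ),
    Runs w P I.initial σ t ∧ t ≤ p.eval (I.size w) ∧ I.IsCorrect φ σ

end Geom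

/-! ### A language with bounded loops and truncated values, and its semantics. -/

namespace Machine

/-! Assign every segment to the last of the given planes that contains it; some plane does, because
among k + 1 points of the segment two lie in the same plane (`exists_inPlane`). The planes are
treated one after another, while a clique K and a partial proper coloring grow together. The
invariant (`StageInv`) is that every segment of an untreated plane that meets a member of K is
already colored.

Inside one plane, disjointness is the union of the comparability relations of four strict orders
(`exists_order`, `Order.trans`): of two disjoint segments one lies below the other on all common
vertical lines, and the projections to the first axis are either nested or shifted. Among the
uncolored segments of the plane let m be the largest size of a chain in any of the four orders.
Coloring by the quadruple of heights is proper and needs at most m ^ 4 new colors, and a longest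
chain C is a clique. By the invariant no uncolored segment meets K, so K ∪ C is a clique.

To restore the invariant, take s in C and a later plane. That plane does not contain s, so it meets
s in at most one point, and all segments of the plane that meet s pass through this point. They meet
pairwise and may share one color (`not_disjSeg_trans`), which costs k - 1 colors for each member of
C. If the chains have sizes m_1, ..., m_k, then |K| is their sum, and the sum of all m_i ^ 4 + (k -
1) m_i is at most |K| ^ 4 + (k - 1) |K| (`stage_spec`).

For the running time, the procedure is written in a language whose loops are bounded and whose
stored values are truncated at a capacity polynomial in the input. Field elements are never stored,
so the numbers that occur in the finitely many expressions of the program have polynomially bounded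
length. Hence every well-formed program of the language is polynomial in both cost models
(`Code.runs_compile`), and what remains is correctness over the reals (`exists_solvesInTime`). The
bound on the chromatic number is a consequence: the output of the program settles finite families,
and compactness (`colorable_of_finite`) settles infinite ones. -/

/-- The contents of the tables of natural numbers. -/
abbrev Mem := ℕ → ℕ → ℕ → ℕ

theorem update_of_ne {α : Type*} (T : ℕ → ℕ → ℕ → α) {a a' : ℕ} (h : a' ≠ a) (i j : ℕ) (v : α) :
    update T a i j v a' = T a' := by
  funext i' j'; simp [update, h]

theorem update_same {α : Type*} (T : ℕ → ℕ → ℕ → α) (a i j i' j' : ℕ) (v : α) :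
    update T a i j v a i' j' = if i' = i ∧ j' = j then v else T a i' j' := by
  simp [update]

/-- Bounding a length by the number itself is crude, but it suffices because all natural numbers in
the memory will be polynomially bounded in value. -/
theorem natCost_le (n : ℕ) : natCost n ≤ n + 1 := by
  have : Nat.size n ≤ n := Nat.size_le.2 Nat.lt_two_pow_self
  unfold natCost; omega

/-- A language of programs with bounded loops. All the values that are stored in the memory are
truncated at a capacity, which compiled programs keep in the table `9`. -/
inductive Code : Type
  | skip
  | set (a : ℕ) (i j e : NatExpr)
  | seq (P Q : Code)
  | ite (b : Test) (P Q : Code)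
  | loop (v : ℕ) (b : NatExpr) (P : Code)

/-- The entry in row `0` and column `0` of a table. -/
def cell (a : ℕ) : NatExpr := .read a (.const 0) (.const 0)

/-- Since subtraction is truncated, the value is the minimum of the value of `e` and the capacity.
-/
def clamp (e : NatExpr) : NatExpr := .sub e (.sub e (cell 9))

namespace Code

/-- A compiled loop evaluates its bound before every round, whereas `exec` evaluates it once; the
two agree for well-formed code because the bound reads only the input and the body changes neither
the input nor the capacity. The increment of the loop variable needs no truncation, as the variable
was less than the truncated bound. -/
def compile : Code → Program
  | skip => .skip
  | set a i j e => .setNat a i j (clamp e)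
  | seq P Q => .seq P.compile Q.compile
  | ite b P Q => .ite b P.compile Q.compile
  | loop v b P => .seq (.setNat v (.const 0) (.const 0) (.const 0))
      (.while (.natLt (cell v) (clamp b))
        (.seq P.compile (.setNat v (.const 0) (.const 0) (.add (cell v) (.const 1)))))

def writes : Code → List ℕ
  | skip => []
  | set a _ _ _ => [a]
  | seq P Q => P.writes ++ Q.writes
  | ite _ P Q => P.writes ++ Q.writes
  | loop v _ P => v :: P.writes

end Code

/-- The expression reads only the table `0`. -/
def NatExpr.IsInput : NatExpr → Prop
  | .const _ => True
  | .read a i j => a = 0 ∧ i.IsInput ∧ j.IsInput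
  | .add x y => x.IsInput ∧ y.IsInput
  | .sub x y => x.IsInput ∧ y.IsInput
  | .mul x y => x.IsInput ∧ y.IsInput

namespace Code

/-- The input and the capacity are not overwritten, and loops do not touch their variables. -/
def WellFormed : Code → Prop
  | skip => True
  | set a _ _ _ => a ≠ 0 ∧ a ≠ 9
  | seq P Q => P.WellFormed ∧ Q.WellFormed
  | ite _ P Q => P.WellFormed ∧ Q.WellFormed
  | loop v b P => v ≠ 0 ∧ v ≠ 9 ∧ v ∉ P.writes ∧ b.IsInput ∧ P.WellFormed

section

variable {K : Type*} [Field K] [LinearOrder K] (num : ℕ → ℕ → ℕ → K) (c : ℕ)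

/-- The semantics of programs, for a capacity `c`. -/
noncomputable def exec : Code → Mem → Mem
  | skip, T => T
  | set a i j e, T =>
      update T a (i.eval (⟨T, num⟩ : State K)) (j.eval (⟨T, num⟩ : State K))
        (min (e.eval (⟨T, num⟩ : State K)) c)
  | seq P Q, T => Q.exec (P.exec T)
  | ite b P Q, T => open Classical in if b.Holds ⟨T, num⟩ then P.exec T else Q.exec T
  | loop v b P, T =>
      Nat.rec (update T v 0 0 0) (fun i T' => update (P.exec T') v 0 0 (i + 1))
        (min (b.eval (⟨T, num⟩ : State K)) c)

/-- The frame rule: facts about a table survive every phase that does not list it in `writes`, which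
is a decidable syntactic condition. -/
theorem exec_frame (P : Code) (T : Mem) {a : ℕ} (h : a ∉ P.writes) :
    P.exec num c T a = T a := by
  induction P generalizing T with
  | skip => rfl
  | set b i j e =>
    simp only [writes, List.mem_singleton] at h
    simp [exec, update_of_ne _ h]
  | seq P Q hP hQ =>
    simp only [writes, List.mem_append, not_or] at h
    simp [exec, hP _ h.1, hQ _ h.2]
  | ite b P Q hP hQ =>
    simp only [writes, List.mem_append, not_or] at h
    simp only [exec]
    split_ifs
    · exact hP _ h.1
    · exact hQ _ h.2
  | loop v b P hP =>
    simp only [writes, List.mem_cons, not_or] at h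
    simp only [exec]
    generalize min (NatExpr.eval _ b) c = N
    induction N with
    | zero => simp [update_of_ne _ h.1]
    | succ N ih => simp [update_of_ne _ h.1, hP _ h.2, ih]

/-- Loops are analysed by means of invariants. -/
theorem loop_induction {v : ℕ} {b : NatExpr} {P : Code} {T : Mem} {N : ℕ} (Inv : ℕ → Mem → Prop)
    (hN : min (b.eval (⟨T, num⟩ : State K)) c = N)
    (h0 : Inv 0 (update T v 0 0 0))
    (hs : ∀ i T', i < N → T' v 0 0 = i → (∀ a, a ≠ v → a ∉ P.writes → T' a = T a) → Inv i T' →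
      Inv (i + 1) (update (P.exec num c T') v 0 0 (i + 1))) :
    Inv N ((loop v b P).exec num c T) := by
  simp only [exec, hN]
  suffices ∀ M ≤ N, (fun T' : Mem => T' v 0 0 = M ∧ (∀ a, a ≠ v → a ∉ P.writes → T' a = T a) ∧
      Inv M T') (Nat.rec (update T v 0 0 0) (fun i T' => update (P.exec num c T') v 0 0 (i + 1)) M)
    from (this N le_rfl).2.2
  intro M hM
  induction M with
  | zero => exact ⟨by simp [update], fun a ha _ => update_of_ne _ ha _ _ _, h0⟩
  | succ M ih =>
    obtain ⟨h1, h2, h3⟩ := ih (by omega)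
    refine ⟨by simp [update], fun a ha ha' => ?_, hs M _ (by omega) h1 h2 h3⟩
    simp only [update_of_ne _ ha]
    rw [exec_frame _ _ _ _ ha']
    exact h2 a ha ha'

end

end Code

/-! ### Growth of the length of numbers under arithmetic. -/

section Cost

open Polynomial

variable {K : Type*} [Field K]

/-- The properties of a cost function that bounds on running times depend on. -/
structure IsCost (w : K → ℕ) : Prop where
  const : ∀ q : ℚ, w (q : K) ≤ ratCost q
  add : ∀ x y, w (x + y) ≤ 2 * (w x + w y)
  sub : ∀ x y, w (x - y) ≤ 2 * (w x + w y)
  mul : ∀ x y, w (x * y) ≤ 2 * (w x + w y)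
  div : ∀ x y, w (x / y) ≤ 2 * (w x + w y)

theorem isCost_realCost : IsCost realCost := by
  constructor <;> intros <;> simp [realCost, ratCost]

theorem size_mul_le (a b : ℕ) : Nat.size (a * b) ≤ Nat.size a + Nat.size b := by
  rw [Nat.size_le, pow_add]
  rcases Nat.eq_zero_or_pos b with rfl | hb
  · simp
  · exact Nat.mul_lt_mul_of_lt_of_le (Nat.lt_size_self a) (Nat.lt_size_self b).le (by positivity)

theorem size_add_le {a b m : ℕ} (ha : Nat.size a ≤ m) (hb : Nat.size b ≤ m) :
    Nat.size (a + b) ≤ m + 1 := by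
  rw [Nat.size_le] at *
  rw [pow_succ]; omega

theorem ratCost_neg (x : ℚ) : ratCost (-x) = ratCost x := by simp [ratCost]

theorem ratCost_mul (x y : ℚ) : ratCost (x * y) ≤ ratCost x + ratCost y := by
  have h1 : (x * y).num.natAbs ≤ x.num.natAbs * y.num.natAbs := by
    rw [Rat.mul_num, ← Int.natAbs_mul]
    exact Int.natAbs_ediv_le_natAbs _ _
  have h2 : (x * y).den ≤ x.den * y.den := by
    rw [Rat.mul_den]; exact Nat.div_le_self _ _
  have := (Nat.size_le_size h1).trans (size_mul_le _ _)
  have := (Nat.size_le_size h2).trans (size_mul_le _ _)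
  unfold ratCost; omega

theorem ratCost_inv (x : ℚ) : ratCost x⁻¹ ≤ ratCost x + 1 := by
  unfold ratCost
  rcases eq_or_ne x 0 with rfl | hx
  · simp
  · simp [Rat.num_inv, Rat.den_inv, hx, Int.natAbs_mul, Int.natAbs_sign_of_ne_zero]
    omega

/-- The two denominators enter both the numerator and the denominator of the sum; this double use
accounts for the factor two in `IsCost`. -/
theorem ratCost_add (x y : ℚ) : ratCost (x + y) ≤ 2 * (ratCost x + ratCost y) := by
  have h1 : (x + y).num.natAbs ≤ x.num.natAbs * y.den + y.num.natAbs * x.den := by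
    rw [Rat.num_add]
    refine (Int.natAbs_ediv_le_natAbs _ _).trans ((Int.natAbs_add_le _ _).trans ?_)
    simp [Int.natAbs_mul]
  have h2 : (x + y).den ≤ x.den * y.den := Nat.le_of_dvd (by positivity) (Rat.add_den_dvd x y)
  have h3 := (Nat.size_le_size h2).trans (size_mul_le _ _)
  have h4 := (Nat.size_le_size h1).trans (size_add_le
    (m := x.num.natAbs.size + y.den.size + y.num.natAbs.size + x.den.size)
    ((size_mul_le _ _).trans (by omega)) ((size_mul_le _ _).trans (by omega)))
  unfold ratCost; omega

theorem isCost_ratCost : IsCost ratCost where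
  const q := by simp
  add := ratCost_add
  sub x y := by rw [sub_eq_add_neg, ← ratCost_neg y]; exact ratCost_add _ _
  mul x y := (ratCost_mul x y).trans (by omega)
  div x y := by
    rw [div_eq_mul_inv]
    have := ratCost_mul x y⁻¹
    have := ratCost_inv y
    have : 1 ≤ ratCost y := by simp [ratCost]
    omega

end Cost

end Machine

namespace Machine

/-! ### Polynomial bounds on the running time of compiled programs. -/

section CostBounds

open Polynomial

variable {K : Type*}

namespace NatExpr

/-- A bound on the value of an expression when no cell exceeds `X`. -/
noncomputable def valueBound : NatExpr → ℕ[X]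
  | .const n => C n
  | .read _ _ _ => X
  | .add x y => x.valueBound + y.valueBound
  | .sub x _ => x.valueBound
  | .mul x y => x.valueBound * y.valueBound

noncomputable def costBound : NatExpr → ℕ[X]
  | .const n => C n + 1
  | .read _ i j => i.costBound + j.costBound + (X + 1)
  | .add x y => x.costBound + y.costBound + (x.valueBound + y.valueBound + 1)
  | .sub x y => x.costBound + y.costBound + (x.valueBound + 1)
  | .mul x y => x.costBound + y.costBound + (x.valueBound * y.valueBound + 1)

variable {σ : State K} {N : ℕ} (h : ∀ a i j, σ.nat a i j ≤ N)
include h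

theorem eval_le (e : NatExpr) : e.eval σ ≤ e.valueBound.eval N := by
  induction e with
  | const n => simp [eval, valueBound]
  | read a i j => simpa [eval, valueBound] using h _ _ _
  | add x y hx hy => simpa [eval, valueBound] using add_le_add hx hy
  | sub x y hx hy => simp only [eval, valueBound]; omega
  | mul x y hx hy => simpa [eval, valueBound] using Nat.mul_le_mul hx hy

theorem cost_le (e : NatExpr) : e.cost σ ≤ e.costBound.eval N := by
  induction e with
  | const n => simpa [cost, costBound] using natCost_le n
  | read a i j hi hj =>
    simp only [cost, costBound, eval_add, eval_X, eval_one]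
    exact add_le_add (add_le_add hi hj) ((natCost_le _).trans (Nat.succ_le_succ (h _ _ _)))
  | add x y hx hy =>
    simp only [cost, costBound, eval_add, eval_one]
    exact add_le_add (add_le_add hx hy) ((natCost_le _).trans
      (Nat.succ_le_succ (add_le_add (eval_le h x) (eval_le h y))))
  | sub x y hx hy =>
    simp only [cost, costBound, eval_add, eval_one]
    exact add_le_add (add_le_add hx hy) ((natCost_le _).trans
      (Nat.succ_le_succ ((Nat.sub_le _ _).trans (eval_le h x))))
  | mul x y hx hy =>
    simp only [cost, costBound, eval_add, eval_mul, eval_one]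
    exact add_le_add (add_le_add hx hy) ((natCost_le _).trans
      (Nat.succ_le_succ (Nat.mul_le_mul (eval_le h x) (eval_le h y))))

end NatExpr

namespace NumExpr

/-- A bound on the cost of the value of an expression when no cell exceeds `X`. -/
noncomputable def valueBound : NumExpr → ℕ[X]
  | .const q => C (ratCost q)
  | .read _ _ _ => X
  | .add x y => 2 * (x.valueBound + y.valueBound)
  | .sub x y => 2 * (x.valueBound + y.valueBound)
  | .mul x y => 2 * (x.valueBound + y.valueBound)
  | .div x y => 2 * (x.valueBound + y.valueBound)

noncomputable def costBound : NumExpr → ℕ[X]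
  | .const q => C (ratCost q)
  | .read _ i j => i.costBound + j.costBound + X
  | .add x y => x.costBound + y.costBound + 2 * (x.valueBound + y.valueBound)
  | .sub x y => x.costBound + y.costBound + 2 * (x.valueBound + y.valueBound)
  | .mul x y => x.costBound + y.costBound + 2 * (x.valueBound + y.valueBound)
  | .div x y => x.costBound + y.costBound + 2 * (x.valueBound + y.valueBound)

variable [Field K] {w : K → ℕ} (hw : IsCost w) {σ : State K} {N : ℕ}
  (h' : ∀ a i j, w (σ.num a i j) ≤ N)
include hw h'

theorem value_le (e : NumExpr) : w (e.eval σ) ≤ e.valueBound.eval N := by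
  induction e with
  | const q => simpa [eval, valueBound] using hw.const q
  | read a i j => simpa [eval, valueBound] using h' _ _ _
  | add x y hx hy =>
    simpa [eval, valueBound] using (hw.add _ _).trans (Nat.mul_le_mul_left 2 (add_le_add hx hy))
  | sub x y hx hy =>
    simpa [eval, valueBound] using (hw.sub _ _).trans (Nat.mul_le_mul_left 2 (add_le_add hx hy))
  | mul x y hx hy =>
    simpa [eval, valueBound] using (hw.mul _ _).trans (Nat.mul_le_mul_left 2 (add_le_add hx hy))
  | div x y hx hy =>
    simpa [eval, valueBound] using (hw.div _ _).trans (Nat.mul_le_mul_left 2 (add_le_add hx hy))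

theorem cost_le (h : ∀ a i j, σ.nat a i j ≤ N) (e : NumExpr) :
    e.cost w σ ≤ e.costBound.eval N := by
  induction e with
  | const q => simpa [cost, costBound] using hw.const q
  | read a i j =>
    simp only [cost, costBound, eval_add, eval_X]
    exact add_le_add (add_le_add (i.cost_le h) (j.cost_le h)) (h' _ _ _)
  | add x y hx hy =>
    have := value_le hw h' (x.add y)
    simp only [cost, costBound, eval_add] at *
    exact add_le_add (add_le_add hx hy) this
  | sub x y hx hy =>
    have := value_le hw h' (x.sub y)
    simp only [cost, costBound, eval_add] at *
    exact add_le_add (add_le_add hx hy) this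
  | mul x y hx hy =>
    have := value_le hw h' (x.mul y)
    simp only [cost, costBound, eval_add] at *
    exact add_le_add (add_le_add hx hy) this
  | div x y hx hy =>
    have := value_le hw h' (x.div y)
    simp only [cost, costBound, eval_add] at *
    exact add_le_add (add_le_add hx hy) this

end NumExpr

noncomputable def Test.costBound : Test → ℕ[X]
  | .natLt x y => x.costBound + y.costBound + 1
  | .numLt x y => x.costBound + y.costBound + 1
  | .not b => b.costBound + 1
  | .and b c => b.costBound + c.costBound + 1

theorem Test.cost_le [Field K] [LinearOrder K] {w : K → ℕ} (hw : IsCost w) {σ : State K} {N : ℕ}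
    (h' : ∀ a i j, w (σ.num a i j) ≤ N) (h : ∀ a i j, σ.nat a i j ≤ N) (b : Test) :
    b.cost w σ ≤ b.costBound.eval N := by
  induction b with
  | natLt x y => simpa [cost, costBound] using add_le_add (x.cost_le h) (y.cost_le h)
  | numLt x y => simpa [cost, costBound] using add_le_add (x.cost_le hw h' h) (y.cost_le hw h' h)
  | not b hb => simpa [cost, costBound] using hb
  | and b c hb hc => simpa [cost, costBound] using add_le_add hb hc

namespace Code

/-- The constant 4 pays for clearing the loop variable: three zeros of cost one, and one for the
instruction. A loop makes at most `X` rounds because its bound is truncated at the capacity. -/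
noncomputable def costBound : Code → ℕ[X]
  | skip => 1
  | set _ i j e => i.costBound + j.costBound + (clamp e).costBound + 1
  | seq P Q => P.costBound + Q.costBound
  | ite b P Q => b.costBound + 1 + (P.costBound + Q.costBound)
  | loop v b P => 4 + ((Test.natLt (cell v) (clamp b)).costBound + 1 +
      X * ((Test.natLt (cell v) (clamp b)).costBound + 1 + (P.costBound +
        ((NatExpr.const 0).costBound + (NatExpr.const 0).costBound +
          (NatExpr.add (cell v) (.const 1)).costBound + 1))))

variable (num : ℕ → ℕ → ℕ → K) {N : ℕ} {c : ℕ}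

theorem _root_.Machine.NatExpr.IsInput.eval_eq {T T' : Mem} (h : T 0 = T' 0) {e : NatExpr}
    (he : e.IsInput) : e.eval (⟨T, num⟩ : State K) = e.eval (⟨T', num⟩ : State K) := by
  induction e with
  | const n => rfl
  | read a i j hi hj => obtain ⟨rfl, h1, h2⟩ := he; simp [NatExpr.eval, hi h1, hj h2, h]
  | add x y hx hy => simp [NatExpr.eval, hx he.1, hy he.2]
  | sub x y hx hy => simp [NatExpr.eval, hx he.1, hy he.2]
  | mul x y hx hy => simp [NatExpr.eval, hx he.1, hy he.2]

theorem WellFormed.notMem_writes {P : Code} (h : P.WellFormed) :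
    0 ∉ P.writes ∧ 9 ∉ P.writes := by
  induction P with
  | skip => simp [writes]
  | set a i j e => simpa [writes, eq_comm] using (show a ≠ 0 ∧ a ≠ 9 from h)
  | seq P Q hP hQ => simp [writes, hP h.1, hQ h.2]
  | ite b P Q hP hQ => simp [writes, hP h.1, hQ h.2]
  | loop v b P hP => simp [writes, hP h.2.2.2.2, Ne.symm h.1, Ne.symm h.2.1]

theorem eval_clamp (e : NatExpr) (T : Mem) (hc : T 9 0 0 = c) :
    (clamp e).eval (⟨T, num⟩ : State K) = min (e.eval (⟨T, num⟩ : State K)) c := by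
  simp only [clamp, cell, NatExpr.eval, hc]; omega

theorem update_le {T : Mem} (hT : ∀ a i j, T a i j ≤ N) {v : ℕ} (hv : v ≤ N) (a i j : ℕ) :
    ∀ a' i' j', update T a i j v a' i' j' ≤ N := by
  intro a' i' j'
  unfold update
  split_ifs
  · exact hv
  · exact hT _ _ _

variable [Field K] [LinearOrder K] {w : K → ℕ}

/-- Compiled programs compute the semantics, in time polynomial in a bound on the contents of the
memory. -/
theorem runs_compile (hw : IsCost w) (hnum : ∀ a i j, w (num a i j) ≤ N) (hcN : c ≤ N) (P : Code)
    (hP : P.WellFormed) (T : Mem) (hT : ∀ a i j, T a i j ≤ N) (hc : T 9 0 0 = c) :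
    (∃ t ≤ P.costBound.eval N, Runs w P.compile ⟨T, num⟩ ⟨P.exec num c T, num⟩ t) ∧
      ∀ a i j, P.exec num c T a i j ≤ N := by
  induction P generalizing T with
  | skip => exact ⟨⟨1, by simp [costBound], .skip _⟩, hT⟩
  | set a i j e =>
    have := Runs.setNat (w := w) ⟨T, num⟩ a i j (clamp e)
    rw [eval_clamp _ _ _ hc] at this
    refine ⟨⟨_, ?_, this⟩, ?_⟩
    rotate_left
    · exact update_le hT ((min_le_right _ _).trans hcN) _ _ _
    · simp only [costBound, eval_add, eval_one]
      exact Nat.succ_le_succ (add_le_add (add_le_add (i.cost_le hT) (j.cost_le hT))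
        ((clamp e).cost_le hT))
  | seq P Q hP' hQ' =>
    obtain ⟨⟨s, hs, h1⟩, h2⟩ := hP' hP.1 T hT hc
    obtain ⟨⟨t, ht, h3⟩, h4⟩ := hQ' hP.2 _ h2
      (by rw [exec_frame _ _ _ _ hP.1.notMem_writes.2, hc])
    exact ⟨⟨s + t, by simpa [costBound] using add_le_add hs ht, h1.seq h3⟩, h4⟩
  | ite b P Q hP' hQ' =>
    have hb := b.cost_le hw (σ := ⟨T, num⟩) hnum hT
    by_cases h : b.Holds ⟨T, num⟩
    · obtain ⟨⟨s, hs, h1⟩, h2⟩ := hP' hP.1 T hT hc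
      simp only [exec, h, if_true]
      refine ⟨⟨_, ?_, .ite_true h h1⟩, h2⟩
      simp only [costBound, eval_add, eval_one]
      omega
    · obtain ⟨⟨s, hs, h1⟩, h2⟩ := hQ' hP.2 T hT hc
      simp only [exec, h, if_false]
      refine ⟨⟨_, ?_, .ite_false h h1⟩, h2⟩
      simp only [costBound, eval_add, eval_one]
      omega
  | loop v b P hP' =>
    obtain ⟨hv0, hv9, hvP, hb, hPw⟩ := hP
    set test := Test.natLt (cell v) (clamp b) with htest
    set inc := Program.setNat v (.const 0) (.const 0) (.add (cell v) (.const 1)) with hinc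
    set M := min (b.eval (⟨T, num⟩ : State K)) c with hM
    -- `S i` is the memory after `i` rounds.
    set S : ℕ → Mem := fun i => Nat.rec (update T v 0 0 0)
      (fun i T' => update (P.exec num c T') v 0 0 (i + 1)) i with hS
    have hSs : ∀ i, S (i + 1) = update (P.exec num c (S i)) v 0 0 (i + 1) := fun i => rfl
    have hSv : ∀ i, S i v 0 0 = i := by
      intro i; cases i <;> simp [hS, update]
    have hS0 : ∀ i, S i 0 = T 0 ∧ S i 9 = T 9 := by
      intro i
      induction i with
      | zero => simp [hS, update_of_ne _ hv0.symm, update_of_ne _ hv9.symm]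
      | succ i ih =>
        rw [hSs, update_of_ne _ hv0.symm, update_of_ne _ hv9.symm,
          exec_frame _ _ _ _ hPw.notMem_writes.1, exec_frame _ _ _ _ hPw.notMem_writes.2]
        exact ih
    have hholds : ∀ i, test.Holds (⟨S i, num⟩ : State K) ↔ i < M := by
      intro i
      simp only [htest, Test.Holds]
      rw [eval_clamp (c := c) _ _ _ (by rw [(hS0 i).2, hc]), hb.eval_eq num (hS0 i).1]
      simp [cell, NatExpr.eval, hSv, hM]
    have hMN : M ≤ N := (min_le_right _ _).trans hcN
    have hSN : ∀ i ≤ M, ∀ a i' j', S i a i' j' ≤ N := by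
      intro i
      induction i with
      | zero => exact fun _ => update_le hT (Nat.zero_le _) _ _ _
      | succ i ih =>
        intro hi
        rw [hSs]
        exact update_le (hP' hPw _ (ih (by omega)) (by rw [(hS0 i).2, hc])).2 (by omega) _ _ _
    set A := test.costBound.eval N with hA
    set B := P.costBound.eval N with hB
    set D := (NatExpr.const 0).costBound.eval N + (NatExpr.const 0).costBound.eval N +
          (NatExpr.add (cell v) (.const 1)).costBound.eval N + 1 with hD
    have hstep : ∀ i < M, ∃ t ≤ B + D,
        Runs w (P.compile.seq inc) ⟨S i, num⟩ ⟨S (i + 1), num⟩ t := by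
      intro i hi
      obtain ⟨⟨s, hs, h1⟩, h2⟩ := hP' hPw (S i) (hSN i hi.le) (by rw [(hS0 i).2, hc])
      have h3 := Runs.setNat (w := w) ⟨P.exec num c (S i), num⟩ v (.const 0) (.const 0)
        (.add (cell v) (.const 1))
      rw [show update (P.exec num c (S i)) v _ _ _ = S (i + 1) by
        simp only [hSs, cell, NatExpr.eval, exec_frame _ _ _ _ hvP, hSv]] at h3
      refine ⟨_, ?_, h1.seq h3⟩
      · have := NatExpr.cost_le (σ := ⟨P.exec num c (S i), num⟩) h2 (.const 0)
        have := NatExpr.cost_le (σ := ⟨P.exec num c (S i), num⟩) h2 (.add (cell v) (.const 1))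
        simp only [cell] at *
        omega
    -- Runs of a loop are built from the last round backwards, so the induction is on the number `m`
    -- of rounds that remain.
    have hwhile : ∀ m ≤ M, ∃ t ≤ (A + 1) + m * (A + 1 + (B + D)),
        Runs w (.while test (P.compile.seq inc)) ⟨S (M - m), num⟩ ⟨S M, num⟩ t := by
      intro m
      induction m with
      | zero =>
        intro _
        refine ⟨_, ?_, .while_false (by simp [hholds])⟩
        have := test.cost_le hw (σ := ⟨S M, num⟩) hnum (hSN M le_rfl)
        simp only [Nat.sub_zero]
        omega
      | succ m ih =>
        intro hm
        obtain ⟨t, ht, h1⟩ := ih (by omega)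
        obtain ⟨s, hs, h2⟩ := hstep (M - (m + 1)) (by omega)
        rw [show M - (m + 1) + 1 = M - m by omega] at h2
        refine ⟨_, ?_, .while_true ((hholds _).2 (by omega)) h2 h1⟩
        have := test.cost_le hw (σ := ⟨S (M - (m + 1)), num⟩) hnum (hSN _ (by omega))
        rw [add_mul, one_mul]
        omega
    obtain ⟨t, ht, h1⟩ := hwhile M le_rfl
    rw [Nat.sub_self] at h1
    refine ⟨⟨_, ?_, .seq (Runs.setNat (w := w) ⟨T, num⟩ v (.const 0) (.const 0) (.const 0)) h1⟩,
      hSN M le_rfl⟩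
    have h5 : M * (A + 1 + (B + D)) ≤ N * (A + 1 + (B + D)) := Nat.mul_le_mul_right _ hMN
    simp only [costBound, eval_add, eval_mul, eval_X, eval_one, NatExpr.cost,
      show (4 : ℕ[X]) = C 4 from rfl, eval_C, natCost, Nat.size_zero]
    simp only [← htest, ← hA, ← hB, ← hD]
    omega

end Code

end CostBounds

end Machine

namespace Machine

/-! ### Transfer of computations along an ordered field embedding. -/

section Map

variable {K : Type*} [Field K] (φ : K →+* ℝ) (T : Mem) (num : ℕ → ℕ → ℕ → K)

omit [Field K] in
theorem NatExpr.eval_congr_num {K' : Type*} (num' : ℕ → ℕ → ℕ → K') (e : NatExpr) :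
    e.eval (⟨T, num⟩ : State K) = e.eval (⟨T, num'⟩ : State K') := by
  induction e with
  | const n => rfl
  | read a i j hi hj => simp [eval, hi, hj]
  | add x y hx hy => simp [eval, hx, hy]
  | sub x y hx hy => simp [eval, hx, hy]
  | mul x y hx hy => simp [eval, hx, hy]

theorem NumExpr.map_eval (e : NumExpr) :
    φ (e.eval ⟨T, num⟩) = e.eval ⟨T, fun a i j => φ (num a i j)⟩ := by
  induction e with
  | const q => simp [eval]
  | read a i j =>
    simp only [eval]
    rw [NatExpr.eval_congr_num T num (fun a i j => φ (num a i j)) i,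
      NatExpr.eval_congr_num T num (fun a i j => φ (num a i j)) j]
  | add x y hx hy => simp [eval, hx, hy]
  | sub x y hx hy => simp [eval, hx, hy]
  | mul x y hx hy => simp [eval, hx, hy]
  | div x y hx hy => simp [eval, hx, hy]

variable [LinearOrder K] (hφ : StrictMono φ)
include hφ

theorem Test.holds_map (b : Test) :
    b.Holds ⟨T, num⟩ ↔ b.Holds ⟨T, fun a i j => φ (num a i j)⟩ := by
  induction b with
  | natLt x y =>
    simp only [Holds]
    rw [NatExpr.eval_congr_num T num (fun a i j => φ (num a i j)) x,
      NatExpr.eval_congr_num T num (fun a i j => φ (num a i j)) y]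
  | numLt x y => simp only [Holds, ← NumExpr.map_eval, hφ.lt_iff_lt]
  | not b hb => simp [Holds, hb]
  | and b c hb hc => simp [Holds, hb, hc]

/-- Code never writes field elements and sees them only through comparisons, which a strictly
monotone homomorphism preserves. So correctness over the reals also covers rational inputs. -/
theorem Code.exec_map (c : ℕ) (P : Code) :
    P.exec num c T = P.exec (fun a i j => φ (num a i j)) c T := by
  induction P generalizing T with
  | skip => rfl
  | set a i j e =>
    simp only [exec]
    rw [NatExpr.eval_congr_num T num (fun a i j => φ (num a i j)) i,
      NatExpr.eval_congr_num T num (fun a i j => φ (num a i j)) j,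
      NatExpr.eval_congr_num T num (fun a i j => φ (num a i j)) e]
  | seq P Q hP hQ => simp only [exec, hP, hQ]
  | ite b P Q hP hQ =>
    simp only [exec, hP, hQ]
    have h := Test.holds_map φ T num hφ b
    by_cases hb : b.Holds ⟨T, num⟩
    · simp only [hb, h.1 hb, if_true]
    · simp only [hb, mt h.2 hb, if_false]
  | loop v b P hP =>
    simp only [exec, hP]
    rw [NatExpr.eval_congr_num T num (fun a i j => φ (num a i j)) b]

end Map

end Machine

/-! ### Reduction of the algorithmic statement to correctness over the reals. -/

namespace Geom

open Machine

namespace Input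

/-- The input with all the coordinates mapped to the reals. -/
def map {K : Type*} (φ : K → ℝ) (I : Input K) : Input ℝ where
  d := I.d
  n := I.n
  k := I.k
  left i j := φ (I.left i j)
  right i j := φ (I.right i j)
  base i j := φ (I.base i j)
  dir₁ i j := φ (I.dir₁ i j)
  dir₂ i j := φ (I.dir₂ i j)

theorem entry_map {K : Type*} [Field K] (φ : K →+* ℝ) {m d : ℕ} (f : Fin m → Fin d → K)
    (i j : ℕ) : φ (entry f i j) = entry (fun i j => φ (f i j)) i j := by
  unfold entry; split_ifs <;> simp

theorem initial_map_num {K : Type*} [Field K] (φ : K →+* ℝ) (I : Input K) :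
    (I.map φ).initial.num = fun a i j => φ (I.initial.num a i j) := by
  funext a i j
  match a with
  | 0 => exact (entry_map φ I.left i j).symm
  | 1 => exact (entry_map φ I.right i j).symm
  | 2 => exact (entry_map φ I.base i j).symm
  | 3 => exact (entry_map φ I.dir₁ i j).symm
  | 4 => exact (entry_map φ I.dir₂ i j).symm
  | n + 5 => exact (map_zero φ).symm

theorem isValid_map {K : Type*} [Field K] (φ : K →+* ℝ) (I : Input K) :
    (I.map φ).IsValid (RingHom.id ℝ) ↔ I.IsValid φ := Iff.rfl

/-- The output consists of natural numbers, and the segments are formed from the images of the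
coordinates in both cases. -/
theorem isCorrect_map {K : Type*} [Field K] (φ : K →+* ℝ) (I : Input K) (T : Mem)
    (num : ℕ → ℕ → ℕ → K) (num' : ℕ → ℕ → ℕ → ℝ) :
    (I.map φ).IsCorrect (RingHom.id ℝ) ⟨T, num'⟩ ↔ I.IsCorrect φ ⟨T, num⟩ := Iff.rfl

theorem initial_nat_le {K : Type*} [Field K] (w : K → ℕ) (I : Input K) (a i j : ℕ) :
    I.initial.nat a i j ≤ I.size w := by
  simp only [initial, size]
  split <;> omega

theorem entry_cost_le {K : Type*} [Field K] (w : K → ℕ) {m d N : ℕ} (f : Fin m → Fin d → K)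
    (h0 : w 0 ≤ N) (h : ∑ i, ∑ j, w (f i j) ≤ N) (i j : ℕ) : w (entry f i j) ≤ N := by
  unfold entry
  split_ifs with hij
  · refine le_trans ?_ h
    refine le_trans ?_ (Finset.single_le_sum (f := fun i => ∑ j, w (f i j))
      (fun _ _ => Nat.zero_le _) (Finset.mem_univ (⟨i, hij.1⟩ : Fin m)))
    exact Finset.single_le_sum (f := fun j => w (f ⟨i, hij.1⟩ j))
      (fun _ _ => Nat.zero_le _) (Finset.mem_univ (⟨j, hij.2⟩ : Fin d))
  · exact h0

theorem initial_num_le {K : Type*} [Field K] {w : K → ℕ} (hw : IsCost w) (I : Input K)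
    (a i j : ℕ) : w (I.initial.num a i j) ≤ I.size w + 2 := by
  have h0 : w 0 ≤ 2 := by simpa [ratCost] using hw.const 0
  have hs : I.size w = I.d + I.n + I.k + (∑ i, ∑ j, w (I.left i j) + ∑ i, ∑ j, w (I.right i j)) +
      ((∑ i, ∑ j, w (I.base i j) + ∑ i, ∑ j, w (I.dir₁ i j)) + ∑ i, ∑ j, w (I.dir₂ i j)) := by
    simp only [size, Finset.sum_add_distrib]
  match a with
  | 0 => exact entry_cost_le w _ (by omega) (by omega) i j
  | 1 => exact entry_cost_le w _ (by omega) (by omega) i j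
  | 2 => exact entry_cost_le w _ (by omega) (by omega) i j
  | 3 => exact entry_cost_le w _ (by omega) (by omega) i j
  | 4 => exact entry_cost_le w _ (by omega) (by omega) i j
  | n + 5 => exact h0.trans (by omega)

/-- The capacity of the memory cells. -/
def capacity {K : Type*} (I : Input K) : ℕ :=
  -- The first two summands dominate (k - 1) |K| + |K| ^ 4, the largest number of colors; the others
  -- leave room for indices, loop bounds and small constants.
  I.n * I.n * (I.n * I.n) + I.k * I.n + I.n + I.k + I.d + 5

/-- The memory after the capacity has been computed. -/
def start {K : Type*} [Zero K] (I : Input K) : Mem := update I.initial.nat 9 0 0 I.capacity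

end Input

def capacityExpr : NatExpr :=
  let d := NatExpr.read 0 (.const 0) (.const 0)
  let n := NatExpr.read 0 (.const 0) (.const 1)
  let k := NatExpr.read 0 (.const 0) (.const 2)
  .add (.add (.add (.add (.add (.mul (.mul n n) (.mul n n)) (.mul k n)) n) k) d) (.const 5)

theorem capacityExpr_eval {K : Type*} [Zero K] (I : Input K) :
    capacityExpr.eval I.initial = I.capacity := rfl

/-- The capacity is stored by an instruction outside the truncated language, since truncation
already relies on it. -/
def Code.toProgram (Q : Code) : Program :=
  .seq (.setNat 9 (.const 0) (.const 0) capacityExpr) Q.compile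

open Polynomial in
/-- A correct program of the language with bounded loops solves the problem in polynomial time, in
every model of costs. -/
theorem exists_solvesInTime (Q : Code) (hQ : Q.WellFormed)
    (h : ∀ I : Input ℝ, I.IsValid (RingHom.id ℝ) → I.IsCorrect (RingHom.id ℝ)
      ⟨Q.exec I.initial.num I.capacity I.start, I.initial.num⟩) :
    ∃ p : ℕ[X], ∀ (K : Type) [Field K] [LinearOrder K] (φ : K →+* ℝ) (w : K → ℕ), StrictMono φ →
      IsCost w → SolvesInTime φ w (Code.toProgram Q) p := by
  -- The 3 pays for the two zero addresses and the instruction that stores the capacity; the 2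
  -- covers the cost of a field cell that contains zero. The inner polynomial bounds all cells when
  -- `Q` starts.
  refine ⟨capacityExpr.costBound + 3 + Q.costBound.comp (capacityExpr.valueBound + X + 2), ?_⟩
  intro K _ _ φ w hφ hw I hI
  set N := (capacityExpr.valueBound + X + 2).eval (I.size w) with hN
  have hN' : N = capacityExpr.valueBound.eval (I.size w) + I.size w + 2 := by
    rw [hN]; simp
  have hcap : I.capacity ≤ capacityExpr.valueBound.eval (I.size w) := by
    rw [← capacityExpr_eval]
    exact NatExpr.eval_le (I.initial_nat_le w) _
  have hstart : ∀ a i j, I.start a i j ≤ N :=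
    Code.update_le (fun a i j => (I.initial_nat_le w a i j).trans (by omega)) (by omega) _ _ _
  obtain ⟨⟨t, ht, hr⟩, -⟩ := Code.runs_compile I.initial.num (N := N) (c := I.capacity) hw
    (fun a i j => (I.initial_num_le hw a i j).trans (by omega)) (by omega) Q hQ I.start hstart
    (by simp [Input.start, Machine.update])
  have h1 := Runs.setNat (w := w) I.initial 9 (.const 0) (.const 0) capacityExpr
  rw [capacityExpr_eval] at h1
  refine ⟨_, _, Runs.seq h1 hr, ?_, ?_⟩
  · have := capacityExpr.cost_le (I.initial_nat_le w)
    simp only [eval_add, eval_comp, ← hN, NatExpr.cost, natCost, Nat.size_zero,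
      show (3 : ℕ[X]) = C 3 from rfl, eval_C]
    omega
  · rw [← Input.isCorrect_map φ I _ _ (I.map φ).initial.num, Code.exec_map φ _ _ hφ,
      ← Input.initial_map_num]
    exact h (I.map φ) ((Input.isValid_map φ I).2 hI)

end Geom

/-! ### Derived tests and proof rules for code. -/

namespace Machine

namespace Test

def or (b c : Test) : Test := .not (.and (.not b) (.not c))

def natEq (x y : NatExpr) : Test := .and (.not (.natLt x y)) (.not (.natLt y x))

def numEq (x y : NumExpr) : Test := .and (.not (.numLt x y)) (.not (.numLt y x))

def numLe (x y : NumExpr) : Test := .not (.numLt y x)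

variable {K : Type*} [Field K] [LinearOrder K] (σ : State K)

theorem holds_or (b c : Test) : (b.or c).Holds σ ↔ b.Holds σ ∨ c.Holds σ := by
  simp only [or, Holds]; tauto

theorem holds_natEq (x y : NatExpr) : (natEq x y).Holds σ ↔ x.eval σ = y.eval σ := by
  simp only [natEq, Holds]; omega

theorem holds_numEq (x y : NumExpr) : (numEq x y).Holds σ ↔ x.eval σ = y.eval σ := by
  simp only [numEq, Holds, not_lt]; exact ⟨fun h => le_antisymm h.2 h.1, fun h => ⟨h.ge, h.le⟩⟩

theorem holds_numLe (x y : NumExpr) : (numLe x y).Holds σ ↔ x.eval σ ≤ y.eval σ := by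
  simp only [numLe, Holds, not_lt]

end Test

/-- Induction over a loop, for a property of a part `π` of the memory that does not depend on the
loop variable. -/
theorem Code.loop_rule {K : Type*} [Field K] [LinearOrder K] {num : ℕ → ℕ → ℕ → K} {c : ℕ}
    {v : ℕ} {b : NatExpr} {P : Code} {T : Mem} {N : ℕ} {α : Type*} (π : Mem → α)
    (Inv : ℕ → α → Prop) (hπ : ∀ T' x, π (update T' v 0 0 x) = π T')
    (hN : b.eval (⟨T, num⟩ : State K) = N) (hNc : N ≤ c) (h0 : Inv 0 (π T))
    (hs : ∀ i T', i < N → T' v 0 0 = i → (∀ a, a ≠ v → a ∉ P.writes → T' a = T a) → Inv i (π T') →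
      Inv (i + 1) (π (P.exec num c T'))) :
    Inv N (π ((loop v b P).exec num c T)) := by
  refine Code.loop_induction num c (fun i T => Inv i (π T)) (by rw [hN]; omega) ?_ ?_
  · show Inv 0 (π _)
    rw [hπ]; exact h0
  · intro i T' hi h1 h2 h3
    show Inv (i + 1) (π _)
    rw [hπ]; exact hs i T' hi h1 h2 h3

theorem Code.exec_ite {K : Type*} [Field K] [LinearOrder K] (num : ℕ → ℕ → ℕ → K) (c : ℕ)
    (b : Test) (P Q : Code) (T : Mem) :
    (b.Holds ⟨T, num⟩ ∧ (ite b P Q).exec num c T = P.exec num c T) ∨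
      (¬ b.Holds ⟨T, num⟩ ∧ (ite b P Q).exec num c T = Q.exec num c T) := by
  by_cases h : b.Holds ⟨T, num⟩ <;> simp [Code.exec, h]

theorem Code.exec_set {K : Type*} [Field K] [LinearOrder K] {num : ℕ → ℕ → ℕ → K} {c : ℕ}
    {a i' j' v : ℕ} {i j e : NatExpr} {T : Mem} (hi : i.eval (⟨T, num⟩ : State K) = i')
    (hj : j.eval (⟨T, num⟩ : State K) = j') (he : e.eval (⟨T, num⟩ : State K) = v) (hv : v ≤ c) :
    (set a i j e).exec num c T = update T a i' j' v := by
  simp only [Code.exec, hi, hj, he, min_eq_left hv]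

/-- The entry in a row of a one-dimensional array. -/
def arr (a : ℕ) (i : NatExpr) : NatExpr := .read a i (.const 0)

end Machine

/-! ### Heights in the four orders. -/

namespace Geom

namespace Algorithm

open Machine

def dimE : NatExpr := .read 0 (.const 0) (.const 0)
def segE : NatExpr := .read 0 (.const 0) (.const 1)
def planeE : NatExpr := .read 0 (.const 0) (.const 2)
def isPos (e : NatExpr) : Test := .natLt (.const 0) e
def setCell (a : ℕ) (e : NatExpr) : Code := .set a (.const 0) (.const 0) e
def setArr (a : ℕ) (i e : NatExpr) : Code := .set a i (.const 0) e
def cond (b : Test) (P : Code) : Code := .ite b P .skip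

theorem exec_cond (num : ℕ → ℕ → ℕ → ℝ) (c : ℕ) (b : Test) (P : Code) (T : Mem) :
    (b.Holds ⟨T, num⟩ ∧ (cond b P).exec num c T = P.exec num c T) ∨
      (¬ b.Holds ⟨T, num⟩ ∧ (cond b P).exec num c T = T) :=
  Code.exec_ite num c b P .skip T

/-- Whether segment `s` precedes segment `t` in the order number `a`. -/
def relE (a s t : NatExpr) : Test := isPos (.read 7 (.add (.mul a segE) s) t)

/-- Table `11` marks the segments of the plane number `20` that have not been colored yet. -/
def markStage : Code :=
  .loop 21 segE (.ite (.and (.natEq (arr 4 (cell 21)) (cell 20)) (.natEq (arr 3 (cell 21)) (.const 0)))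
    (setArr 11 (cell 21) (.const 1)) (setArr 11 (cell 21) (.const 0)))

/-- Table `10` receives the heights of the marked segments in the four orders. -/
def heightsBody : Code :=
  cond (.and (.and (isPos (arr 11 (cell 22))) (isPos (arr 11 (cell 21))))
      (.and (relE (cell 24) (cell 22) (cell 21))
        (.not (.natLt (.read 10 (cell 24) (cell 22)) (cell 25)))))
    (.set 10 (cell 24) (cell 21) (.add (cell 25) (.const 1)))

/-- In round `q`, the value of cell `25`, an element with a predecessor of current height at least
`q` gets height `q + 1`. This is done for each of the four orders, with `n` rounds. -/
def heights : Code :=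
  .loop 24 (.const 4) (.loop 25 segE (.loop 21 segE (.loop 22 segE heightsBody)))

/-- The elements of `U` at height at least `q`. -/
def Level (U : ℕ → Prop) (r : ℕ → ℕ → Prop) : ℕ → ℕ → Prop
  | 0, t => U t
  | q + 1, t => U t ∧ ∃ s, Level U r q s ∧ r s t

theorem Level.mem {U : ℕ → Prop} {r : ℕ → ℕ → Prop} {q t : ℕ} (h : Level U r q t) : U t := by
  cases q with
  | zero => exact h
  | succ q => exact h.1

/-- The state of the computation of heights in round `q`, when the pairs `Q` have been treated. -/
def HeightInv (U : ℕ → Prop) (r : ℕ → ℕ → Prop) (q : ℕ) (Q : ℕ → ℕ → Prop) (H : ℕ → ℕ) : Prop :=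
  ∀ t, U t → H t ≤ q + 1 ∧ (∀ p ≤ q, p ≤ H t ↔ Level U r p t) ∧
    (H t = q + 1 ↔ ∃ s, Q t s ∧ Level U r q s ∧ r s t)

section

variable {U : ℕ → Prop} {r : ℕ → ℕ → Prop} {q : ℕ} {Q Q' : ℕ → ℕ → Prop} {H : ℕ → ℕ}

theorem HeightInv.congr (h : HeightInv U r q Q H)
    (hQ : ∀ t s, U t → U s → (Q t s ↔ Q' t s)) : HeightInv U r q Q' H := by
  intro t ht
  obtain ⟨h1, h2, h3⟩ := h t ht
  refine ⟨h1, h2, h3.trans ?_⟩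
  constructor
  · rintro ⟨s, h4, h5, h6⟩; exact ⟨s, (hQ t s ht h5.mem).1 h4, h5, h6⟩
  · rintro ⟨s, h4, h5, h6⟩; exact ⟨s, (hQ t s ht h5.mem).2 h4, h5, h6⟩

theorem HeightInv.zero (h : ∀ t, U t → H t = 0) : HeightInv U r 0 (fun _ _ => False) H := by
  intro t ht
  rw [h t ht]
  refine ⟨by omega, fun p hp => ?_, by simp⟩
  obtain rfl : p = 0 := by omega
  exact ⟨fun _ => ht, fun _ => le_rfl⟩

/-- When every pair has been treated, the value `q + 1` is taken exactly on the level `q + 1`, so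
one more threshold is correct. -/
theorem HeightInv.succ (h : HeightInv U r q (fun _ _ => True) H) :
    HeightInv U r (q + 1) (fun _ _ => False) H := by
  intro t ht
  obtain ⟨h1, h2, h3⟩ := h t ht
  refine ⟨by omega, fun p hp => ?_, ?_⟩
  · rcases Nat.lt_or_ge p (q + 1) with hp' | hp'
    · exact h2 p (by omega)
    · obtain rfl : p = q + 1 := by omega
      rw [show q + 1 ≤ H t ↔ H t = q + 1 by omega, h3]
      simp [Level, ht]
  · simp; omega

/-- An assignment in the middle of a round does not disturb the remaining tests of the round, which
only ask whether a height is at least `q`. The new value is legitimate: a predecessor on all the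
levels up to `q` puts `t` on all the levels up to `q + 1`. -/
theorem HeightInv.step_true (h : HeightInv U r q Q H) {s t : ℕ} (hs : U s) (hr : r s t)
    (hq : q ≤ H s) : HeightInv U r q (fun t' s' => Q t' s' ∨ (t' = t ∧ s' = s))
      (fun t' => if t' = t then q + 1 else H t') := by
  intro t' ht'
  obtain ⟨h1, h2, h3⟩ := h t' ht'
  have hlev := ((h s hs).2.1 q le_rfl).1 hq
  dsimp only
  split_ifs with htt
  · subst htt
    refine ⟨le_rfl, fun p hp => ?_, ?_⟩
    · constructor
      · intro _
        have : ∀ p ≤ q, Level U r (p + 1) t' := by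
          intro p hp
          exact ⟨ht', s, ((h s hs).2.1 p hp).1 (hp.trans hq), hr⟩
        rcases p with _ | p
        · exact ht'
        · exact this p (by omega)
      · intro _; omega
    · exact ⟨fun _ => ⟨s, Or.inr ⟨rfl, rfl⟩, hlev, hr⟩, fun _ => rfl⟩
  · refine ⟨h1, h2, h3.trans ?_⟩
    simp [htt]

theorem HeightInv.step_false (h : HeightInv U r q Q H) {s t : ℕ}
    (hn : ¬ (U s ∧ U t ∧ r s t ∧ q ≤ H s)) :
    HeightInv U r q (fun t' s' => Q t' s' ∨ (t' = t ∧ s' = s)) H := by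
  intro t' ht'
  obtain ⟨h1, h2, h3⟩ := h t' ht'
  refine ⟨h1, h2, h3.trans ?_⟩
  constructor
  · rintro ⟨s', h4, h5, h6⟩; exact ⟨s', Or.inl h4, h5, h6⟩
  · rintro ⟨s', h4 | ⟨rfl, rfl⟩, h5, h6⟩
    · exact ⟨s', h4, h5, h6⟩
    · exact absurd ⟨h5.mem, ht', h6, ((h s' h5.mem).2.1 q le_rfl).2 h5⟩ hn

end

variable {num : ℕ → ℕ → ℕ → ℝ} {c n : ℕ}

/-- The marked segments. -/
def Marked (n : ℕ) (T : Mem) (t : ℕ) : Prop := t < n ∧ 0 < T 11 t 0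

/-- The orders stored in the memory. -/
def Rel (n : ℕ) (T : Mem) (a s t : ℕ) : Prop := 0 < T 7 (a * n + s) t

/-- Table `10` is never cleared. The heights still start at zero because a segment is marked only in
the stage of its own plane and unmarked entries are left alone; this is why the second conclusion is
recorded. -/
theorem heights_spec (T : Mem) (hn : T 0 0 1 = n) (hc : n + 5 ≤ c)
    (hz : ∀ a < 4, ∀ t, Marked n T t → T 10 a t = 0) :
    (∀ a < 4, HeightInv (Marked n T) (Rel n T a) n (fun _ _ => False)
        (heights.exec num c T 10 a)) ∧
      ∀ a t, ¬ Marked n T t → heights.exec num c T 10 a t = T 10 a t := by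
  have key := Code.loop_rule (num := num) (c := c) (v := 24) (b := .const 4) (N := 4)
    (P := .loop 25 segE (.loop 21 segE (.loop 22 segE heightsBody))) (T := T) (fun T' => T' 10)
    (fun a H => (∀ a' < a, HeightInv (Marked n T) (Rel n T a') n (fun _ _ => False) (H a')) ∧
      (∀ a' ≥ a, H a' = T 10 a') ∧ ∀ a t, ¬ Marked n T t → H a t = T 10 a t)
    (fun T' x => update_of_ne _ (by decide) _ _ _) rfl (by omega) (by simp) ?_
  · exact ⟨key.1, key.2.2⟩
  intro a T₁ ha ha₁ hf₁ ⟨h1, h2, h3⟩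
  have hfr₁ : ∀ b ∈ [0, 7, 11], T₁ b = T b := by
    intro b hb; fin_cases hb <;> exact hf₁ _ (by decide) (by decide)
  have key := Code.loop_rule (num := num) (c := c) (v := 25) (b := segE) (N := n)
    (P := .loop 21 segE (.loop 22 segE heightsBody)) (T := T₁) (fun T' => T' 10)
    (fun q H => HeightInv (Marked n T) (Rel n T a) q (fun _ _ => False) (H a) ∧
      (∀ a' ≠ a, H a' = T₁ 10 a') ∧ ∀ a t, ¬ Marked n T t → H a t = T 10 a t)
    (fun T' x => update_of_ne _ (by decide) _ _ _)
    (by simp [segE, NatExpr.eval, hfr₁ 0, hn]) (by omega)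
    ⟨.zero fun t ht => by rw [h2 a le_rfl]; exact hz a ha t ht, fun _ _ => rfl, h3⟩ ?_
  · refine ⟨fun a' ha' => ?_, fun a' ha' => ?_, key.2.2⟩
    · rcases Nat.lt_or_ge a' a with h | h
      · rw [key.2.1 a' (by omega)]; exact h1 a' h
      · obtain rfl : a' = a := by omega
        exact key.1
    · rw [key.2.1 a' (by omega)]; exact h2 a' (by omega)
  intro q T₂ hq hq₂ hf₂ ⟨g1, g2, g3⟩
  have hfr₂ : ∀ b ∈ [0, 7, 11, 24], T₂ b = T₁ b := by
    intro b hb; fin_cases hb <;> exact hf₂ _ (by decide) (by decide)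
  have key := Code.loop_rule (num := num) (c := c) (v := 21) (b := segE) (N := n)
    (P := .loop 22 segE heightsBody) (T := T₂) (fun T' => T' 10)
    (fun t H => HeightInv (Marked n T) (Rel n T a) q (fun t' _ => t' < t) (H a) ∧
      (∀ a' ≠ a, H a' = T₁ 10 a') ∧ ∀ a t, ¬ Marked n T t → H a t = T 10 a t)
    (fun T' x => update_of_ne _ (by decide) _ _ _)
    (by simp [segE, NatExpr.eval, hfr₁ 0, hfr₂ 0, hn]) (by omega)
    ⟨g1.congr (by simp), g2, g3⟩ ?_
  · exact ⟨(key.1.congr fun t s ht _ => by simp [ht.1]).succ, key.2⟩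
  intro t T₃ ht ht₃ hf₃ ⟨e1, e2, e3⟩
  have hfr₃ : ∀ b ∈ [0, 7, 11, 24, 25], T₃ b = T₂ b := by
    intro b hb; fin_cases hb <;> exact hf₃ _ (by decide) (by decide)
  have key := Code.loop_rule (num := num) (c := c) (v := 22) (b := segE) (N := n)
    (P := heightsBody) (T := T₃) (fun T' => T' 10)
    -- The treated pairs are those that precede `(t, s)` lexicographically.
    (fun s H => HeightInv (Marked n T) (Rel n T a) q (fun t' s' => t' < t ∨ t' = t ∧ s' < s) (H a) ∧
      (∀ a' ≠ a, H a' = T₁ 10 a') ∧ ∀ a t, ¬ Marked n T t → H a t = T 10 a t)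
    (fun T' x => update_of_ne _ (by decide) _ _ _)
    (by simp [segE, NatExpr.eval, hfr₁ 0, hfr₂ 0, hfr₃ 0, hn]) (by omega)
    ⟨e1.congr (by simp), e2, e3⟩ ?_
  · refine ⟨key.1.congr fun t' s _ hs => ?_, key.2⟩
    have := hs.1
    constructor
    · rintro (h | h) <;> omega
    · intro h; omega
  intro s T₄ hs hs₄ hf₄ ⟨d1, d2, d3⟩
  have hfr₄ : ∀ b ∈ [0, 7, 11, 24, 25, 21], T₄ b = T₃ b := by
    intro b hb; fin_cases hb <;> exact hf₄ _ (by decide) (by decide)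
  have e11 : T₄ 11 = T 11 := by simp [hfr₄, hfr₃, hfr₂, hfr₁]
  have e7 : T₄ 7 = T 7 := by simp [hfr₄, hfr₃, hfr₂, hfr₁]
  have e0 : T₄ 0 0 1 = n := by simp [hfr₄, hfr₃, hfr₂, hfr₁, hn]
  have e24 : T₄ 24 0 0 = a := by simp [hfr₄, hfr₃, hfr₂, ha₁]
  have e25 : T₄ 25 0 0 = q := by simp [hfr₄, hfr₃, hq₂]
  have e21 : T₄ 21 0 0 = t := by simp [hfr₄, ht₃]
  have hQ : ∀ t' s' : ℕ, (t' < t ∨ t' = t ∧ s' < s) ∨ (t' = t ∧ s' = s) ↔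
      (t' < t ∨ t' = t ∧ s' < s + 1) := by intros; omega
  rcases exec_cond num c _ _ T₄ with ⟨h, he⟩ | ⟨h, he⟩ <;> rw [heightsBody, he] <;>
    simp only [Test.Holds, isPos, relE, NatExpr.eval, arr, cell, segE, e11, e7, e0, e24, e25, e21,
      hs₄, not_lt] at h
  · obtain ⟨⟨k1, k2⟩, k3, k4⟩ := h
    rw [Code.exec_set (i' := a) (j' := t) (v := q + 1) (by exact e24) (by exact e21)
      (by simp [NatExpr.eval, cell, e25]) (by omega)]
    refine ⟨?_, fun a' ha' => ?_, fun a' t' ht' => ?_⟩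
    · have := (d1.step_true (t := t) ⟨hs, k1⟩ k3 k4).congr (fun t' s' _ _ => hQ t' s')
      convert this using 2
      simp [update_same]
    · funext t'
      simp [update_same, ha', d2 a' ha']
    · have : t' ≠ t := by rintro rfl; exact ht' ⟨ht, k2⟩
      simp [update_same, this, d3 a' t' ht']
  · refine ⟨(d1.step_false (s := s) (t := t) ?_).congr (fun t' s' _ _ => hQ t' s'), d2, d3⟩
    rintro ⟨k1, k2, k3, k4⟩
    exact h ⟨⟨k1.2, k2.2⟩, k3, k4⟩

end Algorithm

end Geom

/-! ### Longest chains. -/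

namespace Geom

namespace Algorithm

open Machine

/-- `r` is a strict order on `U`. -/
structure StrictOn (U : ℕ → Prop) (r : ℕ → ℕ → Prop) : Prop where
  irrefl : ∀ t, U t → ¬ r t t
  trans : ∀ s t u, U s → U t → U u → r s t → r t u → r s u

section

variable {U : ℕ → Prop} {r : ℕ → ℕ → Prop} {n : ℕ} {H : ℕ → ℕ}

/-- By transitivity the set of predecessors grows strictly along a chain, so an element of level `q`
has at least `q` predecessors below `n`, and it is not one of them itself. -/
theorem StrictOn.level_lt (hr : StrictOn U r) (hU : ∀ t, U t → t < n) {q t : ℕ}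
    (h : Level U r q t) : q < n := by
  classical
  have key : ∀ q t, Level U r q t →
      q ≤ ((Finset.range n).filter fun s => U s ∧ r s t).card := by
    intro q
    induction q with
    | zero => intros; omega
    | succ q ih =>
      rintro t ⟨ht, s, hs, hst⟩
      refine (Nat.succ_le_succ (ih s hs)).trans (Nat.succ_le_of_lt (Finset.card_lt_card ?_))
      refine ⟨fun u hu => ?_, fun hsub => ?_⟩
      · simp only [Finset.mem_filter] at hu ⊢
        exact ⟨hu.1, hu.2.1, hr.trans _ _ _ hu.2.1 hs.mem ht hu.2.2 hst⟩
      · have := hsub (Finset.mem_filter.2 ⟨Finset.mem_range.2 (hU s hs.mem), hs.mem, hst⟩)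
        simp only [Finset.mem_filter] at this
        exact hr.irrefl s hs.mem this.2.2
  refine (key q t h).trans_lt ?_
  calc _ < (Finset.range n).card := Finset.card_lt_card ⟨Finset.filter_subset _ _, fun hsub => ?_⟩
    _ = n := by simp
  have := hsub (Finset.mem_range.2 (hU t h.mem))
  simp only [Finset.mem_filter] at this
  exact hr.irrefl t h.mem this.2.2

/-- `H` is the height function of the relation `r` on `U`. -/
structure IsHeight (U : ℕ → Prop) (r : ℕ → ℕ → Prop) (n : ℕ) (H : ℕ → ℕ) : Prop where
  lt : ∀ t, U t → H t < n
  mono : ∀ s t, U s → U t → r s t → H s < H t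
  pred : ∀ q t, U t → H t = q + 1 → ∃ s, U s ∧ r s t ∧ H s = q

/-- The level `n` is empty, so the `n` rounds have decided every threshold that matters. A
predecessor on the level `q` of an element of height `q + 1` has height exactly `q` by monotonicity.
-/
theorem HeightInv.isHeight (h : HeightInv U r n (fun _ _ => False) H) (hr : StrictOn U r)
    (hU : ∀ t, U t → t < n) : IsHeight U r n H := by
  have hn : ∀ t, U t → H t ≤ n := by
    intro t ht
    obtain ⟨h1, -, h3⟩ := h t ht
    simp at h3; omega
  have hlev : ∀ q t, U t → q ≤ n → (q ≤ H t ↔ Level U r q t) := fun q t ht hq => (h t ht).2.1 q hq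
  have hlt : ∀ t, U t → H t < n := fun t ht =>
    hr.level_lt hU ((hlev _ t ht (hn t ht)).1 le_rfl)
  have hmono : ∀ s t, U s → U t → r s t → H s < H t := by
    intro s t hs ht hst
    exact (hlev (H s + 1) t ht (hlt s hs)).2 ⟨ht, s, (hlev _ s hs (hn s hs)).1 le_rfl, hst⟩
  refine ⟨hlt, hmono, fun q t ht hq => ?_⟩
  obtain ⟨-, s, hs, hst⟩ := (hlev (q + 1) t ht (hq ▸ hn t ht)).1 hq.ge
  have h1 := (hlev q s hs.mem (by have := hn t ht; omega)).2 hs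
  have h2 := hmono s t hs.mem ht hst
  exact ⟨s, hs.mem, hst, by omega⟩

end

/-- Cell `12` receives the maximal number of elements of a chain of marked segments, and the cells
`13` and `14` the top element and the order of such a chain. -/
def maxHeightBody : Code :=
  cond (.and (isPos (arr 11 (cell 21)))
      (.not (.natLt (.read 10 (cell 24) (cell 21)) (cell 12))))
    (.seq (setCell 12 (.add (.read 10 (cell 24) (cell 21)) (.const 1)))
      (.seq (setCell 13 (cell 21)) (setCell 14 (cell 24))))

def maxHeight : Code :=
  .seq (setCell 12 (.const 0)) (.loop 24 (.const 4) (.loop 21 segE maxHeightBody))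

/-- Table `1` receives a maximum chain. -/
def chainBody : Code :=
  cond (.and (.and (isPos (arr 11 (cell 22))) (relE (cell 14) (cell 22) (cell 15)))
      (.natEq (.add (.read 10 (cell 14) (cell 22)) (.const 1)) (.read 10 (cell 14) (cell 15))))
    (.seq (setArr 1 (cell 22) (.const 1)) (setCell 15 (cell 22)))

/-- Cell `15` holds the current bottom of the chain. Whenever the scan finds a predecessor whose
height is smaller by one, that predecessor joins the chain and becomes the bottom. -/
def chain : Code :=
  cond (isPos (cell 12)) (.seq (setArr 1 (cell 13) (.const 1)) (.seq (setCell 15 (cell 13))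
    (.loop 25 segE (.loop 22 segE chainBody))))

variable {num : ℕ → ℕ → ℕ → ℝ} {c n : ℕ}

theorem maxHeight_spec (T : Mem) (hn : T 0 0 1 = n) (hc : n + 5 ≤ c)
    (hH : ∀ a < 4, ∀ t, Marked n T t → T 10 a t < n) :
    (∀ a < 4, ∀ t, Marked n T t → T 10 a t < maxHeight.exec num c T 12 0 0) ∧
      (maxHeight.exec num c T 12 0 0 = 0 ∨ maxHeight.exec num c T 14 0 0 < 4 ∧
        Marked n T (maxHeight.exec num c T 13 0 0) ∧
        T 10 (maxHeight.exec num c T 14 0 0) (maxHeight.exec num c T 13 0 0) + 1 =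
          maxHeight.exec num c T 12 0 0) := by
  set Inv : (ℕ → ℕ → Prop) → ℕ × ℕ × ℕ → Prop := fun Q p =>
    (∀ a < 4, ∀ t, Q a t → Marked n T t → T 10 a t < p.1) ∧
      (p.1 = 0 ∨ p.2.2 < 4 ∧ Marked n T p.2.1 ∧ T 10 p.2.2 p.2.1 + 1 = p.1) with hInv
  set π : Mem → ℕ × ℕ × ℕ := fun T => (T 12 0 0, T 13 0 0, T 14 0 0) with hπ
  set T₀ := update T 12 0 0 0 with hT₀
  have e0 : (setCell 12 (.const 0)).exec num c T = T₀ := by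
    simp [setCell, Code.exec, NatExpr.eval, T₀]
  simp only [maxHeight, Code.exec, e0]
  have key := Code.loop_rule (num := num) (c := c) (v := 24) (b := .const 4) (N := 4)
    (P := .loop 21 segE maxHeightBody) (T := T₀) π
    (fun a p => Inv (fun a' _ => a' < a) p)
    (fun T' x => by simp [π, update_of_ne]) rfl (by omega)
    (by simp [hInv, hπ, hT₀, update_same]) ?_
  · exact ⟨fun a ha t ht => key.1 a ha t ha ht, key.2⟩
  intro a T₁ ha ha₁ hf₁ h1
  have hfr₁ : ∀ b ∈ [0, 10, 11], T₁ b = T b := by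
    intro b hb
    have : T₀ b = T b := by fin_cases hb <;> simp [hT₀, update_of_ne]
    rw [← this]
    fin_cases hb <;> exact hf₁ _ (by decide) (by decide)
  have key := Code.loop_rule (num := num) (c := c) (v := 21) (b := segE) (N := n)
    (P := maxHeightBody) (T := T₁) π
    (fun t p => Inv (fun a' t' => a' < a ∨ a' = a ∧ t' < t) p)
    (fun T' x => by simp [π, update_of_ne]) (by simp [segE, NatExpr.eval, hfr₁ 0, hn]) (by omega)
    (by simpa using h1) ?_
  · refine ⟨fun a' ha' t hQ ht => key.1 a' ha' t ?_ ht, key.2⟩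
    have := ht.1
    omega
  intro t T₂ ht ht₂ hf₂ h2
  have hfr₂ : ∀ b ∈ [0, 10, 11, 24], T₂ b = T₁ b := by
    intro b hb; fin_cases hb <;> exact hf₂ _ (by decide) (by decide)
  have e10 : T₂ 10 = T 10 := by simp [hfr₂, hfr₁]
  have e11 : T₂ 11 = T 11 := by simp [hfr₂, hfr₁]
  have e24 : T₂ 24 0 0 = a := by simp [hfr₂, ha₁]
  rcases exec_cond num c _ _ T₂ with ⟨h, he⟩ | ⟨h, he⟩ <;> rw [maxHeightBody, he] <;>
    simp only [Test.Holds, isPos, NatExpr.eval, arr, cell, e10, e11, e24, ht₂, not_lt] at h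
  · have hM : Marked n T t := ⟨ht, h.1⟩
    have hlt := hH a ha t hM
    simp only [Code.exec, setCell, NatExpr.eval, cell, e10, e24, ht₂, hπ]
    simp only [update_same, update_of_ne, e24, ht₂, ne_eq,
      not_false_eq_true, Nat.reduceEqDiff, and_self, if_true]
    rw [min_eq_left (by omega), min_eq_left (by omega), min_eq_left (by omega)]
    refine ⟨fun a' ha' t' hQ ht' => ?_, Or.inr ⟨ha, hM, rfl⟩⟩
    show T 10 a' t' < T 10 a t + 1
    by_cases hnew : a' = a ∧ t' = t
    · rw [hnew.1, hnew.2]; omega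
    · have := h2.1 a' ha' t' (by omega) ht'
      have h4 := h.2
      simp only [hπ] at this
      omega
  · refine ⟨fun a' ha' t' hQ ht' => ?_, h2.2⟩
    by_cases hnew : a' = a ∧ t' = t
    · rw [hnew.1, hnew.2]
      rw [hnew.2] at ht'
      simp only [hπ]
      by_contra h5
      exact h ⟨ht'.2, by omega⟩
    · exact h2.1 a' ha' t' (by omega) ht'

theorem chain_spec (T : Mem) (hn : T 0 0 1 = n) (hc : n + 5 ≤ c)
    (hr : ∀ a < 4, StrictOn (Marked n T) (Rel n T a))
    (hH : ∀ a < 4, IsHeight (Marked n T) (Rel n T a) n (T 10 a))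
    (hm : T 12 0 0 = 0 ∨ T 14 0 0 < 4 ∧ Marked n T (T 13 0 0) ∧
      T 10 (T 14 0 0) (T 13 0 0) + 1 = T 12 0 0) :
    ∃ C : Finset ℕ, (∀ s ∈ C, Marked n T s) ∧ C.card = T 12 0 0 ∧
      (∀ s ∈ C, ∀ t ∈ C, s ≠ t → ∃ a < 4, Rel n T a s t ∨ Rel n T a t s) ∧
      ∀ s, chain.exec num c T 1 s 0 = if s ∈ C then 1 else T 1 s 0 := by
  rcases exec_cond num c (isPos (cell 12)) _ T with ⟨h, he⟩ | ⟨h, he⟩ <;> rw [chain, he] <;>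
    simp only [Test.Holds, isPos, NatExpr.eval, cell] at h
  swap
  · exact ⟨∅, by simp, by simp; omega, by simp, by simp⟩
  replace hm := hm.resolve_left (by omega)
  set o := T 14 0 0
  set top := T 13 0 0
  obtain ⟨ho, htop, hm⟩ := hm
  set r := Rel n T o with hrdef
  replace hr := hr o ho
  have hH' := hH o ho
  set H := T 10 o with hHdef
  have htopn := htop.1
  set T₀ := update (update T 1 top 0 1) 15 0 0 top with hT₀
  have e0 : Code.exec num c ((setArr 1 (cell 13) (.const 1)).seq ((setCell 15 (cell 13)).seq
    (.loop 25 segE (.loop 22 segE chainBody)))) T =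
      (Code.loop 25 segE (.loop 22 segE chainBody)).exec num c T₀ := by
    have : min 1 c = 1 := by omega
    have h2 : min top c = top := by omega
    simp [Code.exec, setArr, setCell, NatExpr.eval, cell, update_of_ne, this, h2, T₀, top]
  rw [e0]
  -- Each descent adds one element and lowers the height of the bottom by one, so size plus height
  -- stays equal to the value of cell `12`; at height zero the size is as required.
  set J : ℕ × (ℕ → ℕ → ℕ) → Prop := fun p => ∃ C : Finset ℕ, p.1 ∈ C ∧
    (∀ s ∈ C, Marked n T s ∧ (s = p.1 ∨ r p.1 s)) ∧ C.card + H p.1 = T 12 0 0 ∧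
    (∀ s ∈ C, ∀ t ∈ C, s ≠ t → r s t ∨ r t s) ∧
    ∀ s, p.2 s 0 = if s ∈ C then 1 else T 1 s 0 with hJ
  set π : Mem → ℕ × (ℕ → ℕ → ℕ) := fun T => (T 15 0 0, T 1) with hπ
  have key := Code.loop_rule (num := num) (c := c) (v := 25) (b := segE) (N := n)
    (P := .loop 22 segE chainBody) (T := T₀) π
    -- Every pass lowers a positive height at least once, and possibly several times, so `n` passes
    -- reach zero.
    (fun q p => J p ∧ (H p.1 = 0 ∨ H p.1 + q ≤ n))
    (fun T' x => by simp [π, update_of_ne])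
    (by simp [segE, NatExpr.eval, hT₀, update_of_ne, hn]) (by omega) ?_ ?_
  · obtain ⟨⟨C, h1, h2, h3, h4, h5⟩, h6⟩ := key
    refine ⟨C, fun s hs => (h2 s hs).1, by omega,
      fun s hs t ht hst => ⟨o, ho, h4 s hs t ht hst⟩, h5⟩
  · have hlt := hH'.lt top htop
    refine ⟨⟨{top}, ?_, ?_, ?_, ?_, ?_⟩, Or.inr ?_⟩
    · simp [hπ, hT₀, update_same]
    · simp [hπ, hT₀, update_same, htop]
    · simp [hπ, hT₀, update_same]; omega
    · simp only [Finset.mem_singleton]; rintro s rfl t rfl h; exact absurd rfl h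
    · intro s; simp [hπ, hT₀, update_same, update_of_ne]
    · simp [hπ, hT₀, update_same]; omega
  intro q T₁ hq hq₁ hf₁ ⟨h1, h1'⟩
  have hfr₁ : ∀ b ∈ [0, 7, 10, 11, 14], T₁ b = T b := by
    intro b hb
    have : T₀ b = T b := by fin_cases hb <;> simp [hT₀, update_of_ne]
    rw [← this]
    fin_cases hb <;> exact hf₁ _ (by decide) (by decide)
  set cur := (π T₁).1 with hcur
  have key := Code.loop_rule (num := num) (c := c) (v := 22) (b := segE) (N := n)
    (P := chainBody) (T := T₁) π
    -- During a pass either a descent has happened or no suitable predecessor has been seen yet; the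
    -- second alternative cannot survive the whole pass when the height is positive, by
    -- `IsHeight.pred`.
    (fun s p => J p ∧ (H p.1 < H cur ∨ p.1 = cur ∧
      ∀ s' < s, ¬ (Marked n T s' ∧ r s' cur ∧ H s' + 1 = H cur)))
    (fun T' x => by simp [π, update_of_ne]) (by simp [segE, NatExpr.eval, hfr₁ 0, hn]) (by omega)
    ⟨h1, Or.inr ⟨rfl, by simp⟩⟩ ?_
  · refine ⟨key.1, ?_⟩
    rcases key.2 with h2 | ⟨h2, h3⟩
    · omega
    · rw [h2]
      left
      obtain ⟨C, h5, h6, -⟩ := h1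
      by_contra h4
      obtain ⟨p, hp⟩ := Nat.exists_eq_succ_of_ne_zero h4
      obtain ⟨s, hs, hs', hs''⟩ := hH'.pred p cur (h6 _ h5).1 hp
      exact h3 s hs.1 ⟨hs, hs', by omega⟩
  intro s T₂ hs hs₂ hf₂ ⟨h2, h2'⟩
  have hfr₂ : ∀ b ∈ [0, 7, 10, 11, 14], T₂ b = T₁ b := by
    intro b hb; fin_cases hb <;> exact hf₂ _ (by decide) (by decide)
  have e10 : T₂ 10 = T 10 := by simp [hfr₂, hfr₁]
  have e11 : T₂ 11 = T 11 := by simp [hfr₂, hfr₁]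
  have e7 : T₂ 7 = T 7 := by simp [hfr₂, hfr₁]
  have e14 : T₂ 14 0 0 = o := by simp [hfr₂, hfr₁, o]
  have e00 : T₂ 0 0 1 = n := by simp [hfr₂, hfr₁, hn]
  have e15 : (π T₂).1 = T₂ 15 0 0 := rfl
  rw [e15] at h2'
  obtain ⟨C, c1, c2, c3, c4, c5⟩ := h2
  rw [e15] at c1 c2 c3
  rcases exec_cond num c _ _ T₂ with ⟨h, he⟩ | ⟨h, he⟩ <;> rw [chainBody, he] <;>
    simp only [Test.Holds, Test.holds_natEq, relE, isPos, NatExpr.eval, arr, cell, segE, e10, e11,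
      e7, e14, e00, hs₂, ← hHdef] at h
  · obtain ⟨⟨k1, k2⟩, k3⟩ := h
    change r s (T₂ 15 0 0) at k2
    have hM : Marked n T s := ⟨hs, k1⟩
    have hs' : ∀ x ∈ C, r s x := by
      intro x hx
      rcases (c2 x hx).2 with rfl | h5
      · exact k2
      · exact hr.trans _ _ _ hM (c2 _ c1).1 (c2 x hx).1 k2 h5
    have hsC : s ∉ C := fun h => hr.irrefl s hM (hs' s h)
    have e : π (Code.exec num c ((setArr 1 (cell 22) (.const 1)).seq (setCell 15 (cell 22))) T₂) =
        (s, fun i j => if i = s ∧ j = 0 then 1 else T₂ 1 i j) := by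
      have : min 1 c = 1 := by omega
      have h2 : min s c = s := by omega
      simp only [hπ, Code.exec, setArr, setCell, NatExpr.eval, cell, hs₂, this]
      simp [update_of_ne, update_same, hs₂, h2]
      funext i j
      simp [update_same]
    rw [e]
    refine ⟨⟨insert s C, by simp, ?_, ?_, ?_, ?_⟩, ?_⟩
    · intro x hx
      rcases Finset.mem_insert.1 hx with rfl | hx
      · exact ⟨hM, Or.inl rfl⟩
      · exact ⟨(c2 x hx).1, Or.inr (hs' x hx)⟩
    · rw [Finset.card_insert_of_notMem hsC]
      show _ + H s = _
      omega
    · intro x hx y hy hxy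
      rcases Finset.mem_insert.1 hx with hx' | hx' <;>
        rcases Finset.mem_insert.1 hy with hy' | hy'
      · exact absurd (hx'.trans hy'.symm) hxy
      · exact Or.inl (hx' ▸ hs' y hy')
      · exact Or.inr (hy' ▸ hs' x hx')
      · exact c4 x hx' y hy' hxy
    · intro x
      have := c5 x
      simp only [hπ] at this
      by_cases hx : x = s <;> simp [hx, this]
    · left
      show H s < _
      rcases h2' with h5 | ⟨h5, -⟩
      · omega
      · rw [h5] at k3; omega
  · refine ⟨⟨C, c1, c2, c3, c4, c5⟩, ?_⟩
    rcases h2' with h5 | ⟨h5, h6⟩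
    · exact Or.inl h5
    · refine Or.inr ⟨h5, fun s' hs' hbad => ?_⟩
      rcases Nat.lt_succ_iff_lt_or_eq.1 hs' with h7 | rfl
      · exact h6 s' h7 hbad
      · rw [h5] at h
        exact h ⟨⟨hbad.1.2, hbad.2.1⟩, hbad.2.2⟩

end Algorithm

end Geom

/-! ### Colors from heights, and partial proper colorings. -/

namespace Geom

namespace Algorithm

open Machine

/-- The marked segments are colored according to their heights in the four orders. -/
def colorExpr : NatExpr :=
  .add (cell 16) (.add (.mul (.add (.mul (.add (.mul (.read 10 (.const 0) (cell 21)) (cell 12))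
    (.read 10 (.const 1) (cell 21))) (cell 12)) (.read 10 (.const 2) (cell 21))) (cell 12))
    (.read 10 (.const 3) (cell 21)))

def colorBody : Code :=
  cond (isPos (arr 11 (cell 21)))
    (.seq (setArr 2 (cell 21) colorExpr) (setArr 3 (cell 21) (.const 1)))

def colorStage : Code := .loop 21 segE colorBody

/-- The uncolored segments of the plane `j + 1` that meet the segment `s` receive a new color. -/
def starBody : Code :=
  cond (.and (.and (.natEq (arr 4 (cell 21)) (.add (cell 23) (.const 1)))
      (.natEq (arr 3 (cell 21)) (.const 0))) (isPos (.read 8 (cell 22) (cell 21))))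
    (.seq (setArr 2 (cell 21) (cell 16)) (setArr 3 (cell 21) (.const 1)))

def star : Code := .loop 21 segE starBody

/-- The two flags single out the chain of the current stage. Plane `0` is skipped, as it comes after
no other plane. The color advances for each of the other planes, whether or not it was used, so a
chain element costs exactly `k - 1` colors. -/
def starsBody : Code :=
  cond (.and (isPos (arr 11 (cell 22))) (isPos (arr 1 (cell 22))))
    (.loop 23 (.sub planeE (.const 1)) (.seq star (setCell 16 (.add (cell 16) (.const 1)))))

def stars : Code := .loop 22 segE starsBody

/-- Reserves the block of colors, the fourth power of the chain length, that was used for the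
quadruples of heights. -/
def addBase : Code :=
  setCell 16 (.add (cell 16) (.mul (.mul (cell 12) (cell 12)) (.mul (cell 12) (cell 12))))

variable {num : ℕ → ℕ → ℕ → ℝ} {c n k : ℕ}

theorem markStage_spec (T : Mem) (hn : T 0 0 1 = n) (hc : n + 5 ≤ c) (t : ℕ) (ht : t < n) :
    0 < markStage.exec num c T 11 t 0 ↔ T 4 t 0 = T 20 0 0 ∧ T 3 t 0 = 0 := by
  have key := Code.loop_rule (num := num) (c := c) (v := 21) (b := segE) (N := n)
    (P := .ite (.and (.natEq (arr 4 (cell 21)) (cell 20)) (.natEq (arr 3 (cell 21)) (.const 0)))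
    (setArr 11 (cell 21) (.const 1)) (setArr 11 (cell 21) (.const 0))) (T := T) (fun T' => T' 11)
    (fun i U => ∀ t < i, 0 < U t 0 ↔ T 4 t 0 = T 20 0 0 ∧ T 3 t 0 = 0)
    (fun T' x => update_of_ne _ (by decide) _ _ _) (by simp [segE, NatExpr.eval, hn]) (by omega)
    (by simp) ?_
  · exact key t ht
  intro i T₁ hi hi₁ hf h1 t' ht'
  have hfr : ∀ b ∈ [3, 4, 20], T₁ b = T b := by
    intro b hb; fin_cases hb <;> exact hf _ (by decide) (by decide)
  have e1 : min 1 c = 1 := by omega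
  rcases Code.exec_ite num c _ _ _ T₁ with ⟨h, he⟩ | ⟨h, he⟩ <;> rw [he] <;>
    simp only [Test.Holds, Test.holds_natEq, NatExpr.eval, arr, cell, hi₁, hfr 4 (by simp),
      hfr 3 (by simp), hfr 20 (by simp)] at h <;>
    simp only [Code.exec, setArr, NatExpr.eval, cell, hi₁, update_same, e1, and_true] <;>
    rcases Nat.lt_succ_iff_lt_or_eq.1 ht' with h2 | rfl
  · rw [if_neg (by omega)]; exact h1 _ h2
  · simp [h]
  · rw [if_neg (by omega)]; exact h1 _ h2
  · simp [h]

/-- The number with given digits in base `m`. -/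
def digits (m : ℕ) (h : ℕ → ℕ) : ℕ := ((h 0 * m + h 1) * m + h 2) * m + h 3

theorem digits_lt {m : ℕ} {h : ℕ → ℕ} (hm : ∀ a < 4, h a < m) : digits m h < m * m * (m * m) := by
  have h0 := hm 0 (by omega)
  have h1 := hm 1 (by omega)
  have h2 := hm 2 (by omega)
  have h3 := hm 3 (by omega)
  have step : ∀ {x y N : ℕ}, x < N → y < m → x * m + y < N * m := by
    intro x y N hx hy
    calc x * m + y < x * m + m := by omega
      _ = (x + 1) * m := by ring
      _ ≤ N * m := Nat.mul_le_mul_right _ hx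
  have := step (step (step h0 h1) h2) h3
  unfold digits
  calc _ < m * m * m * m := this
    _ = _ := by ring

theorem digits_inj {m : ℕ} {h h' : ℕ → ℕ} (hm : ∀ a < 4, h a < m) (hm' : ∀ a < 4, h' a < m)
    (he : digits m h = digits m h') : ∀ a < 4, h a = h' a := by
  have step : ∀ {x y x' y' : ℕ}, y < m → y' < m → x * m + y = x' * m + y' → x = x' ∧ y = y' := by
    intro x y x' y' hy hy' h
    have hpos : 0 < m := by omega
    have h1 : (x * m + y) / m = x := by
      rw [mul_comm, Nat.mul_add_div hpos, Nat.div_eq_of_lt hy, add_zero]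
    have h2 : (x' * m + y') / m = x' := by
      rw [mul_comm, Nat.mul_add_div hpos, Nat.div_eq_of_lt hy', add_zero]
    have : x = x' := by rw [← h1, ← h2, h]
    subst this
    exact ⟨rfl, by omega⟩
  obtain ⟨h1, e3⟩ := step (hm 3 (by omega)) (hm' 3 (by omega)) he
  obtain ⟨h2, e2⟩ := step (hm 2 (by omega)) (hm' 2 (by omega)) h1
  obtain ⟨e0, e1⟩ := step (hm 1 (by omega)) (hm' 1 (by omega)) h2
  intro a ha
  interval_cases a <;> assumption

/-- The hypothesis `hcol` says that truncation does not alter the colors. -/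
theorem colorStage_spec (T : Mem) (hn : T 0 0 1 = n) (hc : n + 5 ≤ c)
    (hcol : ∀ t, Marked n T t → T 16 0 0 + digits (T 12 0 0) (fun a => T 10 a t) ≤ c) :
    (∀ t, Marked n T t →
      colorStage.exec num c T 2 t 0 = T 16 0 0 + digits (T 12 0 0) (fun a => T 10 a t) ∧
      colorStage.exec num c T 3 t 0 = 1) ∧
    ∀ t, ¬ Marked n T t → colorStage.exec num c T 2 t 0 = T 2 t 0 ∧
      colorStage.exec num c T 3 t 0 = T 3 t 0 := by
  have key := Code.loop_rule (num := num) (c := c) (v := 21) (b := segE) (N := n)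
    (P := colorBody) (T := T) (fun T' => (T' 2, T' 3))
    (fun i p => (∀ t < i, Marked n T t →
        p.1 t 0 = T 16 0 0 + digits (T 12 0 0) (fun a => T 10 a t) ∧ p.2 t 0 = 1) ∧
      ∀ t, ¬ Marked n T t → p.1 t 0 = T 2 t 0 ∧ p.2 t 0 = T 3 t 0)
    (fun T' x => by simp [update_of_ne]) (by simp [segE, NatExpr.eval, hn]) (by omega)
    (by simp) ?_
  · exact ⟨fun t ht => key.1 t ht.1 ht, key.2⟩
  intro i T₁ hi hi₁ hf ⟨h1, h2⟩
  have hfr : ∀ b ∈ [10, 11, 12, 16], T₁ b = T b := by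
    intro b hb; fin_cases hb <;> exact hf _ (by decide) (by decide)
  have e1 : min 1 c = 1 := by omega
  rcases exec_cond num c _ _ T₁ with ⟨h, he⟩ | ⟨h, he⟩ <;> rw [colorBody, he] <;>
    simp only [Test.Holds, isPos, NatExpr.eval, arr, cell, hi₁, hfr 11 (by simp)] at h
  · have hM : Marked n T i := ⟨hi, h⟩
    have e2 : colorExpr.eval (⟨T₁, num⟩ : State ℝ) =
        T 16 0 0 + digits (T 12 0 0) (fun a => T 10 a i) := by
      simp [colorExpr, NatExpr.eval, cell, hfr, hi₁, digits]
    have e3 := min_eq_left (hcol i hM)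
    simp only [Code.exec, setArr, e2, e3, NatExpr.eval, cell, hi₁, e1, update_of_ne, update_same,
      ne_eq, Nat.reduceEqDiff, not_false_eq_true, and_true]
    refine ⟨fun t ht hMt => ?_, fun t hMt => ?_⟩
    · by_cases hti : t = i
      · subst hti; simp
      · simpa [hti] using h1 t (by omega) hMt
    · have : t ≠ i := by rintro rfl; exact hMt hM
      simpa [this] using h2 t hMt
  · refine ⟨fun t ht hMt => ?_, h2⟩
    rcases Nat.lt_succ_iff_lt_or_eq.1 ht with h3 | rfl
    · exact h1 t h3 hMt
    · exact absurd hMt.2 h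

theorem star_spec (T : Mem) (hn : T 0 0 1 = n) (hc : n + 5 ≤ c) (hb : T 16 0 0 ≤ c) (t : ℕ) :
    (t < n ∧ T 4 t 0 = T 23 0 0 + 1 ∧ T 3 t 0 = 0 ∧ 0 < T 8 (T 22 0 0) t →
      star.exec num c T 2 t 0 = T 16 0 0 ∧ star.exec num c T 3 t 0 = 1) ∧
    (¬ (t < n ∧ T 4 t 0 = T 23 0 0 + 1 ∧ T 3 t 0 = 0 ∧ 0 < T 8 (T 22 0 0) t) →
      star.exec num c T 2 t 0 = T 2 t 0 ∧ star.exec num c T 3 t 0 = T 3 t 0) := by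
  set New : ℕ → Prop := fun t =>
    t < n ∧ T 4 t 0 = T 23 0 0 + 1 ∧ T 3 t 0 = 0 ∧ 0 < T 8 (T 22 0 0) t with hNew
  have key := Code.loop_rule (num := num) (c := c) (v := 21) (b := segE) (N := n)
    (P := starBody) (T := T) (fun T' => (T' 2, T' 3))
    (fun i p => (∀ t < i, New t → p.1 t 0 = T 16 0 0 ∧ p.2 t 0 = 1) ∧
      ∀ t, (¬ New t ∨ i ≤ t) → p.1 t 0 = T 2 t 0 ∧ p.2 t 0 = T 3 t 0)
    (fun T' x => by simp [update_of_ne]) (by simp [segE, NatExpr.eval, hn]) (by omega)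
    (by simp) ?_
  · exact ⟨fun ht => key.1 t ht.1 ht, fun ht => key.2 t (Or.inl ht)⟩
  intro i T₁ hi hi₁ hf ⟨h1, h2⟩
  have hfr : ∀ b ∈ [4, 8, 16, 22, 23], T₁ b = T b := by
    intro b hb; fin_cases hb <;> exact hf _ (by decide) (by decide)
  have e1 : min 1 c = 1 := by omega
  have e3 : T₁ 3 i 0 = T 3 i 0 := (h2 i (Or.inr le_rfl)).2
  rcases exec_cond num c _ _ T₁ with ⟨h, he⟩ | ⟨h, he⟩ <;> rw [starBody, he] <;>
    simp only [Test.Holds, Test.holds_natEq, isPos, NatExpr.eval, arr, cell, hi₁, hfr 4 (by simp),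
      hfr 8 (by simp), hfr 22 (by simp), hfr 23 (by simp), e3] at h
  · have hM : New i := ⟨hi, h.1.1, h.1.2, h.2⟩
    have e4 := min_eq_left hb
    simp only [Code.exec, setArr, NatExpr.eval, cell, hi₁, e1, update_of_ne, update_same,
      ne_eq, Nat.reduceEqDiff, not_false_eq_true, and_true, hfr 16 (by simp), e4]
    refine ⟨fun t ht hMt => ?_, fun t hMt => ?_⟩
    · by_cases hti : t = i
      · subst hti; simp
      · simpa [hti] using h1 t (by omega) hMt
    · have : t ≠ i := by
        rintro rfl
        rcases hMt with h | h
        · exact h hM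
        · omega
      simpa [this] using h2 t (hMt.imp id (by omega))
  · refine ⟨fun t ht hMt => ?_, fun t hMt => h2 t (hMt.imp id (by omega))⟩
    rcases Nat.lt_succ_iff_lt_or_eq.1 ht with h3 | rfl
    · exact h1 t h3 hMt
    · exact absurd ⟨⟨hMt.2.1, hMt.2.2.1⟩, hMt.2.2.2⟩ h

/-- The relations between the segments that the main part of the algorithm relies on. -/
structure Tables (n k : ℕ) (disj : ℕ → ℕ → Prop) (T : Mem) : Prop where
  segs : T 0 0 1 = n
  planes : T 0 0 2 = k
  class_lt : ∀ t < n, T 4 t 0 < k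
  strict : ∀ a < 4, ∀ i, StrictOn (fun t => t < n ∧ T 4 t 0 = i) (Rel n T a)
  disj_of_rel : ∀ a < 4, ∀ s < n, ∀ t < n, T 4 s 0 = T 4 t 0 → Rel n T a s t → disj s t
  rel_of_disj : ∀ s < n, ∀ t < n, T 4 s 0 = T 4 t 0 → disj s t →
    ∃ a < 4, Rel n T a s t ∨ Rel n T a t s
  meets_iff : ∀ s < n, ∀ t < n, T 4 s 0 < T 4 t 0 → (0 < T 8 s t ↔ ¬ disj s t)
  star : ∀ s < n, ∀ t < n, ∀ t' < n, T 4 s 0 < T 4 t 0 → T 4 t 0 = T 4 t' 0 → ¬ disj s t →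
    ¬ disj s t' → ¬ disj t t'
  symm : ∀ s t, disj s t → disj t s

theorem Tables.congr {disj : ℕ → ℕ → Prop} {T T' : Mem} (h : Tables n k disj T)
    (e : ∀ a ∈ [0, 4, 7, 8], T' a = T a) : Tables n k disj T' := by
  have e0 := e 0 (by simp)
  have e4 := e 4 (by simp)
  have e7 := e 7 (by simp)
  have e8 := e 8 (by simp)
  have eR : Rel n T' = Rel n T := by unfold Rel; rw [e7]
  refine ⟨?_, ?_, ?_, ?_, ?_, ?_, ?_, ?_, h.symm⟩ <;> simp only [e0, e4, e8, eR]
  exacts [h.segs, h.planes, h.class_lt, h.strict, h.disj_of_rel, h.rel_of_disj, h.meets_iff,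
    h.star]

/-- The partial coloring in the tables `2` and `3` is proper and uses only colors less than the
number in the cell `16`. -/
structure ProperColoring (n : ℕ) (disj : ℕ → ℕ → Prop) (T : Mem) : Prop where
  lt : ∀ t < n, 0 < T 3 t 0 → T 2 t 0 < T 16 0 0
  ne : ∀ s < n, ∀ t < n, 0 < T 3 s 0 → 0 < T 3 t 0 → disj s t → T 2 s 0 ≠ T 2 t 0

theorem ProperColoring.congr {disj : ℕ → ℕ → Prop} {T T' : Mem} (h : ProperColoring n disj T)
    (e : ∀ a ∈ [2, 3, 16], T' a = T a) : ProperColoring n disj T' := by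
  have e2 := e 2 (by simp)
  have e3 := e 3 (by simp)
  have e16 := e 16 (by simp)
  constructor <;> simp only [e2, e3, e16]
  exacts [h.lt, h.ne]

/-- Coloring new elements with new colors preserves properness. -/
theorem ProperColoring.extend {disj : ℕ → ℕ → Prop} {T T' : Mem} (h : ProperColoring n disj T)
    (New : ℕ → Prop)
    (hold : ∀ t < n, ¬ New t → T' 2 t 0 = T 2 t 0 ∧ T' 3 t 0 = T 3 t 0)
    (hnew : ∀ t < n, New t → T 16 0 0 ≤ T' 2 t 0 ∧ T' 2 t 0 < T' 16 0 0)
    (hle : T 16 0 0 ≤ T' 16 0 0)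
    (hne : ∀ s < n, ∀ t < n, New s → New t → disj s t → T' 2 s 0 ≠ T' 2 t 0) :
    ProperColoring n disj T' := by
  constructor
  · intro t ht h3
    by_cases hN : New t
    · exact (hnew t ht hN).2
    · obtain ⟨e2, e3⟩ := hold t ht hN
      rw [e2]
      exact (h.lt t ht (e3 ▸ h3)).trans_le hle
  · have mixed : ∀ s < n, ∀ t < n, New s → ¬ New t → 0 < T' 3 t 0 → T' 2 s 0 ≠ T' 2 t 0 := by
      intro s hs t ht hNs hNt h3
      obtain ⟨e2, e3⟩ := hold t ht hNt
      have := h.lt t ht (e3 ▸ h3)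
      have := hnew s hs hNs
      omega
    intro s hs t ht hs3 ht3 hd
    by_cases hNs : New s <;> by_cases hNt : New t
    · exact hne s hs t ht hNs hNt hd
    · exact mixed s hs t ht hNs hNt ht3
    · exact (mixed t ht s hs hNt hNs hs3).symm
    · obtain ⟨e2, e3⟩ := hold s hs hNs
      obtain ⟨e2', e3'⟩ := hold t ht hNt
      rw [e2, e2']
      exact h.ne s hs t ht (e3 ▸ hs3) (e3' ▸ ht3) hd

end Algorithm

end Geom

/-! ### One color for the segments through a common point. -/

namespace Geom

namespace Algorithm

open Machine

/-- The part of the memory that consists of the tables in a list. -/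
def restrict (l : List ℕ) (T : Mem) : Mem := fun a => if a ∈ l then T a else fun _ _ => 0

theorem restrict_update {l : List ℕ} {T : Mem} {v : ℕ} (h : v ∉ l) (i j x : ℕ) :
    restrict l (update T v i j x) = restrict l T := by
  funext a
  unfold restrict
  split_ifs with ha
  · exact update_of_ne _ (by rintro rfl; exact h ha) _ _ _
  · rfl

theorem restrict_apply {l : List ℕ} {T : Mem} {a : ℕ} (h : a ∈ l) : restrict l T a = T a :=
  if_pos h

variable {num : ℕ → ℕ → ℕ → ℝ} {c n k : ℕ} {disj : ℕ → ℕ → Prop}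

theorem ProperColoring.restrict_iff {l : List ℕ} {T : Mem} (h : ∀ a ∈ [2, 3, 16], a ∈ l) :
    ProperColoring n disj (restrict l T) ↔ ProperColoring n disj T :=
  ⟨fun H => H.congr fun a ha => (restrict_apply (h a ha)).symm,
    fun H => H.congr fun a ha => restrict_apply (h a ha)⟩

/-- A color is given only to uncolored segments of one plane that meet one element `s` of the chain
`D`. By `hdone` such a plane comes after that of `s`, so `Tables.star` shows that these segments
meet pairwise. Afterwards no uncolored segment of a later plane meets `D`. -/
theorem stars_spec (T : Mem) (hT : Tables n k disj T) (hc : n + 5 ≤ c) (hk : 1 ≤ k)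
    (hcol : ProperColoring n disj T) (D : Finset ℕ) (i : ℕ)
    (hD : ∀ s, s ∈ D ↔ Marked n T s ∧ 0 < T 1 s 0) (hDi : ∀ s ∈ D, T 4 s 0 = i)
    (hdone : ∀ t < n, T 4 t 0 ≤ i → 0 < T 3 t 0) (hb : T 16 0 0 + (k - 1) * D.card ≤ c) :
    ProperColoring n disj (stars.exec num c T) ∧
      stars.exec num c T 16 0 0 = T 16 0 0 + (k - 1) * D.card ∧
      (∀ t, 0 < T 3 t 0 → 0 < stars.exec num c T 3 t 0) ∧
      ∀ s ∈ D, ∀ t < n, i < T 4 t 0 → ¬ disj s t → 0 < stars.exec num c T 3 t 0 := by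
  have hl : ∀ a ∈ [2, 3, 16], a ∈ [2, 3, 16] := fun _ h => h
  have key := Code.loop_rule (num := num) (c := c) (v := 22) (b := segE) (N := n)
    (P := starsBody) (T := T) (restrict [2, 3, 16])
    (fun s p => ProperColoring n disj p ∧
      p 16 0 0 = T 16 0 0 + (k - 1) * (D.filter (· < s)).card ∧
      (∀ t, 0 < T 3 t 0 → 0 < p 3 t 0) ∧
      ∀ s' ∈ D, s' < s → ∀ t < n, i < T 4 t 0 → ¬ disj s' t → 0 < p 3 t 0)
    (fun T' x => restrict_update (by decide) _ _ _) (by simp [segE, NatExpr.eval, hT.segs])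
    (by omega) ?_ ?_
  · obtain ⟨h1, h2, h3, h4⟩ := key
    have : D.filter (· < n) = D := Finset.filter_true_of_mem fun s hs => ((hD s).1 hs).1.1
    rw [this] at h2
    exact ⟨(ProperColoring.restrict_iff hl).1 h1, h2, h3, fun s hs => h4 s hs ((hD s).1 hs).1.1⟩
  · exact ⟨(ProperColoring.restrict_iff hl).2 hcol, by simp [restrict_apply], fun t ht => ht,
      by simp⟩
  intro s T₁ hs hs₁ hf ⟨h1, h2, h3, h4⟩
  rw [ProperColoring.restrict_iff hl] at h1
  change T₁ 16 0 0 = _ at h2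
  change ∀ t, _ → 0 < T₁ 3 t 0 at h3
  change ∀ s' ∈ D, s' < s → ∀ t < n, i < T 4 t 0 → ¬ disj s' t → 0 < T₁ 3 t 0 at h4
  have hfr : ∀ b ∈ [0, 1, 4, 7, 8, 11], T₁ b = T b := by
    intro b hb; fin_cases hb <;> exact hf _ (by decide) (by decide)
  have hT₁ : Tables n k disj T₁ := hT.congr fun a ha => hfr a (by fin_cases ha <;> decide)
  rcases exec_cond num c _ _ T₁ with ⟨h, he⟩ | ⟨h, he⟩ <;> rw [starsBody, he] <;>
    simp only [Test.Holds, isPos, NatExpr.eval, arr, cell, hs₁, hfr 11 (by simp),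
      hfr 1 (by simp)] at h
  · have hsD : s ∈ D := (hD s).2 ⟨⟨hs, h.1⟩, h.2⟩
    have hcard : (D.filter (· < s + 1)).card = (D.filter (· < s)).card + 1 := by
      have : D.filter (· < s + 1) = insert s (D.filter (· < s)) := by
        ext x
        simp only [Finset.mem_filter, Finset.mem_insert]
        constructor
        · rintro ⟨h1, h2⟩
          rcases Nat.lt_succ_iff_lt_or_eq.1 h2 with h3 | h3
          · exact Or.inr ⟨h1, h3⟩
          · exact Or.inl h3
        · rintro (rfl | ⟨h1, h2⟩)
          · exact ⟨hsD, by omega⟩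
          · exact ⟨h1, by omega⟩
      rw [this, Finset.card_insert_of_notMem (by simp)]
    have hbound : T₁ 16 0 0 + (k - 1) ≤ c := by
      have h5 : (D.filter (· < s + 1)).card ≤ D.card := Finset.card_filter_le _ _
      rw [hcard] at h5
      have := Nat.mul_le_mul_left (k - 1) h5
      rw [mul_add, mul_one] at this
      omega
    have key := Code.loop_rule (num := num) (c := c) (v := 23) (b := .sub planeE (.const 1))
      (N := k - 1) (P := .seq star (setCell 16 (.add (cell 16) (.const 1)))) (T := T₁)
      (restrict [2, 3, 16])
      (fun j p => ProperColoring n disj p ∧ p 16 0 0 = T₁ 16 0 0 + j ∧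
        (∀ t, 0 < T₁ 3 t 0 → 0 < p 3 t 0) ∧
        ∀ t < n, i < T 4 t 0 → T 4 t 0 < j + 1 → ¬ disj s t → 0 < p 3 t 0)
      (fun T' x => restrict_update (by decide) _ _ _)
      (by simp [planeE, NatExpr.eval, hfr 0, hT.planes]) (by omega) ?_ ?_
    · obtain ⟨g1, g2, g3, g4⟩ := key
      refine ⟨g1, ?_, fun t ht => g3 t (h3 t ht), fun s' hs' hlt t ht hit hd => ?_⟩
      · rw [g2, h2, hcard]; ring
      · rcases Nat.lt_succ_iff_lt_or_eq.1 hlt with h5 | rfl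
        · exact g3 t (h4 s' hs' h5 t ht hit hd)
        · refine g4 t ht hit ?_ hd
          have := hT.class_lt t ht
          omega
    · exact ⟨(ProperColoring.restrict_iff hl).2 h1, by simp [restrict_apply], fun t ht => ht,
        by intros; omega⟩
    intro j T₂ hj hj₂ hf₂ ⟨g1, g2, g3, g4⟩
    rw [ProperColoring.restrict_iff hl] at g1
    change T₂ 16 0 0 = _ at g2
    change ∀ t, _ → 0 < T₂ 3 t 0 at g3
    change ∀ t < n, i < T 4 t 0 → _ → ¬ disj s t → 0 < T₂ 3 t 0 at g4
    have hfr₂ : ∀ b ∈ [0, 1, 4, 7, 8, 11, 22], T₂ b = T₁ b := by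
      intro b hb; fin_cases hb <;> exact hf₂ _ (by decide) (by decide)
    have hT₂ : Tables n k disj T₂ := hT₁.congr fun a ha => hfr₂ a (by fin_cases ha <;> decide)
    have e4 : T₂ 4 = T 4 := by simp [hfr₂, hfr]
    have e22 : T₂ 22 0 0 = s := by simp [hfr₂, hs₁]
    have hst := star_spec (num := num) (c := c) T₂ hT₂.segs hc (by omega)
    rw [hj₂, e22, e4] at hst
    -- Table `8` is meaningful only when the plane of `t` comes after that of `s`; this holds for an
    -- uncolored `t`, since everything up to plane `i` is colored.
    have hpos : ∀ t < n, T 4 t 0 = j + 1 → T₂ 3 t 0 = 0 → (0 < T₂ 8 s t ↔ ¬ disj s t) := by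
      intro t ht h4t h3t
      have h5 := hT₂.meets_iff s hs t ht
      rw [e4, hDi s hsD] at h5
      apply h5
      by_contra h6
      have := g3 t (h3 t (hdone t ht (by omega)))
      omega
    have hst2 : T₂ 16 0 0 + 1 ≤ c := by omega
    set T₃ := star.exec num c T₂ with hT₃
    have e16 : T₃ 16 = T₂ 16 := Code.exec_frame _ _ _ _ (by decide)
    have hexec : (Code.seq star (setCell 16 (.add (cell 16) (.const 1)))).exec num c T₂ =
        update T₃ 16 0 0 (T₂ 16 0 0 + 1) := by
      simp [setCell, Code.exec, NatExpr.eval, cell, ← hT₃, e16, min_eq_left hst2]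
    rw [hexec]
    refine ⟨(ProperColoring.restrict_iff hl).2 (g1.extend (fun t => t < n ∧ T 4 t 0 = j + 1 ∧
      T₂ 3 t 0 = 0 ∧ 0 < T₂ 8 s t) ?_ ?_ ?_ ?_), ?_, ?_, ?_⟩
    · intro t ht hN
      simpa [update_of_ne] using (hst t).2 hN
    · intro t ht hN
      simp [update_of_ne, update_same, ((hst t).1 hN).1]
    · simp [update_same]
    · intro t ht t' ht' hN hN' hd
      refine absurd hd (hT₂.star s hs t ht t' ht' ?_ ?_ ?_ ?_)
      · rw [e4, hDi s hsD]
        by_contra h6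
        have := g3 t (h3 t (hdone t ht (by omega)))
        omega
      · rw [e4, hN.2.1, hN'.2.1]
      · exact (hpos t ht hN.2.1 hN.2.2.1).1 hN.2.2.2
      · exact (hpos t' ht' hN'.2.1 hN'.2.2.1).1 hN'.2.2.2
    · simp [restrict_apply, update_same, g2, add_assoc]
    · have mono : ∀ t, 0 < T₂ 3 t 0 → 0 < T₃ 3 t 0 := by
        intro t ht
        rw [((hst t).2 (by omega)).2]; exact ht
      intro t ht
      simpa [restrict_apply, update_of_ne] using mono t (g3 t ht)
    · intro t ht hit hlt hd
      simp only [restrict_apply, List.mem_cons, true_or, or_true, update_of_ne,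
        ne_eq, Nat.reduceEqDiff, not_false_eq_true]
      by_cases h3t : T₂ 3 t 0 = 0
      · by_cases hjt : T 4 t 0 = j + 1
        · rw [((hst t).1 ⟨ht, hjt, h3t, (hpos t ht hjt h3t).2 hd⟩).2]; omega
        · have := g4 t ht hit (by omega) hd
          omega
      · rw [((hst t).2 (by omega)).2]; omega
  · have hsD : s ∉ D := fun hs' => h (((hD s).1 hs').imp And.right id)
    have hfil : D.filter (· < s + 1) = D.filter (· < s) := by
      apply Finset.filter_congr
      intro x hx
      have : x ≠ s := by rintro rfl; exact hsD hx
      omega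
    refine ⟨(ProperColoring.restrict_iff hl).2 h1, by rw [hfil]; exact h2, h3,
      fun s' hs' hlt => h4 s' hs' ?_⟩
    have : s' ≠ s := by rintro rfl; exact hsD hs'
    omega

end Algorithm

end Geom

/-! ### Induction over the planes. -/

namespace Geom

namespace Algorithm

open Machine

def stage : Code :=
  .seq markStage (.seq heights (.seq maxHeight (.seq chain (.seq colorStage (.seq addBase stars)))))

def colorAll : Code := .loop 20 planeE stage

variable {num : ℕ → ℕ → ℕ → ℝ} {c n k : ℕ} {disj : ℕ → ℕ → Prop}

/-- The state of the algorithm when the segments of the first `i` planes have been treated, where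
`K` is the clique found so far. -/
structure StageInv (n k : ℕ) (disj : ℕ → ℕ → Prop) (i : ℕ) (K : Finset ℕ) (T : Mem) : Prop where
  tables : Tables n k disj T
  proper : ProperColoring n disj T
  mem_iff : ∀ t, 0 < T 1 t 0 ↔ t ∈ K
  mem : ∀ s ∈ K, s < n ∧ T 4 s 0 < i
  clique : ∀ s ∈ K, ∀ t ∈ K, s ≠ t → disj s t
  base_le : T 16 0 0 ≤ (k - 1) * K.card + K.card ^ 4
  done : ∀ t < n, T 4 t 0 < i → 0 < T 3 t 0
  done_of_meets : ∀ s ∈ K, ∀ t < n, i ≤ T 4 t 0 → ¬ disj s t → 0 < T 3 t 0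
  height_zero : ∀ a, ∀ t < n, i ≤ T 4 t 0 → T 10 a t = 0

theorem StageInv.congr {i : ℕ} {K : Finset ℕ} {T T' : Mem} (h : StageInv n k disj i K T)
    (e : ∀ a ∈ [0, 1, 2, 3, 4, 7, 8, 10, 16], T' a = T a) : StageInv n k disj i K T' := by
  have e1 := e 1 (by simp)
  have e3 := e 3 (by simp)
  have e4 := e 4 (by simp)
  have e10 := e 10 (by simp)
  have e16 := e 16 (by simp)
  refine ⟨h.tables.congr fun a ha => e a (by fin_cases ha <;> decide),
    h.proper.congr fun a ha => e a (by fin_cases ha <;> decide), ?_, ?_, h.clique, ?_, ?_, ?_, ?_⟩ <;>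
    simp only [e1, e3, e4, e10, e16]
  exacts [h.mem_iff, h.mem, h.base_le, h.done, h.done_of_meets, h.height_zero]

/-- Superadditivity lets the fourth powers spent on separate planes be charged to the fourth power
of the size of the whole clique. -/
theorem pow_four_add_le (a b : ℕ) : a ^ 4 + b * b * (b * b) ≤ (a + b) ^ 4 := by
  have : (a + b) ^ 4 = a ^ 4 + b * b * (b * b) +
      (4 * a ^ 3 * b + 6 * a ^ 2 * b ^ 2 + 4 * a * b ^ 3) := by ring
  omega

/-- The new clique is `K ∪ C`, where `C` is a longest chain of uncolored segments of the plane `i`.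
The stage spends the fourth power of the size of `C` on heights and `k - 1` colors per element of
`C` on later planes. -/
theorem stage_spec {i : ℕ} {K : Finset ℕ} {T : Mem} (h : StageInv n k disj i K T)
    (hi : T 20 0 0 = i) (hk : 1 ≤ k)
    (hc : n * n * (n * n) + k * n + n + k + 5 ≤ c) :
    ∃ K', StageInv n k disj (i + 1) K' (stage.exec num c T) := by
  have hc' : n + 5 ≤ c := by omega
  have hn := h.tables.segs
  set T₁ := markStage.exec num c T with hT₁
  have f₁ : ∀ a, a ∉ [21, 11] → T₁ a = T a := fun a ha =>
    Code.exec_frame _ _ _ _ (by simpa [markStage, Code.writes, setArr] using ha)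
  set M := Marked n T₁ with hM
  have hMiff : ∀ t, M t ↔ t < n ∧ T 4 t 0 = i ∧ T 3 t 0 = 0 := by
    intro t
    have := fun ht => markStage_spec (num := num) (c := c) T hn hc' t ht
    rw [hi] at this
    exact and_congr_right this
  set T₂ := heights.exec num c T₁ with hT₂
  have f₂ : ∀ a, a ∉ [24, 25, 21, 22, 10] → T₂ a = T₁ a := fun a ha =>
    Code.exec_frame _ _ _ _ (by simpa [heights, heightsBody, cond, Code.writes] using ha)
  set T₃ := maxHeight.exec num c T₂ with hT₃
  have f₃ : ∀ a, a ∉ [12, 24, 21, 13, 14] → T₃ a = T₂ a := fun a ha =>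
    Code.exec_frame _ _ _ _
      (by simp [maxHeight, maxHeightBody, cond, Code.writes, setCell] at ha ⊢; tauto)
  set T₄ := chain.exec num c T₃ with hT₄
  have f₄ : ∀ a, a ∉ [1, 15, 25, 22] → T₄ a = T₃ a := fun a ha =>
    Code.exec_frame _ _ _ _
      (by simp [chain, chainBody, cond, Code.writes, setArr, setCell] at ha ⊢; tauto)
  set T₅ := colorStage.exec num c T₄ with hT₅
  have f₅ : ∀ a, a ∉ [2, 3, 21] → T₅ a = T₄ a := fun a ha =>
    Code.exec_frame _ _ _ _
      (by simp [colorStage, colorBody, cond, Code.writes, setArr] at ha ⊢; tauto)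
  set T₆ := addBase.exec num c T₅ with hT₆
  have f₆ : ∀ a, a ≠ 16 → T₆ a = T₅ a := fun a ha =>
    Code.exec_frame _ _ _ _ (by simpa [addBase, Code.writes, setCell] using ha)
  set T₇ := stars.exec num c T₆ with hT₇
  have f₇ : ∀ a, a ∉ [22, 23, 21, 2, 3, 16] → T₇ a = T₆ a := fun a ha =>
    Code.exec_frame _ _ _ _
      (by simp [stars, starsBody, star, starBody, cond, Code.writes, setArr, setCell] at ha ⊢; tauto)
  show ∃ K', StageInv n k disj (i + 1) K' T₇
  have hM₂ : Marked n T₂ = M := by unfold M Marked; rw [f₂ 11 (by decide)]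
  have hM₃ : Marked n T₃ = M := by rw [← hM₂]; unfold Marked; rw [f₃ 11 (by decide)]
  have hM₄ : Marked n T₄ = M := by rw [← hM₃]; unfold Marked; rw [f₄ 11 (by decide)]
  have hM₆ : Marked n T₆ = M := by
    rw [← hM₄]; unfold Marked; rw [f₆ 11 (by decide), f₅ 11 (by decide)]
  have hR₁ : Rel n T₁ = Rel n T := by unfold Rel; rw [f₁ 7 (by decide)]
  have hR₃ : Rel n T₃ = Rel n T := by
    unfold Rel; rw [f₃ 7 (by decide), f₂ 7 (by decide), f₁ 7 (by decide)]
  have hstrict : ∀ a < 4, StrictOn M (Rel n T a) := by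
    intro a ha
    have hs := h.tables.strict a ha i
    have hsub : ∀ t, M t → t < n ∧ T 4 t 0 = i := fun t ht =>
      ⟨((hMiff t).1 ht).1, ((hMiff t).1 ht).2.1⟩
    exact ⟨fun t ht => hs.irrefl t (hsub t ht), fun s t u h1 h2 h3 =>
      hs.trans s t u (hsub s h1) (hsub t h2) (hsub u h3)⟩
  have hMlt : ∀ t, M t → t < n := fun t ht => ht.1
  obtain ⟨hh1, hh2⟩ := heights_spec (num := num) (c := c) T₁ (by rw [f₁ 0 (by decide), hn]) hc'
    (by
      intro a ha t ht
      rw [f₁ 10 (by decide)]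
      exact h.height_zero a t ht.1 ((hMiff t).1 ht).2.1.ge)
  rw [← hT₂, ← hM] at hh1 hh2
  rw [hR₁] at hh1
  have hH : ∀ a < 4, IsHeight M (Rel n T a) n (T₂ 10 a) := fun a ha =>
    (hh1 a ha).isHeight (hstrict a ha) hMlt
  have e0₂ : T₂ 0 0 1 = n := by rw [f₂ 0 (by decide), f₁ 0 (by decide), hn]
  obtain ⟨hm1, hm2⟩ := maxHeight_spec (num := num) (c := c) T₂ e0₂ hc'
    (by rw [hM₂]; exact fun a ha => (hH a ha).lt)
  rw [hM₂, ← hT₃] at hm1 hm2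
  have e10₃ : T₃ 10 = T₂ 10 := f₃ 10 (by decide)
  obtain ⟨C, hC1, hC2, hC3, hC4⟩ := chain_spec (num := num) (c := c) T₃
    (by rw [f₃ 0 (by decide), e0₂]) hc' (by rw [hM₃, hR₃]; exact hstrict)
    (by rw [hM₃, hR₃, e10₃]; exact hH) (by rw [hM₃, e10₃]; exact hm2)
  rw [hM₃] at hC1
  rw [hR₃] at hC3
  rw [← hT₄] at hC4
  set m := T₃ 12 0 0 with hm
  have e1₃ : T₃ 1 = T 1 := by rw [f₃ 1 (by decide), f₂ 1 (by decide), f₁ 1 (by decide)]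
  rw [e1₃] at hC4
  have hdisj : Disjoint K C := by
    rw [Finset.disjoint_left]
    intro s hsK hsC
    have h1 := (h.mem s hsK).2
    have h2 := ((hMiff s).1 (hC1 s hsC)).2.1
    omega
  have hK'n : (K ∪ C).card ≤ n := by
    have : K ∪ C ⊆ Finset.range n := by
      intro s hs
      rcases Finset.mem_union.1 hs with hs | hs
      · exact Finset.mem_range.2 (h.mem s hs).1
      · exact Finset.mem_range.2 (hMlt s (hC1 s hs))
    simpa using Finset.card_le_card this
  have hcard : (K ∪ C).card = K.card + m := by rw [Finset.card_union_of_disjoint hdisj, hC2]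
  have hfinal : T 16 0 0 + m * m * (m * m) + (k - 1) * m ≤
      (k - 1) * (K ∪ C).card + (K ∪ C).card ^ 4 := by
    rw [hcard, mul_add]
    have := h.base_le
    have := pow_four_add_le K.card m
    omega
  -- All colors of the stage stay within the capacity, so no truncation occurs.
  have hcap : (k - 1) * (K ∪ C).card + (K ∪ C).card ^ 4 ≤ c := by
    have h1 : (k - 1) * (K ∪ C).card ≤ k * n := Nat.mul_le_mul (by omega) hK'n
    have h2 : (K ∪ C).card ^ 4 ≤ n * n * (n * n) := by
      calc _ ≤ n ^ 4 := Nat.pow_le_pow_left hK'n 4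
        _ = _ := by ring
    omega
  have e16₄ : T₄ 16 = T 16 := by
    rw [f₄ 16 (by decide), f₃ 16 (by decide), f₂ 16 (by decide), f₁ 16 (by decide)]
  have e12₄ : T₄ 12 0 0 = m := by rw [f₄ 12 (by decide)]
  have e10₄ : T₄ 10 = T₂ 10 := by rw [f₄ 10 (by decide), e10₃]
  have e2₄ : T₄ 2 = T 2 := by
    rw [f₄ 2 (by decide), f₃ 2 (by decide), f₂ 2 (by decide), f₁ 2 (by decide)]
  have e3₄ : T₄ 3 = T 3 := by
    rw [f₄ 3 (by decide), f₃ 3 (by decide), f₂ 3 (by decide), f₁ 3 (by decide)]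
  have hdig : ∀ t, M t → digits m (fun a => T₂ 10 a t) < m * m * (m * m) := fun t ht =>
    digits_lt fun a ha => hm1 a ha t ht
  have hcol := colorStage_spec (num := num) (c := c) T₄
    (by rw [f₄ 0 (by decide), f₃ 0 (by decide), e0₂]) hc'
    (by
      rw [hM₄, e16₄, e12₄, e10₄]
      intro t ht
      have := hdig t ht
      omega)
  rw [hM₄, e16₄, e12₄, e10₄, e2₄, e3₄, ← hT₅] at hcol
  obtain ⟨hcol1, hcol2⟩ := hcol
  have e16₆ : T₆ 16 0 0 = T 16 0 0 + m * m * (m * m) := by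
    have e16₅ : T₅ 16 = T 16 := by rw [f₅ 16 (by decide), e16₄]
    have e12₅ : T₅ 12 0 0 = m := by rw [f₅ 12 (by decide), e12₄]
    have : min (T 16 0 0 + m * m * (m * m)) c = T 16 0 0 + m * m * (m * m) := by omega
    simp [hT₆, addBase, setCell, Code.exec, NatExpr.eval, cell, update_same, e16₅, e12₅, this]
  have e2₆ : T₆ 2 = T₅ 2 := f₆ 2 (by decide)
  have e3₆ : T₆ 3 = T₅ 3 := f₆ 3 (by decide)
  have e4₆ : T₆ 4 = T 4 := by
    rw [f₆ 4 (by decide), f₅ 4 (by decide), f₄ 4 (by decide), f₃ 4 (by decide), f₂ 4 (by decide),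
      f₁ 4 (by decide)]
  have hstat : ∀ a ∈ [0, 4, 7, 8], T₆ a = T a := by
    intro a ha
    fin_cases ha <;> rw [f₆ _ (by decide), f₅ _ (by decide), f₄ _ (by decide), f₃ _ (by decide),
      f₂ _ (by decide), f₁ _ (by decide)]
  have hTab₆ : Tables n k disj T₆ := h.tables.congr hstat
  have hproper₆ : ProperColoring n disj T₆ := by
    refine h.proper.extend M ?_ ?_ ?_ ?_
    · intro t _ ht
      rw [e2₆, e3₆]; exact hcol2 t ht
    · intro t _ ht
      rw [e2₆, e16₆, (hcol1 t ht).1]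
      have := hdig t ht
      omega
    · omega
    -- Disjoint segments of the plane are comparable in one of the orders, so their colors differ in
    -- the digit of that order.
    · intro s hs t ht hMs hMt hd heq
      rw [e2₆, (hcol1 s hMs).1, (hcol1 t hMt).1] at heq
      have hdd := digits_inj (fun a ha => hm1 a ha s hMs) (fun a ha => hm1 a ha t hMt)
        (Nat.add_left_cancel heq)
      obtain ⟨a, ha, hr⟩ := h.tables.rel_of_disj s hs t ht
        (by rw [((hMiff s).1 hMs).2.1, ((hMiff t).1 hMt).2.1]) hd
      have := hdd a ha
      rcases hr with hr | hr
      · have := (hH a ha).mono s t hMs hMt hr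
        omega
      · have := (hH a ha).mono t s hMt hMs hr
        omega
  have hmono₆ : ∀ t, 0 < T 3 t 0 → 0 < T₆ 3 t 0 := by
    intro t ht
    rw [e3₆, (hcol2 t fun hMt => by have := ((hMiff t).1 hMt).2.2; omega).2]
    exact ht
  have e1₆ : T₆ 1 = T₄ 1 := by rw [f₆ 1 (by decide), f₅ 1 (by decide)]
  have hdone₆ : ∀ t < n, T 4 t 0 ≤ i → 0 < T₆ 3 t 0 := by
    intro t ht hti
    by_cases hMt : M t
    · rw [e3₆, (hcol1 t hMt).2]; exact one_pos
    · apply hmono₆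
      by_cases hlt : T 4 t 0 < i
      · exact h.done t ht hlt
      · by_contra h3
        exact hMt ((hMiff t).2 ⟨ht, by omega, by omega⟩)
  -- Table `1` describes all of `K ∪ C`; the marks filter out `K`, whose members belong to earlier
  -- planes.
  have hCmem : ∀ s, s ∈ C ↔ Marked n T₆ s ∧ 0 < T₆ 1 s 0 := by
    intro s
    rw [hM₆, e1₆, hC4]
    constructor
    · intro hs; exact ⟨hC1 s hs, by simp [hs]⟩
    · rintro ⟨h1, h2⟩
      by_contra hs
      rw [if_neg hs, h.mem_iff] at h2
      have := (h.mem s h2).2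
      have := ((hMiff s).1 h1).2.1
      omega
  obtain ⟨g1, g2, g3, g4⟩ := stars_spec (num := num) (c := c) T₆ hTab₆ hc' hk hproper₆ C i hCmem
    (by intro s hs; rw [e4₆]; exact ((hMiff s).1 (hC1 s hs)).2.1) (by rw [e4₆]; exact hdone₆)
    (by rw [hC2, e16₆]; omega)
  rw [← hT₇] at g1 g2 g3 g4
  rw [e4₆] at g4
  have e4₇ : T₇ 4 = T 4 := by rw [f₇ 4 (by decide), e4₆]
  have e1₇ : T₇ 1 = T₄ 1 := by rw [f₇ 1 (by decide), e1₆]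
  have e10₇ : T₇ 10 = T₂ 10 := by
    rw [f₇ 10 (by decide), f₆ 10 (by decide), f₅ 10 (by decide), e10₄]
  -- A segment of this plane that meets `K` was colored in an earlier stage and therefore was not
  -- marked.
  have hKC : ∀ s ∈ K, ∀ t ∈ C, disj s t := by
    intro s hs t ht
    by_contra hd
    have hMt := (hMiff t).1 (hC1 t ht)
    have := h.done_of_meets s hs t hMt.1 hMt.2.1.ge hd
    omega
  refine ⟨K ∪ C, hTab₆.congr fun a ha => f₇ a (by fin_cases ha <;> decide), g1, ?_, ?_, ?_, ?_, ?_,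
    ?_, ?_⟩
  · intro t
    rw [e1₇, hC4, Finset.mem_union, ← h.mem_iff]
    split_ifs with ht <;> simp [ht]
  · intro s hs
    rw [e4₇]
    rcases Finset.mem_union.1 hs with hs | hs
    · exact ⟨(h.mem s hs).1, (h.mem s hs).2.trans (Nat.lt_succ_self i)⟩
    · have := (hMiff s).1 (hC1 s hs)
      exact ⟨this.1, by omega⟩
  · intro s hs t ht hst
    rcases Finset.mem_union.1 hs with hs | hs <;> rcases Finset.mem_union.1 ht with ht | ht
    · exact h.clique s hs t ht hst
    · exact hKC s hs t ht
    · exact h.tables.symm _ _ (hKC t ht s hs)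
    · have hs' := (hMiff s).1 (hC1 s hs)
      have ht' := (hMiff t).1 (hC1 t ht)
      obtain ⟨a, ha, hr | hr⟩ := hC3 s hs t ht hst
      · exact h.tables.disj_of_rel a ha s hs'.1 t ht'.1 (hs'.2.1.trans ht'.2.1.symm) hr
      · exact h.tables.symm _ _
          (h.tables.disj_of_rel a ha t ht'.1 s hs'.1 (ht'.2.1.trans hs'.2.1.symm) hr)
  · rw [g2, e16₆, hC2]; exact hfinal
  · intro t ht hti
    rw [e4₇] at hti
    exact g3 t (hdone₆ t ht (by omega))
  · intro s hs t ht hti hd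
    rw [e4₇] at hti
    rcases Finset.mem_union.1 hs with hs | hs
    · exact g3 t (hmono₆ t (h.done_of_meets s hs t ht (by omega) hd))
    · exact g4 s hs t ht (by omega) hd
  · intro a t ht hti
    rw [e4₇] at hti
    rw [e10₇, hh2 a t (fun hMt => by have := ((hMiff t).1 hMt).2.1; omega), f₁ 10 (by decide)]
    exact h.height_zero a t ht (by omega)

/-- The main part of the algorithm finds a clique and a coloring. -/
theorem colorAll_spec {T : Mem} (h : Tables n k disj T) (hk : 1 ≤ k)
    (hc : n * n * (n * n) + k * n + n + k + 5 ≤ c) (hz : ∀ a ∈ [1, 2, 3, 10, 16], ∀ i j, T a i j = 0) :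
    ∃ K : Finset ℕ, (∀ t, 0 < colorAll.exec num c T 1 t 0 ↔ t ∈ K) ∧ (∀ s ∈ K, s < n) ∧
      (∀ s ∈ K, ∀ t ∈ K, s ≠ t → disj s t) ∧
      (∀ s < n, ∀ t < n, disj s t → colorAll.exec num c T 2 s 0 ≠ colorAll.exec num c T 2 t 0) ∧
      ∀ t < n, colorAll.exec num c T 2 t 0 < (k - 1) * K.card + K.card ^ 4 := by
  have key := Code.loop_rule (num := num) (c := c) (v := 20) (b := planeE) (N := k)
    (P := stage) (T := T) (restrict [0, 1, 2, 3, 4, 7, 8, 10, 16])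
    (fun i p => ∃ K, StageInv n k disj i K p)
    (fun T' x => restrict_update (by decide) _ _ _) (by simp [planeE, NatExpr.eval, h.planes])
    (by omega) ?_ ?_
  · obtain ⟨K, hK⟩ := key
    replace hK := hK.congr (T' := colorAll.exec num c T) fun a ha => (restrict_apply ha).symm
    refine ⟨K, hK.mem_iff, fun s hs => (hK.mem s hs).1, hK.clique, ?_, ?_⟩
    · intro s hs t ht hd
      exact hK.proper.ne s hs t ht (hK.done s hs (hK.tables.class_lt s hs))
        (hK.done t ht (hK.tables.class_lt t ht)) hd
    · intro t ht
      exact (hK.proper.lt t ht (hK.done t ht (hK.tables.class_lt t ht))).trans_le hK.base_le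
  · refine ⟨∅, StageInv.congr (T := T) ?_ fun a ha => restrict_apply ha⟩
    have h1 := hz 1 (by simp)
    have h3 := hz 3 (by simp)
    have h10 := hz 10 (by simp)
    have h16 := hz 16 (by simp)
    exact ⟨h, ⟨by simp [h3], by simp [h3]⟩, by simp [h1], by simp, by simp, by simp [h16], by simp,
      by simp, by simp [h10]⟩
  · rintro i T₁ hi hi₁ hf ⟨K, hK⟩
    obtain ⟨K', hK'⟩ := stage_spec (num := num) (c := c)
      (hK.congr (T' := T₁) fun a ha => (restrict_apply ha).symm) hi₁ hk hc
    exact ⟨K', hK'.congr fun a ha => restrict_apply ha⟩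

end Algorithm

end Geom

/-! ### Programs for comparing segments and for choosing coordinates and planes. -/

namespace Geom

namespace Algorithm

open Machine

/-! Comparisons of segments in the plane. -/

/-- `σ = 1`: the part of the segment from `c` to `d` between its end points has no point below or
at `p`, if the first coordinate increases from `c` to `d`; `σ = -1`: above instead of below. -/
def HalfBelow (σ : ℝ) (p c d : ℝ × ℝ) : Prop :=
  c.1 < p.1 ∧ p.1 < d.1 → 0 < σ * ((d.1 - p.1) * (c.2 - p.2) + (p.1 - c.1) * (d.2 - p.2))

/-- A division-free comparison of `p` with the points of the segment on its vertical line. The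
quantity in `HalfBelow` is the vertical gap multiplied by the positive width `d.1 - c.1`; the
clauses for the end points also take care of vertical segments. -/
def PointBelow (σ : ℝ) (p c d : ℝ × ℝ) : Prop :=
  ((c.1 = p.1 → σ * p.2 < σ * c.2) ∧ (d.1 = p.1 → σ * p.2 < σ * d.2)) ∧
    HalfBelow σ p c d ∧ HalfBelow σ p d c

/-- Only the end points are compared with the other segment; `below_iff` shows that this is enough.
-/
def Below (σ : ℝ) (a b c d : ℝ × ℝ) : Prop :=
  (PointBelow σ a c d ∧ PointBelow σ b c d) ∧ PointBelow (-σ) c a b ∧ PointBelow (-σ) d a b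

/-- The projection of the second segment is contained in that of the first. -/
def Nested (a b c d : ℝ × ℝ) : Prop :=
  ((a.1 ≤ c.1 ∨ b.1 ≤ c.1) ∧ (c.1 ≤ a.1 ∨ c.1 ≤ b.1)) ∧
    (a.1 ≤ d.1 ∨ b.1 ≤ d.1) ∧ (d.1 ≤ a.1 ∨ d.1 ≤ b.1)

/-- Both ends of the projection of the second segment are to the right of those of the first. -/
def Shifted (a b c d : ℝ × ℝ) : Prop :=
  ((a.1 ≤ c.1 ∨ b.1 ≤ c.1) ∧ (a.1 ≤ d.1 ∨ b.1 ≤ d.1)) ∧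
    (a.1 ≤ c.1 ∨ a.1 ≤ d.1) ∧ (b.1 ≤ c.1 ∨ b.1 ≤ d.1)

/-- Being below is not transitive by itself, because the middle segment may miss the vertical lines
common to the outer two. Either condition on the projections repairs this, which with the two
directions makes four orders. -/
def Order (o : ℕ) (a b c d : ℝ × ℝ) : Prop :=
  (o = 0 ∧ Nested a b c d ∧ Below 1 a b c d ∨ o = 1 ∧ Nested a b c d ∧ Below (-1) a b c d) ∨
    (o = 2 ∧ Shifted a b c d ∧ Below 1 a b c d ∨ o = 3 ∧ Shifted a b c d ∧ Below (-1) a b c d)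

def impTest (b c : Test) : Test := .not (.and b (.not c))

def halfTest (q : ℚ) (p c d : NumExpr × NumExpr) : Test :=
  impTest (.and (.numLt c.1 p.1) (.numLt p.1 d.1)) (.numLt (.const 0) (.mul (.const q)
    (.add (.mul (.sub d.1 p.1) (.sub c.2 p.2)) (.mul (.sub p.1 c.1) (.sub d.2 p.2)))))

def pointTest (q : ℚ) (p c d : NumExpr × NumExpr) : Test :=
  .and (.and
    (impTest (.numEq c.1 p.1) (.numLt (.mul (.const q) p.2) (.mul (.const q) c.2)))
    (impTest (.numEq d.1 p.1) (.numLt (.mul (.const q) p.2) (.mul (.const q) d.2))))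
    (.and (halfTest q p c d) (halfTest q p d c))

def belowTest (q : ℚ) (a b c d : NumExpr × NumExpr) : Test :=
  .and (.and (pointTest q a c d) (pointTest q b c d))
    (.and (pointTest (-q) c a b) (pointTest (-q) d a b))

def nestedTest (a b c d : NumExpr × NumExpr) : Test :=
  .and (.and (.or (.numLe a.1 c.1) (.numLe b.1 c.1)) (.or (.numLe c.1 a.1) (.numLe c.1 b.1)))
    (.and (.or (.numLe a.1 d.1) (.numLe b.1 d.1)) (.or (.numLe d.1 a.1) (.numLe d.1 b.1)))

def shiftedTest (a b c d : NumExpr × NumExpr) : Test :=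
  .and (.and (.or (.numLe a.1 c.1) (.numLe b.1 c.1)) (.or (.numLe a.1 d.1) (.numLe b.1 d.1)))
    (.and (.or (.numLe a.1 c.1) (.numLe a.1 d.1)) (.or (.numLe b.1 c.1) (.numLe b.1 d.1)))

def orderTest (o : NatExpr) (a b c d : NumExpr × NumExpr) : Test :=
  .or (.or (.and (.natEq o (.const 0)) (.and (nestedTest a b c d) (belowTest 1 a b c d)))
      (.and (.natEq o (.const 1)) (.and (nestedTest a b c d) (belowTest (-1) a b c d))))
    (.or (.and (.natEq o (.const 2)) (.and (shiftedTest a b c d) (belowTest 1 a b c d)))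
      (.and (.natEq o (.const 3)) (.and (shiftedTest a b c d) (belowTest (-1) a b c d))))

noncomputable def evalPair (τ : State ℝ) (p : NumExpr × NumExpr) : ℝ × ℝ := (p.1.eval τ, p.2.eval τ)

theorem holds_impTest (τ : State ℝ) (b c : Test) :
    (impTest b c).Holds τ ↔ (b.Holds τ → c.Holds τ) := by
  simp only [impTest, Test.Holds]; tauto

theorem holds_pointTest (τ : State ℝ) (q : ℚ) (p c d : NumExpr × NumExpr) :
    (pointTest q p c d).Holds τ ↔
      PointBelow q (evalPair τ p) (evalPair τ c) (evalPair τ d) := by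
  simp only [pointTest, halfTest, Test.Holds, holds_impTest, Test.holds_numEq, NumExpr.eval,
    PointBelow, HalfBelow, evalPair, Rat.cast_zero]

theorem holds_belowTest (τ : State ℝ) (q : ℚ) (a b c d : NumExpr × NumExpr) :
    (belowTest q a b c d).Holds τ ↔
      Below q (evalPair τ a) (evalPair τ b) (evalPair τ c) (evalPair τ d) := by
  simp only [belowTest, Test.Holds, holds_pointTest, Below, Rat.cast_neg]

theorem holds_orderTest (τ : State ℝ) (o : NatExpr) (a b c d : NumExpr × NumExpr) :
    (orderTest o a b c d).Holds τ ↔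
      Order (o.eval τ) (evalPair τ a) (evalPair τ b) (evalPair τ c) (evalPair τ d) := by
  simp only [orderTest, nestedTest, shiftedTest, Test.Holds, Test.holds_or, Test.holds_natEq,
    Test.holds_numLe, holds_belowTest, Order, Nested, Shifted, evalPair, Rat.cast_neg, Rat.cast_one,
    NatExpr.eval]

/-! The preparatory phases of the algorithm. -/

variable {num : ℕ → ℕ → ℕ → ℝ} {c d n k : ℕ}

/-- If this does not vanish, the coordinates `α` and `β` are injective on the plane `j` and can
serve as planar coordinates. -/
def minor (num : ℕ → ℕ → ℕ → ℝ) (j α β : ℕ) : ℝ :=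
  num 3 j α * num 4 j β - num 3 j β * num 4 j α

def minorExpr (j α β : NatExpr) : NumExpr :=
  .sub (.mul (.read 3 j α) (.read 4 j β)) (.mul (.read 3 j β) (.read 4 j α))

theorem minorExpr_eval (T : Mem) (j α β : NatExpr) :
    (minorExpr j α β).eval ⟨T, num⟩ = minor num (j.eval (⟨T, num⟩ : State ℝ))
      (α.eval (⟨T, num⟩ : State ℝ)) (β.eval (⟨T, num⟩ : State ℝ)) := rfl

/-- Tables `5` and `6` receive two coordinates that can be used in a plane. -/
def axesBody : Code :=
  cond (.not (.numEq (minorExpr (cell 23) (cell 26) (cell 27)) (.const 0)))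
    (.seq (setArr 5 (cell 23) (cell 26)) (setArr 6 (cell 23) (cell 27)))

def axes : Code := .loop 23 planeE (.loop 26 dimE (.loop 27 dimE axesBody))

theorem axes_spec (T : Mem) (hd : T 0 0 0 = d) (hk : T 0 0 2 = k) (hc : d + k + 5 ≤ c)
    (hex : ∀ j < k, ∃ α < d, ∃ β < d, minor num j α β ≠ 0) (j : ℕ) (hj : j < k) :
    axes.exec num c T 5 j 0 < d ∧ axes.exec num c T 6 j 0 < d ∧
      minor num j (axes.exec num c T 5 j 0) (axes.exec num c T 6 j 0) ≠ 0 := by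
  set G : ℕ → (ℕ → ℕ → ℕ) × (ℕ → ℕ → ℕ) → Prop := fun j p =>
    p.1 j 0 < d ∧ p.2 j 0 < d ∧ minor num j (p.1 j 0) (p.2 j 0) ≠ 0 with hG
  set π : Mem → (ℕ → ℕ → ℕ) × (ℕ → ℕ → ℕ) := fun T' => (T' 5, T' 6) with hπ
  have key := Code.loop_rule (num := num) (c := c) (v := 23) (b := planeE) (N := k)
    (P := .loop 26 dimE (.loop 27 dimE axesBody)) (T := T) π (fun i p => ∀ j < i, G j p)
    (fun T' x => by simp [hπ, update_of_ne]) (by simp [planeE, NatExpr.eval, hk]) (by omega)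
    (by simp) ?_
  · exact key j hj
  clear hj j
  intro j T₁ hj hj₁ hf₁ h1
  have e0₁ : T₁ 0 = T 0 := hf₁ _ (by decide) (by decide)
  have key := Code.loop_rule (num := num) (c := c) (v := 26) (b := dimE) (N := d)
    (P := .loop 27 dimE axesBody) (T := T₁) π
    (fun i p => (∀ j' < j, G j' p) ∧ ((∃ α < i, ∃ β < d, minor num j α β ≠ 0) → G j p))
    (fun T' x => by simp [hπ, update_of_ne]) (by simp [dimE, NatExpr.eval, e0₁, hd]) (by omega)
    ⟨h1, by simp⟩ ?_
  · intro j' hj'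
    rcases Nat.lt_succ_iff_lt_or_eq.1 hj' with h | rfl
    · exact key.1 j' h
    · exact key.2 (hex j' hj)
  intro α T₂ hα hα₂ hf₂ ⟨h2, h2'⟩
  have e0₂ : T₂ 0 = T 0 := (hf₂ _ (by decide) (by decide)).trans e0₁
  have ej₂ : T₂ 23 0 0 = j := by rw [hf₂ _ (by decide) (by decide)]; exact hj₁
  have key := Code.loop_rule (num := num) (c := c) (v := 27) (b := dimE) (N := d)
    (P := axesBody) (T := T₂) π
    (fun i p => (∀ j' < j, G j' p) ∧ (((∃ α' < α, ∃ β < d, minor num j α' β ≠ 0) ∨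
      ∃ β < i, minor num j α β ≠ 0) → G j p))
    (fun T' x => by simp [hπ, update_of_ne]) (by simp [dimE, NatExpr.eval, e0₂, hd]) (by omega)
    ⟨h2, by simpa using h2'⟩ ?_
  · refine ⟨key.1, ?_⟩
    rintro ⟨α', hα', h⟩
    refine key.2 ?_
    rcases Nat.lt_succ_iff_lt_or_eq.1 hα' with h' | rfl
    · exact Or.inl ⟨α', h', h⟩
    · exact Or.inr h
  intro β T₃ hβ hβ₃ hf₃ ⟨h3, h3'⟩
  have ej₃ : T₃ 23 0 0 = j := by rw [hf₃ _ (by decide) (by decide)]; exact ej₂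
  have eα₃ : T₃ 26 0 0 = α := by rw [hf₃ _ (by decide) (by decide)]; exact hα₂
  have m1 : min α c = α := by omega
  have m2 : min β c = β := by omega
  rcases exec_cond num c _ _ T₃ with ⟨h, he⟩ | ⟨h, he⟩ <;> rw [axesBody, he] <;>
    simp only [Test.Holds, Test.holds_numEq, minorExpr_eval, NumExpr.eval, NatExpr.eval, cell, ej₃,
      eα₃, hβ₃, Rat.cast_zero] at h
  · have e : π (Code.exec num c (.seq (setArr 5 (cell 23) (cell 26))
        (setArr 6 (cell 23) (cell 27))) T₃) =
        (fun i i' => if i = j ∧ i' = 0 then α else T₃ 5 i i',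
          fun i i' => if i = j ∧ i' = 0 then β else T₃ 6 i i') := by
      simp only [hπ, Code.exec, setArr, NatExpr.eval, cell, ej₃, eα₃, hβ₃, update_of_ne, ne_eq,
        Nat.reduceEqDiff, not_false_eq_true, m1, m2]
      ext i i' <;> simp [update_same, update_of_ne]
    rw [e]
    refine ⟨fun j' hj' => ?_, fun _ => ?_⟩
    · have := h3 j' hj'
      simp only [hG, hπ] at this ⊢
      simpa [show j' ≠ j by omega] using this
    · simp only [hG]
      simpa using ⟨hα, hβ, h⟩
  · refine ⟨h3, ?_⟩
    rintro (h' | ⟨β', hβ', h'⟩)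
    · exact h3' (Or.inl h')
    · refine h3' (Or.inr ⟨β', ?_, h'⟩)
      rcases Nat.lt_succ_iff_lt_or_eq.1 hβ' with h4 | rfl
      · exact h4
      · exact absurd h' h

/-- A loop that clears the flag in the cell `17` unless a condition holds for all the values of the
loop variable. -/
theorem flag_loop {v : ℕ} {b : NatExpr} {P : Code} {T : Mem} {N : ℕ} (Φ : ℕ → Prop) (hv : v ≠ 17)
    (hN : b.eval (⟨T, num⟩ : State ℝ) = N) (hNc : N ≤ c)
    (hs : ∀ i T', i < N → T' v 0 0 = i → (∀ a, a ≠ v → a ∉ P.writes → T' a = T a) →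
      (0 < P.exec num c T' 17 0 0 ↔ 0 < T' 17 0 0 ∧ Φ i)) :
    0 < (Code.loop v b P).exec num c T 17 0 0 ↔ 0 < T 17 0 0 ∧ ∀ i < N, Φ i := by
  refine Code.loop_rule (num := num) (c := c) (fun T' => T' 17 0 0)
    (fun i f => 0 < f ↔ 0 < T 17 0 0 ∧ ∀ i' < i, Φ i') (fun T' x => by simp [update_of_ne _ hv.symm])
    hN hNc (by simp) ?_
  intro i T' hi hi' hf h
  rw [hs i T' hi hi' hf, h, and_assoc, and_congr_right_iff]
  intro _
  exact ⟨fun h i' hi' => (Nat.lt_succ_iff_lt_or_eq.1 hi').elim (h.1 i') (fun e => e ▸ h.2),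
    fun h => ⟨fun i' hi' => h i' (by omega), h i (by omega)⟩⟩

theorem clear_flag (b : Test) (T : Mem) :
    0 < (cond b (setCell 17 (.const 0))).exec num c T 17 0 0 ↔
      0 < T 17 0 0 ∧ ¬ b.Holds ⟨T, num⟩ := by
  rcases exec_cond num c b (setCell 17 (.const 0)) T with ⟨h, he⟩ | ⟨h, he⟩ <;> rw [he]
  · simp [h, setCell, Code.exec, NatExpr.eval, update_same]
  · simp [h]

/-- The determinant whose vanishing for all `γ` means that a point lies in the plane `j`. -/
def det (num : ℕ → ℕ → ℕ → ℝ) (α β : ℕ) (x s j γ : ℕ) : ℝ :=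
  (num x s α - num 2 j α) * minor num j β γ - (num x s β - num 2 j β) * minor num j α γ +
    (num x s γ - num 2 j γ) * minor num j α β

def detExpr (x : ℕ) (s j γ : NatExpr) : NumExpr :=
  .add (.sub
    (.mul (.sub (.read x s (arr 5 j)) (.read 2 j (arr 5 j))) (minorExpr j (arr 6 j) γ))
    (.mul (.sub (.read x s (arr 6 j)) (.read 2 j (arr 6 j))) (minorExpr j (arr 5 j) γ)))
    (.mul (.sub (.read x s γ) (.read 2 j γ)) (minorExpr j (arr 5 j) (arr 6 j)))

theorem detExpr_eval {T T₀ : Mem} {x s' j' γ' : ℕ} {s j γ : NatExpr}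
    (hs : s.eval (⟨T, num⟩ : State ℝ) = s') (hj : j.eval (⟨T, num⟩ : State ℝ) = j')
    (hγ : γ.eval (⟨T, num⟩ : State ℝ) = γ') (h5 : T 5 = T₀ 5) (h6 : T 6 = T₀ 6) :
    (detExpr x s j γ).eval ⟨T, num⟩ = det num (T₀ 5 j' 0) (T₀ 6 j' 0) x s' j' γ' := by
  simp only [detExpr, NumExpr.eval, minorExpr_eval, arr, NatExpr.eval, hs, hj, hγ, h5, h6, det]

/-- The segment `t` lies in the plane `j`. -/
def InPlane (num : ℕ → ℕ → ℕ → ℝ) (d : ℕ) (T : Mem) (t j : ℕ) : Prop :=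
  ∀ γ < d, det num (T 5 j 0) (T 6 j 0) 0 t j γ = 0 ∧ det num (T 5 j 0) (T 6 j 0) 1 t j γ = 0

/-- Table `4` receives the last plane that contains a segment. -/
def classesFlag : Code :=
  .loop 28 dimE (cond (.not (.and
    (.numEq (detExpr 0 (cell 21) (cell 23) (cell 28)) (.const 0))
    (.numEq (detExpr 1 (cell 21) (cell 23) (cell 28)) (.const 0)))) (setCell 17 (.const 0)))

def classesBody : Code :=
  .seq (setCell 17 (.const 1)) (.seq classesFlag
    (cond (isPos (cell 17)) (setArr 4 (cell 21) (cell 23))))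

def classes : Code := .loop 21 segE (.loop 23 planeE classesBody)

theorem classesFlag_spec (T : Mem) (hd : T 0 0 0 = d) (hc : d ≤ c) :
    0 < classesFlag.exec num c T 17 0 0 ↔
      0 < T 17 0 0 ∧ InPlane num d T (T 21 0 0) (T 23 0 0) := by
  refine flag_loop _ (by decide) (by simp [dimE, NatExpr.eval, hd]) hc ?_
  intro γ T' hγ hγ' hf
  have e5 : T' 5 = T 5 := hf _ (by decide) (by decide)
  have e6 : T' 6 = T 6 := hf _ (by decide) (by decide)
  have e21 : T' 21 = T 21 := hf _ (by decide) (by decide)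
  have e23 : T' 23 = T 23 := hf _ (by decide) (by decide)
  rw [clear_flag]
  simp only [Test.Holds, Test.holds_numEq, not_not]
  rw [detExpr_eval (s' := T 21 0 0) (j' := T 23 0 0) (γ' := γ) (T₀ := T)
      (by simp [cell, NatExpr.eval, e21]) (by simp [cell, NatExpr.eval, e23])
      (by simp [cell, NatExpr.eval, hγ']) e5 e6,
    detExpr_eval (s' := T 21 0 0) (j' := T 23 0 0) (γ' := γ) (T₀ := T)
      (by simp [cell, NatExpr.eval, e21]) (by simp [cell, NatExpr.eval, e23])
      (by simp [cell, NatExpr.eval, hγ']) e5 e6]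
  simp [NumExpr.eval]

/-- Overwriting during an increasing scan leaves the last plane. Its maximality is what later
ensures that a segment is not contained in any plane of larger number. -/
theorem classes_spec (T : Mem) (hd : T 0 0 0 = d) (hn : T 0 0 1 = n) (hk : T 0 0 2 = k)
    (hc : d + n + k + 5 ≤ c) (hex : ∀ t < n, ∃ j < k, InPlane num d T t j) (t : ℕ) (ht : t < n) :
    classes.exec num c T 4 t 0 < k ∧ InPlane num d T t (classes.exec num c T 4 t 0) ∧
      ∀ j < k, classes.exec num c T 4 t 0 < j → ¬ InPlane num d T t j := by
  set G : ℕ → ℕ → (ℕ → ℕ → ℕ) → Prop := fun i t p => (∃ j < i, InPlane num d T t j) →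
    p t 0 < i ∧ InPlane num d T t (p t 0) ∧ ∀ j < i, p t 0 < j → ¬ InPlane num d T t j with hG
  have key := Code.loop_rule (num := num) (c := c) (v := 21) (b := segE) (N := n)
    (P := .loop 23 planeE classesBody) (T := T) (fun T' => T' 4) (fun i p => ∀ t < i, G k t p)
    (fun T' x => by simp [update_of_ne]) (by simp [segE, NatExpr.eval, hn]) (by omega)
    (by simp) ?_
  · exact key t ht (hex t ht)
  clear ht t
  intro t T₁ ht ht₁ hf₁ h1
  have e0₁ : T₁ 0 = T 0 := hf₁ _ (by decide) (by decide)
  have key := Code.loop_rule (num := num) (c := c) (v := 23) (b := planeE) (N := k)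
    (P := classesBody) (T := T₁) (fun T' => T' 4) (fun i p => (∀ t' < t, G k t' p) ∧ G i t p)
    (fun T' x => by simp [update_of_ne]) (by simp [planeE, NatExpr.eval, e0₁, hk]) (by omega)
    ⟨h1, by simp [hG]⟩ ?_
  · intro t' ht'
    rcases Nat.lt_succ_iff_lt_or_eq.1 ht' with h | rfl
    · exact key.1 t' h
    · exact key.2
  intro j T₂ hj hj₂ hf₂ ⟨h2, h3⟩
  have e0₂ : T₂ 0 = T 0 := (hf₂ _ (by decide) (by decide)).trans e0₁
  have e5 : T₂ 5 = T 5 := (hf₂ _ (by decide) (by decide)).trans (hf₁ _ (by decide) (by decide))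
  have e6 : T₂ 6 = T 6 := (hf₂ _ (by decide) (by decide)).trans (hf₁ _ (by decide) (by decide))
  have et : T₂ 21 0 0 = t := by rw [hf₂ _ (by decide) (by decide)]; exact ht₁
  set T₃ := (setCell 17 (.const 1)).exec num c T₂ with hT₃
  have f₃ : ∀ a, a ≠ 17 → T₃ a = T₂ a := fun a ha =>
    Code.exec_frame _ _ _ _ (by simpa [setCell, Code.writes] using ha)
  have e17 : T₃ 17 0 0 = 1 := by
    simp [hT₃, setCell, Code.exec, NatExpr.eval, update_same]; omega
  set T₄ := classesFlag.exec num c T₃ with hT₄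
  have f₄ : ∀ a, a ∉ [28, 17] → T₄ a = T₃ a := fun a ha =>
    Code.exec_frame _ _ _ _ (by simpa [classesFlag, cond, setCell, Code.writes] using ha)
  have hflag : 0 < T₄ 17 0 0 ↔ InPlane num d T t j := by
    rw [hT₄, classesFlag_spec (d := d) T₃ (by rw [f₃ 0 (by decide), e0₂, hd]) (by omega), e17,
      f₃ 21 (by decide), f₃ 23 (by decide), et, hj₂]
    simp only [InPlane, f₃ 5 (by decide), f₃ 6 (by decide), e5, e6]
    simp
  have e4 : T₄ 4 = T₂ 4 := by rw [f₄ 4 (by decide), f₃ 4 (by decide)]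
  have et₄ : T₄ 21 0 0 = t := by rw [f₄ 21 (by decide), f₃ 21 (by decide), et]
  have ej₄ : T₄ 23 0 0 = j := by rw [f₄ 23 (by decide), f₃ 23 (by decide), hj₂]
  show _ ∧ G (j + 1) t ((cond (isPos (cell 17)) (setArr 4 (cell 21) (cell 23))).exec num c T₄ 4)
  rw [show classesBody.exec num c T₂ = (cond (isPos (cell 17))
    (setArr 4 (cell 21) (cell 23))).exec num c T₄ from rfl]
  rcases exec_cond num c (isPos (cell 17)) (setArr 4 (cell 21) (cell 23)) T₄ with
    ⟨h, he⟩ | ⟨h, he⟩ <;> rw [he] <;> simp only [Test.Holds, isPos, NatExpr.eval, cell, hflag] at h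
  · have e : (setArr 4 (cell 21) (cell 23)).exec num c T₄ 4 =
        fun i i' => if i = t ∧ i' = 0 then j else T₂ 4 i i' := by
      funext i i'
      have : min j c = j := by omega
      simp [setArr, Code.exec, NatExpr.eval, cell, et₄, ej₄, update_same, e4, this]
    rw [e]
    refine ⟨fun t' ht' => ?_, fun _ => ?_⟩
    · have := h2 t' ht'
      simp only [hG] at this ⊢
      simpa [show t' ≠ t by omega] using this
    · simp only [and_self, if_true]
      exact ⟨by omega, h, fun j' hj' hj'' => by omega⟩
  · rw [e4]
    refine ⟨h2, ?_⟩
    rintro ⟨j', hj', hin⟩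
    have hj'' : j' ≠ j := by rintro rfl; exact h hin
    obtain ⟨g1, g2, g3⟩ := h3 ⟨j', by omega, hin⟩
    refine ⟨by omega, g2, fun i hi hi' => ?_⟩
    rcases Nat.lt_succ_iff_lt_or_eq.1 hi with h4 | rfl
    · exact g3 i h4 hi'
    · exact h

end Algorithm

end Geom

/-! ### Programs for the orders within planes and for intersections across planes. -/

namespace Geom

namespace Algorithm

open Machine

variable {num : ℕ → ℕ → ℕ → ℝ} {c d n k : ℕ}

/-- The end point of the segment `s` that is stored in table `x`, in the coordinates of the plane
of the segment. -/
def pointExpr (x : ℕ) (s : NatExpr) : NumExpr × NumExpr :=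
  (.read x s (arr 5 (arr 4 s)), .read x s (arr 6 (arr 4 s)))

def planePoint (num : ℕ → ℕ → ℕ → ℝ) (α β : ℕ) (x s : ℕ) : ℝ × ℝ := (num x s α, num x s β)

def OrderRel (num : ℕ → ℕ → ℕ → ℝ) (T : Mem) (a s t : ℕ) : Prop :=
  T 4 s 0 = T 4 t 0 ∧
    Order a (planePoint num (T 5 (T 4 s 0) 0) (T 6 (T 4 s 0) 0) 0 s)
      (planePoint num (T 5 (T 4 s 0) 0) (T 6 (T 4 s 0) 0) 1 s)
      (planePoint num (T 5 (T 4 s 0) 0) (T 6 (T 4 s 0) 0) 0 t)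
      (planePoint num (T 5 (T 4 s 0) 0) (T 6 (T 4 s 0) 0) 1 t)

/-- Table `7` receives the four orders. -/
def ordersBody : Code :=
  cond (.and (.natEq (arr 4 (cell 22)) (arr 4 (cell 21)))
    (orderTest (cell 24) (pointExpr 0 (cell 22)) (pointExpr 1 (cell 22)) (pointExpr 0 (cell 21))
      (pointExpr 1 (cell 21))))
    (.set 7 (.add (.mul (cell 24) segE) (cell 22)) (cell 21) (.const 1))

def orders : Code := .loop 24 (.const 4) (.loop 22 segE (.loop 21 segE ordersBody))

/-- The rows of table `7` encode pairs of an order and a segment. -/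
theorem mul_add_inj {a a' s s' : ℕ} (hs : s < n) (hs' : s' < n) (h : a * n + s = a' * n + s') :
    a = a' ∧ s = s' := by
  have hpos : 0 < n := by omega
  have h1 : (a * n + s) / n = a := by
    rw [mul_comm, Nat.mul_add_div hpos, Nat.div_eq_of_lt hs, add_zero]
  have h2 : (a' * n + s') / n = a' := by
    rw [mul_comm, Nat.mul_add_div hpos, Nat.div_eq_of_lt hs', add_zero]
  have : a = a' := by rw [← h1, ← h2, h]
  subst this
  exact ⟨rfl, by omega⟩

theorem orders_spec (T : Mem) (hn : T 0 0 1 = n) (hc : n + 5 ≤ c) (hz : ∀ i j, T 7 i j = 0)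
    (a s t : ℕ) (ha : a < 4) (hs : s < n) (ht : t < n) :
    0 < orders.exec num c T 7 (a * n + s) t ↔ OrderRel num T a s t := by
  set G : (ℕ → ℕ → ℕ → Prop) → (ℕ → ℕ → ℕ) → Prop := fun Q p =>
    ∀ a < 4, ∀ s < n, ∀ t < n, 0 < p (a * n + s) t ↔ Q a s t ∧ OrderRel num T a s t with hG
  have congr : ∀ {Q Q' : ℕ → ℕ → ℕ → Prop} {p}, G Q p →
      (∀ a s t, s < n → t < n → (Q a s t ↔ Q' a s t)) → G Q' p := by
    intro Q Q' p h hQ a ha s hs t ht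
    rw [h a ha s hs t ht, hQ a s t hs ht]
  have key := Code.loop_rule (num := num) (c := c) (v := 24) (b := .const 4) (N := 4)
    (P := .loop 22 segE (.loop 21 segE ordersBody)) (T := T) (fun T' => T' 7)
    (fun i p => G (fun a _ _ => a < i) p)
    (fun T' x => by simp [update_of_ne]) rfl (by omega) (by simp [hG, hz]) ?_
  · simpa [ha, orders] using key a ha s hs t ht
  clear ha hs ht a s t
  intro a T₁ ha ha₁ hf₁ h1
  have hfr₁ : ∀ b ∈ [0, 4, 5, 6], T₁ b = T b := by
    intro b hb; fin_cases hb <;> exact hf₁ _ (by decide) (by decide)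
  have key := Code.loop_rule (num := num) (c := c) (v := 22) (b := segE) (N := n)
    (P := .loop 21 segE ordersBody) (T := T₁) (fun T' => T' 7)
    (fun i p => G (fun a' s _ => a' < a ∨ a' = a ∧ s < i) p)
    (fun T' x => by simp [update_of_ne]) (by simp [segE, NatExpr.eval, hfr₁ 0, hn]) (by omega)
    (congr h1 (by simp)) ?_
  · exact congr key (by intros; omega)
  intro s T₂ hs hs₂ hf₂ h2
  have hfr₂ : ∀ b ∈ [0, 4, 5, 6, 24], T₂ b = T₁ b := by
    intro b hb; fin_cases hb <;> exact hf₂ _ (by decide) (by decide)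
  have key := Code.loop_rule (num := num) (c := c) (v := 21) (b := segE) (N := n)
    (P := ordersBody) (T := T₂) (fun T' => T' 7)
    (fun i p => G (fun a' s' t => a' < a ∨ a' = a ∧ (s' < s ∨ s' = s ∧ t < i)) p)
    (fun T' x => by simp [update_of_ne]) (by simp [segE, NatExpr.eval, hfr₂ 0, hfr₁ 0, hn])
    (by omega) (congr h2 (by intros; omega)) ?_
  · exact congr key (by intros; omega)
  intro t T₃ ht ht₃ hf₃ h3
  have hfr₃ : ∀ b ∈ [0, 4, 5, 6, 22, 24], T₃ b = T₂ b := by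
    intro b hb; fin_cases hb <;> exact hf₃ _ (by decide) (by decide)
  have e0 : T₃ 0 0 1 = n := by simp [hfr₃, hfr₂, hfr₁, hn]
  have e4 : T₃ 4 = T 4 := by simp [hfr₃, hfr₂, hfr₁]
  have e5 : T₃ 5 = T 5 := by simp [hfr₃, hfr₂, hfr₁]
  have e6 : T₃ 6 = T 6 := by simp [hfr₃, hfr₂, hfr₁]
  have ea : T₃ 24 0 0 = a := by simp [hfr₃, hfr₂, ha₁]
  have es : T₃ 22 0 0 = s := by simp [hfr₃, hs₂]
  have m1 : min 1 c = 1 := by omega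
  have hiff : Test.Holds (⟨T₃, num⟩ : State ℝ) (.and (.natEq (arr 4 (cell 22)) (arr 4 (cell 21)))
      (orderTest (cell 24) (pointExpr 0 (cell 22)) (pointExpr 1 (cell 22)) (pointExpr 0 (cell 21))
        (pointExpr 1 (cell 21)))) ↔ OrderRel num T a s t := by
    simp only [Test.Holds, Test.holds_natEq, holds_orderTest, evalPair, pointExpr, NumExpr.eval,
      NatExpr.eval, arr, cell, ht₃, e4, e5, e6, ea, es, OrderRel, planePoint]
    refine and_congr_right fun h => ?_
    rw [h]
  rcases exec_cond num c _ _ T₃ with ⟨h, he⟩ | ⟨h, he⟩ <;> rw [ordersBody, he] <;> rw [hiff] at h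
  · rw [Code.exec_set (i' := a * n + s) (j' := t) (v := 1)
      (by simp [NatExpr.eval, cell, segE, ea, e0, es]) (by simp [NatExpr.eval, cell, ht₃]) rfl
      (by omega)]
    intro a' ha' s' hs' t' ht'
    have h4 := h3 a' ha' s' hs' t' ht'
    rw [update_same]
    by_cases heq : a' * n + s' = a * n + s ∧ t' = t
    · obtain ⟨rfl, rfl⟩ := mul_add_inj hs' hs heq.1
      obtain rfl := heq.2
      simp [h]
    · rw [if_neg heq, h4]
      refine and_congr_left fun _ => ?_
      have : ¬ (a' = a ∧ s' = s ∧ t' = t) := by rintro ⟨rfl, rfl, rfl⟩; exact heq ⟨rfl, rfl⟩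
      omega
  · intro a' ha' s' hs' t' ht'
    rw [h3 a' ha' s' hs' t' ht']
    refine and_congr_left fun hr => ?_
    have : ¬ (a' = a ∧ s' = s ∧ t' = t) := by rintro ⟨rfl, rfl, rfl⟩; exact h hr
    omega

/-- The coordinate `δ` of the point of the line of the segment `s` in the plane `j`, from the
values of the determinant at the ends of the segment. -/
noncomputable def crossing (num : ℕ → ℕ → ℕ → ℝ) (x y : ℝ) (s δ : ℕ) : ℝ :=
  num 0 s δ + x / (x - y) * (num 1 s δ - num 0 s δ)

def crossingExpr (x y : NumExpr) (s δ : NatExpr) : NumExpr :=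
  .add (.read 0 s δ) (.mul (.div x (.sub x y)) (.sub (.read 1 s δ) (.read 0 s δ)))

/-- The condition for a point `p` to be on the segment `t` that refers to two coordinates. -/
def OnSegment (num : ℕ → ℕ → ℕ → ℝ) (p : ℕ → ℝ) (t δ ε : ℕ) : Prop :=
  (p δ - num 0 t δ) * (num 1 t ε - num 0 t ε) = (p ε - num 0 t ε) * (num 1 t δ - num 0 t δ) ∧
    (p δ - num 0 t δ) * (p δ - num 1 t δ) ≤ 0

def onSegmentTest (p q : NumExpr) (t δ ε : NatExpr) : Test :=
  .and (.numEq (.mul (.sub p (.read 0 t δ)) (.sub (.read 1 t ε) (.read 0 t ε)))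
      (.mul (.sub q (.read 0 t ε)) (.sub (.read 1 t δ) (.read 0 t δ))))
    (.numLe (.mul (.sub p (.read 0 t δ)) (.sub p (.read 1 t δ))) (.const 0))

def leftDet : NumExpr := detExpr 0 (cell 22) (arr 4 (cell 21)) (cell 28)
def rightDet : NumExpr := detExpr 1 (cell 22) (arr 4 (cell 21)) (cell 28)

def meetsFlag : Code :=
  .loop 26 dimE (.loop 27 dimE (cond (.not (onSegmentTest
    (crossingExpr leftDet rightDet (cell 22) (cell 26))
    (crossingExpr leftDet rightDet (cell 22) (cell 27)) (cell 21) (cell 26) (cell 27)))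
    (setCell 17 (.const 0))))

/-- Table `8` receives the pairs of a segment and a segment in a plane that does not contain the
first one such that the two meet. -/
def meetsBody : Code :=
  cond (.and (.not (.numEq leftDet rightDet)) (.numLe (.mul leftDet rightDet) (.const 0)))
    (.seq (setCell 17 (.const 1)) (.seq meetsFlag
      (cond (isPos (cell 17)) (.set 8 (cell 22) (cell 21) (.const 1)))))

def meets : Code := .loop 22 segE (.loop 21 segE (.loop 28 dimE meetsBody))

def endDet (num : ℕ → ℕ → ℕ → ℝ) (T : Mem) (x s t γ : ℕ) : ℝ :=
  det num (T 5 (T 4 t 0) 0) (T 6 (T 4 t 0) 0) x s (T 4 t 0) γ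

/-- The determinant number `γ` of the plane of `t` is not constant along `s` and has weakly opposite
signs at its ends. It therefore vanishes at exactly one parameter in the unit interval, and the last
clause tests whether the corresponding point lies on `t`. -/
def CrossAt (num : ℕ → ℕ → ℕ → ℝ) (d : ℕ) (T : Mem) (s t γ : ℕ) : Prop :=
  (endDet num T 0 s t γ ≠ endDet num T 1 s t γ ∧
    endDet num T 0 s t γ * endDet num T 1 s t γ ≤ 0) ∧
  ∀ δ < d, ∀ ε < d, OnSegment num (crossing num (endDet num T 0 s t γ) (endDet num T 1 s t γ) s)
    t δ ε

theorem endDet_eval {T T₀ : Mem} {x s t γ : ℕ} (hs : T 22 0 0 = s) (ht : T 21 0 0 = t)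
    (hγ : T 28 0 0 = γ) (h4 : T 4 = T₀ 4) (h5 : T 5 = T₀ 5) (h6 : T 6 = T₀ 6) :
    (detExpr x (cell 22) (arr 4 (cell 21)) (cell 28)).eval ⟨T, num⟩ = endDet num T₀ x s t γ :=
  detExpr_eval (by simp [cell, NatExpr.eval, hs]) (by simp [cell, arr, NatExpr.eval, ht, h4])
    (by simp [cell, NatExpr.eval, hγ]) h5 h6

theorem meetsFlag_spec (T : Mem) (hd : T 0 0 0 = d) (hc : d ≤ c) {s t γ : ℕ} (hs : T 22 0 0 = s)
    (ht : T 21 0 0 = t) (hγ : T 28 0 0 = γ) :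
    0 < meetsFlag.exec num c T 17 0 0 ↔ 0 < T 17 0 0 ∧ ∀ δ < d, ∀ ε < d,
      OnSegment num (crossing num (endDet num T 0 s t γ) (endDet num T 1 s t γ) s) t δ ε := by
  refine flag_loop _ (by decide) (by simp [dimE, NatExpr.eval, hd]) hc ?_
  intro δ T₁ hδ hδ₁ hf₁
  have hfr₁ : ∀ b ∈ [0, 4, 5, 6, 21, 22, 28], T₁ b = T b := by
    intro b hb; fin_cases hb <;> exact hf₁ _ (by decide) (by decide)
  refine flag_loop _ (by decide) (by simp [dimE, NatExpr.eval, hfr₁, hd]) hc ?_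
  intro ε T₂ hε hε₂ hf₂
  have hfr₂ : ∀ b ∈ [0, 4, 5, 6, 21, 22, 26, 28], T₂ b = T₁ b := by
    intro b hb; fin_cases hb <;> exact hf₂ _ (by decide) (by decide)
  have es : T₂ 22 0 0 = s := by simp [hfr₂, hfr₁, hs]
  have et : T₂ 21 0 0 = t := by simp [hfr₂, hfr₁, ht]
  have eδ : T₂ 26 0 0 = δ := by simp [hfr₂, hδ₁]
  have hdet : ∀ x, (detExpr x (cell 22) (arr 4 (cell 21)) (cell 28)).eval ⟨T₂, num⟩ =
      endDet num T x s t γ := fun x =>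
    endDet_eval es et (by simp [hfr₂, hfr₁, hγ]) (by simp [hfr₂, hfr₁]) (by simp [hfr₂, hfr₁])
      (by simp [hfr₂, hfr₁])
  have hl : leftDet.eval ⟨T₂, num⟩ = endDet num T 0 s t γ := hdet 0
  have hr : rightDet.eval ⟨T₂, num⟩ = endDet num T 1 s t γ := hdet 1
  rw [clear_flag]
  simp only [Test.Holds, onSegmentTest, crossingExpr, Test.holds_numEq, Test.holds_numLe, not_not,
    NumExpr.eval, hl, hr, NatExpr.eval, cell, es, et, eδ, hε₂, Rat.cast_zero,
    OnSegment, crossing]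

theorem meets_spec (T : Mem) (hd : T 0 0 0 = d) (hn : T 0 0 1 = n) (hc : d + n + 5 ≤ c)
    (hz : ∀ i j, T 8 i j = 0) (s t : ℕ) (hs : s < n) (ht : t < n) :
    0 < meets.exec num c T 8 s t ↔ ∃ γ < d, CrossAt num d T s t γ := by
  set G : (ℕ → ℕ → ℕ → Prop) → (ℕ → ℕ → ℕ) → Prop := fun Q p =>
    ∀ s < n, ∀ t < n, 0 < p s t ↔ ∃ γ < d, Q s t γ ∧ CrossAt num d T s t γ with hG
  have congr : ∀ {Q Q' : ℕ → ℕ → ℕ → Prop} {p}, G Q p →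
      (∀ s t γ, s < n → t < n → γ < d → (Q s t γ ↔ Q' s t γ)) → G Q' p := by
    intro Q Q' p h hQ s hs t ht
    rw [h s hs t ht]
    refine exists_congr fun γ => and_congr_right fun hγ => ?_
    rw [hQ s t γ hs ht hγ]
  have key := Code.loop_rule (num := num) (c := c) (v := 22) (b := segE) (N := n)
    (P := .loop 21 segE (.loop 28 dimE meetsBody)) (T := T) (fun T' => T' 8)
    (fun i p => G (fun s _ _ => s < i) p)
    (fun T' x => by simp [update_of_ne]) (by simp [segE, NatExpr.eval, hn]) (by omega)
    (by simp [hG, hz]) ?_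
  · simpa [hs, meets] using key s hs t ht
  clear hs ht s t
  intro s T₁ hs hs₁ hf₁ h1
  have hfr₁ : ∀ b ∈ [0, 4, 5, 6], T₁ b = T b := by
    intro b hb; fin_cases hb <;> exact hf₁ _ (by decide) (by decide)
  have key := Code.loop_rule (num := num) (c := c) (v := 21) (b := segE) (N := n)
    (P := .loop 28 dimE meetsBody) (T := T₁) (fun T' => T' 8)
    (fun i p => G (fun s' t _ => s' < s ∨ s' = s ∧ t < i) p)
    (fun T' x => by simp [update_of_ne]) (by simp [segE, NatExpr.eval, hfr₁ 0, hn]) (by omega)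
    (congr h1 (by simp)) ?_
  · exact congr key (by intros; omega)
  intro t T₂ ht ht₂ hf₂ h2
  have hfr₂ : ∀ b ∈ [0, 4, 5, 6, 22], T₂ b = T₁ b := by
    intro b hb; fin_cases hb <;> exact hf₂ _ (by decide) (by decide)
  have key := Code.loop_rule (num := num) (c := c) (v := 28) (b := dimE) (N := d)
    (P := meetsBody) (T := T₂) (fun T' => T' 8)
    (fun i p => G (fun s' t' γ => s' < s ∨ s' = s ∧ (t' < t ∨ t' = t ∧ γ < i)) p)
    (fun T' x => by simp [update_of_ne]) (by simp [dimE, NatExpr.eval, hfr₂ 0, hfr₁ 0, hd])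
    (by omega) (congr h2 (by intros; omega)) ?_
  · exact congr key (by intros; omega)
  intro γ T₃ hγ hγ₃ hf₃ h3
  have hfr₃ : ∀ b ∈ [0, 4, 5, 6, 21, 22], T₃ b = T₂ b := by
    intro b hb; fin_cases hb <;> exact hf₃ _ (by decide) (by decide)
  have e4 : T₃ 4 = T 4 := by simp [hfr₃, hfr₂, hfr₁]
  have e5 : T₃ 5 = T 5 := by simp [hfr₃, hfr₂, hfr₁]
  have e6 : T₃ 6 = T 6 := by simp [hfr₃, hfr₂, hfr₁]
  have es : T₃ 22 0 0 = s := by simp [hfr₃, hfr₂, hs₁]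
  have et : T₃ 21 0 0 = t := by simp [hfr₃, ht₂]
  have hdet : ∀ x, (detExpr x (cell 22) (arr 4 (cell 21)) (cell 28)).eval ⟨T₃, num⟩ =
      endDet num T x s t γ := fun x => endDet_eval es et hγ₃ e4 e5 e6
  have hold : ¬ CrossAt num d T s t γ →
      G (fun s' t' γ' => s' < s ∨ s' = s ∧ (t' < t ∨ t' = t ∧ γ' < γ + 1)) (T₃ 8) := by
    intro hno s' hs' t' ht'
    rw [h3 s' hs' t' ht']
    refine exists_congr fun γ' => and_congr_right fun _ => and_congr_left fun hr => ?_
    have : ¬ (s' = s ∧ t' = t ∧ γ' = γ) := by rintro ⟨rfl, rfl, rfl⟩; exact hno hr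
    omega
  rcases exec_cond num c _ _ T₃ with ⟨h, he⟩ | ⟨h, he⟩ <;> rw [meetsBody, he] <;>
    simp only [Test.Holds, Test.holds_numEq, Test.holds_numLe, NumExpr.eval, leftDet, rightDet,
      hdet, Rat.cast_zero] at h
  swap
  · exact hold fun hcr => h hcr.1
  set T₄ := (setCell 17 (.const 1)).exec num c T₃ with hT₄
  have f₄ : ∀ a, a ≠ 17 → T₄ a = T₃ a := fun a ha =>
    Code.exec_frame _ _ _ _ (by simpa [setCell, Code.writes] using ha)
  have e17 : T₄ 17 0 0 = 1 := by
    simp [hT₄, setCell, Code.exec, NatExpr.eval, update_same]; omega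
  set T₅ := meetsFlag.exec num c T₄ with hT₅
  have f₅ : ∀ a, a ∉ [26, 27, 17] → T₅ a = T₄ a := fun a ha =>
    Code.exec_frame _ _ _ _ (by simpa [meetsFlag, cond, setCell, Code.writes] using ha)
  have hE : ∀ x, endDet num T₄ x s t γ = endDet num T x s t γ := by
    intro x
    simp only [endDet, f₄ 4 (by decide), f₄ 5 (by decide), f₄ 6 (by decide), e4, e5, e6]
  have hflag : 0 < T₅ 17 0 0 ↔ CrossAt num d T s t γ := by
    rw [hT₅, meetsFlag_spec (d := d) (s := s) (t := t) (γ := γ) T₄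
      (by rw [f₄ 0 (by decide)]; simp [hfr₃, hfr₂, hfr₁, hd]) (by omega)
      (by rw [f₄ 22 (by decide), es]) (by rw [f₄ 21 (by decide), et])
      (by rw [f₄ 28 (by decide), hγ₃]), e17, hE, hE]
    simp only [CrossAt]
    constructor
    · exact fun h' => ⟨h, h'.2⟩
    · exact fun h' => ⟨one_pos, h'.2⟩
  have e8 : T₅ 8 = T₃ 8 := by rw [f₅ 8 (by decide), f₄ 8 (by decide)]
  have es₅ : T₅ 22 0 0 = s := by rw [f₅ 22 (by decide), f₄ 22 (by decide), es]
  have et₅ : T₅ 21 0 0 = t := by rw [f₅ 21 (by decide), f₄ 21 (by decide), et]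
  have hbody : Code.exec num c ((setCell 17 (.const 1)).seq (meetsFlag.seq
      (cond (isPos (cell 17)) (.set 8 (cell 22) (cell 21) (.const 1))))) T₃ =
      (cond (isPos (cell 17)) (.set 8 (cell 22) (cell 21) (.const 1))).exec num c T₅ := rfl
  rw [hbody]
  rcases exec_cond num c (isPos (cell 17)) (.set 8 (cell 22) (cell 21) (.const 1)) T₅ with
    ⟨h', he'⟩ | ⟨h', he'⟩ <;> rw [he'] <;>
    simp only [Test.Holds, isPos, NatExpr.eval, cell, hflag] at h'
  · rw [Code.exec_set (i' := s) (j' := t) (v := 1) (by simp [NatExpr.eval, cell, es₅])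
      (by simp [NatExpr.eval, cell, et₅]) rfl (by omega)]
    intro s' hs' t' ht'
    rw [update_same]
    by_cases heq : s' = s ∧ t' = t
    · obtain ⟨rfl, rfl⟩ := heq
      simp only [and_self, if_true, zero_lt_one, true_iff]
      exact ⟨γ, hγ, by simp, h'⟩
    · rw [if_neg heq, e8, h3 s' hs' t' ht']
      refine exists_congr fun γ' => and_congr_right fun _ => and_congr_left fun hr => ?_
      omega
  · rw [e8]; exact hold h'

end Algorithm

end Geom

/-! ### Disjoint segments in the plane are comparable in one of four strict orders. -/

namespace Geom

namespace Algorithm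

/-- The points of the segment from `a` to `b`. -/
def segPoint (a b : ℝ × ℝ) (l : ℝ) : ℝ × ℝ := (a.1 + l * (b.1 - a.1), a.2 + l * (b.2 - a.2))

/-- Every point of the first segment is below (for `σ = 1`) every point of the second one on the
same vertical line. -/
def SegBelow (σ : ℝ) (a b c d : ℝ × ℝ) : Prop :=
  ∀ l ∈ Set.Icc (0 : ℝ) 1, ∀ m ∈ Set.Icc (0 : ℝ) 1, (segPoint a b l).1 = (segPoint c d m).1 →
    σ * (segPoint a b l).2 < σ * (segPoint c d m).2

/-- On the vertical line of `p`, the expression in `HalfBelow` is the product of `d.1 - c.1` and the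
signed vertical gap. -/
theorem pointBelow_iff (σ : ℝ) (p c d : ℝ × ℝ) :
    PointBelow σ p c d ↔
      ∀ m ∈ Set.Icc (0 : ℝ) 1, p.1 = (segPoint c d m).1 → σ * p.2 < σ * (segPoint c d m).2 := by
  obtain ⟨p1, p2⟩ := p
  obtain ⟨c1, c2⟩ := c
  obtain ⟨d1, d2⟩ := d
  simp only [PointBelow, HalfBelow, segPoint]
  constructor
  · rintro ⟨⟨h1, h2⟩, h3, h4⟩ m ⟨hm0, hm1⟩ he
    rcases hm0.eq_or_lt with rfl | hm0
    · have := h1 (by linarith)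
      linarith
    rcases hm1.eq_or_lt with rfl | hm1
    · have := h2 (by linarith)
      linarith
    rcases lt_trichotomy c1 d1 with hcd | hcd | hcd
    · have h5 : 0 < m * (d1 - c1) := mul_pos hm0 (by linarith)
      have h6 : 0 < (1 - m) * (d1 - c1) := mul_pos (by linarith) (by linarith)
      have h7 := h3 ⟨by linarith, by linarith⟩
      have h8 : σ * ((d1 - p1) * (c2 - p2) + (p1 - c1) * (d2 - p2)) =
          (d1 - c1) * (σ * (c2 + m * (d2 - c2)) - σ * p2) := by rw [he]; ring
      rw [h8] at h7
      have := (mul_pos_iff_of_pos_left (by linarith)).1 h7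
      linarith
    -- On a vertical segment the conditions at the two ends are combined with weights `1 - m` and
    -- `m`.
    · subst hcd
      have hp : c1 = p1 := by rw [he]; ring
      have h5 := mul_lt_mul_of_pos_left (h1 hp) (show 0 < 1 - m by linarith)
      have h6 := mul_lt_mul_of_pos_left (h2 hp) hm0
      linarith
    · have h5 : 0 < m * (c1 - d1) := mul_pos hm0 (by linarith)
      have h6 : 0 < (1 - m) * (c1 - d1) := mul_pos (by linarith) (by linarith)
      have h7 := h4 ⟨by linarith, by linarith⟩
      have h8 : σ * ((c1 - p1) * (d2 - p2) + (p1 - d1) * (c2 - p2)) =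
          (c1 - d1) * (σ * (c2 + m * (d2 - c2)) - σ * p2) := by rw [he]; ring
      rw [h8] at h7
      have := (mul_pos_iff_of_pos_left (by linarith)).1 h7
      linarith
  · intro h
    have inner : ∀ m ∈ Set.Icc (0 : ℝ) 1, p1 = c1 + m * (d1 - c1) →
        0 < σ * (c2 + m * (d2 - c2)) - σ * p2 := fun m hm he => sub_pos.2 (h m hm he)
    refine ⟨⟨fun he => ?_, fun he => ?_⟩, fun ⟨h1, h2⟩ => ?_, fun ⟨h1, h2⟩ => ?_⟩
    · simpa using h 0 (by simp) (by linarith)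
    · have := h 1 (by simp) (by linarith)
      linarith
    · have hpos : 0 < d1 - c1 := by linarith
      have h3 := inner ((p1 - c1) / (d1 - c1)) ⟨by apply div_nonneg <;> linarith,
        by rw [div_le_one hpos]; linarith⟩ (by field_simp; ring)
      have h4 := mul_pos hpos h3
      have h5 : (d1 - c1) * (σ * (c2 + (p1 - c1) / (d1 - c1) * (d2 - c2)) - σ * p2) =
          σ * ((d1 - p1) * (c2 - p2) + (p1 - c1) * (d2 - p2)) := by
        field_simp; ring
      rwa [h5] at h4
    · have hpos : 0 < c1 - d1 := by linarith
      have h3 := inner ((c1 - p1) / (c1 - d1)) ⟨by apply div_nonneg <;> linarith,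
        by rw [div_le_one hpos]; linarith⟩ (by field_simp; ring)
      have h4 := mul_pos hpos h3
      have h5 : (c1 - d1) * (σ * (c2 + (c1 - p1) / (c1 - d1) * (d2 - c2)) - σ * p2) =
          σ * ((c1 - p1) * (d2 - p2) + (p1 - d1) * (c2 - p2)) := by
        field_simp; ring
      rwa [h5] at h4

theorem exists_hit_one {x v : ℝ} (hx : x ∈ Set.Icc (0 : ℝ) 1) (hv : v ≠ 0) :
    ∃ T, 0 ≤ T ∧ (∀ S, 0 ≤ S → S ≤ T → x + S * v ∈ Set.Icc (0 : ℝ) 1) ∧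
      (x + T * v = 0 ∨ x + T * v = 1) := by
  obtain ⟨h0, h1⟩ := hx
  rcases lt_or_gt_of_ne hv with hv | hv
  · have e : x / (-v) * v = -x := by field_simp
    refine ⟨x / (-v), div_nonneg h0 (by linarith), fun S hS hST => ?_, Or.inl (by rw [e]; ring)⟩
    have := mul_le_mul_of_nonpos_right hST hv.le
    have := mul_nonneg hS (neg_nonneg.2 hv.le)
    constructor <;> linarith
  · have e : (1 - x) / v * v = 1 - x := by field_simp
    refine ⟨(1 - x) / v, div_nonneg (by linarith) hv.le, fun S hS hST => ?_,
      Or.inr (by rw [e]; ring)⟩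
    have := mul_le_mul_of_nonneg_right hST hv.le
    have := mul_nonneg hS hv.le
    constructor <;> linarith

/-- A ray that starts in the unit square hits its boundary. -/
theorem exists_hit {x y v w : ℝ} (hx : x ∈ Set.Icc (0 : ℝ) 1) (hy : y ∈ Set.Icc (0 : ℝ) 1)
    (hvw : v ≠ 0 ∨ w ≠ 0) :
    ∃ T, 0 ≤ T ∧ x + T * v ∈ Set.Icc (0 : ℝ) 1 ∧ y + T * w ∈ Set.Icc (0 : ℝ) 1 ∧
      ((x + T * v = 0 ∨ x + T * v = 1) ∨ (y + T * w = 0 ∨ y + T * w = 1)) := by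
  by_cases hv : v = 0
  · obtain ⟨T, h0, h1, h2⟩ := exists_hit_one hy (hvw.resolve_left (not_not.2 hv))
    exact ⟨T, h0, by simpa [hv] using hx, h1 T h0 le_rfl, Or.inr h2⟩
  obtain ⟨T, h0, h1, h2⟩ := exists_hit_one hx hv
  by_cases hw : w = 0
  · exact ⟨T, h0, h1 T h0 le_rfl, by simpa [hw] using hy, Or.inl h2⟩
  obtain ⟨S, g0, g1, g2⟩ := exists_hit_one hy hw
  rcases le_total S T with h | h
  · exact ⟨S, g0, h1 S g0 h, g1 S g0 le_rfl, Or.inr g2⟩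
  · exact ⟨T, h0, h1 T h0 le_rfl, g1 T h0 h, Or.inl h2⟩

/-- The pairs of parameters of points on a common vertical line are the solutions of a linear
equation in the unit square, and the vertical gap is affine on them. A violation can be pushed,
without improving the gap, to the boundary of the square, where one of the two points is an end
point. -/
theorem below_iff (σ : ℝ) (a b c d : ℝ × ℝ) : Below σ a b c d ↔ SegBelow σ a b c d := by
  have s0 : ∀ a b : ℝ × ℝ, segPoint a b 0 = a := by intro a b; simp [segPoint]
  have s1 : ∀ a b : ℝ × ℝ, segPoint a b 1 = b := by intro a b; simp [segPoint]
  have i0 : (0 : ℝ) ∈ Set.Icc (0 : ℝ) 1 := by simp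
  have i1 : (1 : ℝ) ∈ Set.Icc (0 : ℝ) 1 := by simp
  simp only [Below, pointBelow_iff]
  constructor
  · rintro ⟨⟨h1, h2⟩, h3, h4⟩ l hl m hm hx
    by_contra hy
    rw [not_lt] at hy
    -- A direction along which the two points stay on a common vertical line, with its sign chosen
    -- so that the violation does not shrink. If both segments are vertical, moving the first point
    -- alone will do.
    obtain ⟨v, w, hvw, hdx, hdy⟩ : ∃ v w : ℝ, (v ≠ 0 ∨ w ≠ 0) ∧
        v * (b.1 - a.1) = w * (d.1 - c.1) ∧
        0 ≤ σ * (v * (b.2 - a.2)) - σ * (w * (d.2 - c.2)) := by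
      obtain ⟨v, w, hvw, hdx⟩ : ∃ v w : ℝ, (v ≠ 0 ∨ w ≠ 0) ∧
          v * (b.1 - a.1) = w * (d.1 - c.1) := by
        by_cases h : d.1 - c.1 = 0 ∧ b.1 - a.1 = 0
        · exact ⟨1, 0, by simp, by simp [h.2]⟩
        · exact ⟨d.1 - c.1, b.1 - a.1, not_and_or.1 h, mul_comm _ _⟩
      rcases le_total 0 (σ * (v * (b.2 - a.2)) - σ * (w * (d.2 - c.2))) with h | h
      · exact ⟨v, w, hvw, hdx, h⟩
      · exact ⟨-v, -w, by simpa using hvw, by linarith, by linarith⟩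
    obtain ⟨T, hT, hl', hm', hb⟩ := exists_hit hl hm hvw
    have hx' : (segPoint a b (l + T * v)).1 = (segPoint c d (m + T * w)).1 := by
      simp only [segPoint] at hx ⊢
      have : T * (v * (b.1 - a.1)) = T * (w * (d.1 - c.1)) := by rw [hdx]
      linarith
    have hy' : σ * (segPoint c d (m + T * w)).2 ≤ σ * (segPoint a b (l + T * v)).2 := by
      simp only [segPoint] at hy ⊢
      have := mul_nonneg hT hdy
      linarith
    rcases hb with (hb | hb) | (hb | hb)
    · rw [hb, s0] at hx' hy'
      exact absurd (h1 _ hm' hx') (not_lt.2 hy')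
    · rw [hb, s1] at hx' hy'
      exact absurd (h2 _ hm' hx') (not_lt.2 hy')
    · rw [hb, s0] at hx' hy'
      have := h3 _ hl' hx'.symm
      linarith
    · rw [hb, s1] at hx' hy'
      have := h4 _ hl' hx'.symm
      linarith
  · intro h
    refine ⟨⟨fun m hm hx => ?_, fun m hm hx => ?_⟩, fun l hl hx => ?_, fun l hl hx => ?_⟩
    · have := h 0 i0 m hm
      rw [s0] at this
      exact this hx
    · have := h 1 i1 m hm
      rw [s1] at this
      exact this hx
    · have := h l hl 0 i0
      rw [s0] at this
      have := this hx.symm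
      linarith
    · have := h l hl 1 i1
      rw [s1] at this
      have := this hx.symm
      linarith

theorem nested_iff (a b c d : ℝ × ℝ) :
    Nested a b c d ↔ min a.1 b.1 ≤ min c.1 d.1 ∧ max c.1 d.1 ≤ max a.1 b.1 := by
  rw [Nested, ← min_le_iff, ← le_max_iff, ← min_le_iff, ← le_max_iff, le_min_iff, max_le_iff]
  tauto

theorem shifted_iff (a b c d : ℝ × ℝ) :
    Shifted a b c d ↔ min a.1 b.1 ≤ min c.1 d.1 ∧ max a.1 b.1 ≤ max c.1 d.1 := by
  rw [Shifted, ← min_le_iff, ← min_le_iff, ← le_max_iff, ← le_max_iff, le_min_iff, max_le_iff]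

theorem segPoint_fst_mem {a b : ℝ × ℝ} {l : ℝ} (hl : l ∈ Set.Icc (0 : ℝ) 1) :
    min a.1 b.1 ≤ (segPoint a b l).1 ∧ (segPoint a b l).1 ≤ max a.1 b.1 := by
  obtain ⟨h0, h1⟩ := hl
  simp only [segPoint]
  rcases le_total a.1 b.1 with h | h
  · rw [min_eq_left h, max_eq_right h]
    constructor <;> nlinarith
  · rw [min_eq_right h, max_eq_left h]
    constructor <;> nlinarith

theorem exists_segPoint_fst {a b : ℝ × ℝ} {x : ℝ} (h1 : min a.1 b.1 ≤ x) (h2 : x ≤ max a.1 b.1) :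
    ∃ l ∈ Set.Icc (0 : ℝ) 1, (segPoint a b l).1 = x := by
  have : x ∈ segment ℝ a.1 b.1 := by
    rw [segment_eq_uIcc, Set.mem_uIcc]
    rcases le_total a.1 b.1 with h | h
    · rw [min_eq_left h] at h1; rw [max_eq_right h] at h2; exact Or.inl ⟨h1, h2⟩
    · rw [min_eq_right h] at h1; rw [max_eq_left h] at h2; exact Or.inr ⟨h1, h2⟩
  rw [segment_eq_image'] at this
  obtain ⟨l, hl, rfl⟩ := this
  exact ⟨l, hl, by simp [segPoint]⟩

/-- The hypothesis `hx` supplies a point of the middle segment on each vertical line that meets both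
outer ones. -/
theorem SegBelow.trans {σ : ℝ} {a b c d e f : ℝ × ℝ} (h1 : SegBelow σ a b c d)
    (h2 : SegBelow σ c d e f)
    (hx : ∀ x, min a.1 b.1 ≤ x → x ≤ max a.1 b.1 → min e.1 f.1 ≤ x → x ≤ max e.1 f.1 →
      min c.1 d.1 ≤ x ∧ x ≤ max c.1 d.1) : SegBelow σ a b e f := by
  intro l hl m hm he
  have hl' := segPoint_fst_mem (a := a) (b := b) hl
  have hm' := segPoint_fst_mem (a := e) (b := f) hm
  rw [← he] at hm'
  obtain ⟨h3, h4⟩ := hx _ hl'.1 hl'.2 hm'.1 hm'.2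
  obtain ⟨u, hu, hue⟩ := exists_segPoint_fst h3 h4
  exact (h1 l hl u hu hue.symm).trans (h2 u hu m hm (hue.trans he))

theorem Order.irrefl {o : ℕ} {a b : ℝ × ℝ} : ¬ Order o a b a b := by
  have : ∀ σ, ¬ Below σ a b a b := by
    intro σ h
    rw [below_iff] at h
    exact lt_irrefl _ (h 0 (by simp) 0 (by simp) rfl)
  rintro ((⟨-, -, h⟩ | ⟨-, -, h⟩) | (⟨-, -, h⟩ | ⟨-, -, h⟩)) <;> exact this _ h

/-- In the nested case the middle projection contains the last one. In the shifted case the middle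
left end is at most the last left end and the middle right end is at least the first right end.
Either way the middle projection covers what the outer two share. -/
theorem Order.trans {o : ℕ} {a b c d e f : ℝ × ℝ} (h1 : Order o a b c d) (h2 : Order o c d e f) :
    Order o a b e f := by
  have nested : ∀ {σ}, Nested a b c d ∧ Below σ a b c d → Nested c d e f ∧ Below σ c d e f →
      Nested a b e f ∧ Below σ a b e f := by
    rintro σ ⟨h1, h2⟩ ⟨h3, h4⟩
    rw [nested_iff] at *
    rw [below_iff] at *
    exact ⟨⟨h1.1.trans h3.1, h3.2.trans h1.2⟩, h2.trans h4 fun x _ _ h5 h6 =>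
      ⟨h3.1.trans h5, h6.trans h3.2⟩⟩
  have shifted : ∀ {σ}, Shifted a b c d ∧ Below σ a b c d → Shifted c d e f ∧ Below σ c d e f →
      Shifted a b e f ∧ Below σ a b e f := by
    rintro σ ⟨h1, h2⟩ ⟨h3, h4⟩
    rw [shifted_iff] at *
    rw [below_iff] at *
    exact ⟨⟨h1.1.trans h3.1, h1.2.trans h3.2⟩, h2.trans h4 fun x _ h7 h5 _ =>
      ⟨h3.1.trans h5, h7.trans h1.2⟩⟩
  unfold Order at *
  rcases h1 with (⟨ho, h⟩ | ⟨ho, h⟩) | (⟨ho, h⟩ | ⟨ho, h⟩) <;> subst ho <;> simp at h2 ⊢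
  · exact nested h h2
  · exact nested h h2
  · exact shifted h h2
  · exact shifted h h2

theorem Order.ne {o : ℕ} {a b c d : ℝ × ℝ} (h : Order o a b c d) {l m : ℝ}
    (hl : l ∈ Set.Icc (0 : ℝ) 1) (hm : m ∈ Set.Icc (0 : ℝ) 1) : segPoint a b l ≠ segPoint c d m := by
  have : ∀ {σ}, Below σ a b c d → segPoint a b l ≠ segPoint c d m := by
    intro σ h he
    rw [below_iff] at h
    have := h l hl m hm (by rw [he])
    rw [he] at this
    exact lt_irrefl _ this
  rcases h with (⟨-, -, h⟩ | ⟨-, -, h⟩) | (⟨-, -, h⟩ | ⟨-, -, h⟩) <;> exact this h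

/-- Of two disjoint segments one is below the other. -/
theorem segBelow_or_segBelow {a b c d : ℝ × ℝ}
    (h : ∀ l ∈ Set.Icc (0 : ℝ) 1, ∀ m ∈ Set.Icc (0 : ℝ) 1, segPoint a b l ≠ segPoint c d m) :
    SegBelow 1 a b c d ∨ SegBelow (-1) a b c d := by
  by_contra hno
  simp only [SegBelow, not_or, not_forall, not_lt, exists_prop] at hno
  obtain ⟨⟨l, hl, m, hm, hx, hy⟩, l', hl', m', hm', hx', hy'⟩ := hno
  set D := (segPoint a b l).2 - (segPoint c d m).2 with hD
  set D' := (segPoint c d m').2 - (segPoint a b l').2 with hD'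
  have h0 : 0 ≤ D := by linarith
  have h1 : 0 ≤ D' := by linarith
  rcases h0.eq_or_lt with h0' | h0'
  · exact h l hl m hm (Prod.ext hx (by linarith))
  have hpos : 0 < D + D' := by linarith
  -- The gap is `D` at the first pair of points and `-D'` at the second; `u` is the zero of its
  -- affine interpolation, and the interpolated pair gives a common point.
  set u := D / (D + D') with hu
  have hu0 : 0 ≤ u := by positivity
  have hu1 : u ≤ 1 := by rw [hu, div_le_one hpos]; linarith
  have conv : ∀ {x y : ℝ}, x ∈ Set.Icc (0 : ℝ) 1 → y ∈ Set.Icc (0 : ℝ) 1 →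
      (1 - u) * x + u * y ∈ Set.Icc (0 : ℝ) 1 := by
    intro x y hx hy
    exact convex_Icc (0 : ℝ) 1 hx hy (by linarith) hu0 (by ring)
  refine h _ (conv hl hl') _ (conv hm hm') (Prod.ext ?_ ?_)
  · simp only [segPoint] at hx hx' ⊢
    linear_combination (1 - u) * hx + u * hx'
  · have hu' : u * (D + D') = D := by rw [hu]; field_simp
    simp only [segPoint] at hD hD' ⊢
    linear_combination -hu' + (u - 1) * hD + u * hD'

theorem SegBelow.symm {σ : ℝ} {a b c d : ℝ × ℝ} (h : SegBelow σ a b c d) :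
    SegBelow (-σ) c d a b := by
  intro l hl m hm hx
  have := h m hm l hl hx.symm
  linarith

/-- Comparing the left ends and the right ends of the two projections shows that one of the segments
is nested in or shifted from the other, and disjointness supplies the vertical comparison. -/
theorem exists_order {a b c d : ℝ × ℝ}
    (h : ∀ l ∈ Set.Icc (0 : ℝ) 1, ∀ m ∈ Set.Icc (0 : ℝ) 1, segPoint a b l ≠ segPoint c d m) :
    ∃ o < 4, Order o a b c d ∨ Order o c d a b := by
  have h1 := segBelow_or_segBelow h
  have h2 : SegBelow 1 c d a b ∨ SegBelow (-1) c d a b :=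
    h1.symm.imp (fun h => by simpa using h.symm) (fun h => h.symm)
  simp only [← below_iff] at h1 h2
  have nested : ∀ {a b c d : ℝ × ℝ}, Nested a b c d → Below 1 a b c d ∨ Below (-1) a b c d →
      ∃ o < 4, Order o a b c d := by
    rintro a b c d h (h' | h')
    · exact ⟨0, by omega, by simp [Order, h, h']⟩
    · exact ⟨1, by omega, by simp [Order, h, h']⟩
  have shifted : ∀ {a b c d : ℝ × ℝ}, Shifted a b c d → Below 1 a b c d ∨ Below (-1) a b c d →
      ∃ o < 4, Order o a b c d := by
    rintro a b c d h (h' | h')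
    · exact ⟨2, by omega, by simp [Order, h, h']⟩
    · exact ⟨3, by omega, by simp [Order, h, h']⟩
  have left : (∃ o < 4, Order o a b c d) → ∃ o < 4, Order o a b c d ∨ Order o c d a b :=
    fun ⟨o, ho, h⟩ => ⟨o, ho, Or.inl h⟩
  have right : (∃ o < 4, Order o c d a b) → ∃ o < 4, Order o a b c d ∨ Order o c d a b :=
    fun ⟨o, ho, h⟩ => ⟨o, ho, Or.inr h⟩
  rcases le_total (min a.1 b.1) (min c.1 d.1) with h3 | h3 <;>
    rcases le_total (max a.1 b.1) (max c.1 d.1) with h4 | h4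
  · exact left (shifted ((shifted_iff _ _ _ _).2 ⟨h3, h4⟩) h1)
  · exact left (nested ((nested_iff _ _ _ _).2 ⟨h3, h4⟩) h1)
  · exact right (nested ((nested_iff _ _ _ _).2 ⟨h3, h4⟩) h2)
  · exact right (shifted ((shifted_iff _ _ _ _).2 ⟨h3, h4⟩) h2)

end Algorithm

end Geom

/-! ### Segments and planes in coordinates of `d`-space. -/

namespace Geom

namespace Algorithm

open Machine

variable {num : ℕ → ℕ → ℕ → ℝ} {d n k : ℕ}

/-- The coordinates of the points of the segment `s`. -/
def linePoint (num : ℕ → ℕ → ℕ → ℝ) (s : ℕ) (l : ℝ) (δ : ℕ) : ℝ :=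
  num 0 s δ + l * (num 1 s δ - num 0 s δ)

/-- The segments `s` and `t` are disjoint. -/
def DisjSeg (num : ℕ → ℕ → ℕ → ℝ) (d s t : ℕ) : Prop :=
  ∀ l ∈ Set.Icc (0 : ℝ) 1, ∀ m ∈ Set.Icc (0 : ℝ) 1,
    ∃ δ < d, linePoint num s l δ ≠ linePoint num t m δ

theorem DisjSeg.symm {s t : ℕ} (h : DisjSeg num d s t) : DisjSeg num d t s := by
  intro l hl m hm
  obtain ⟨δ, hδ, h'⟩ := h m hm l hl
  exact ⟨δ, hδ, h'.symm⟩

theorem not_disjSeg_iff {s t : ℕ} : ¬ DisjSeg num d s t ↔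
    ∃ l ∈ Set.Icc (0 : ℝ) 1, ∃ m ∈ Set.Icc (0 : ℝ) 1,
      ∀ δ < d, linePoint num s l δ = linePoint num t m δ := by
  simp only [DisjSeg, not_forall, not_exists, not_and, not_not, exists_prop]

/-- The determinant whose vanishing for all `γ` means that the point `p` lies in the plane `j`. -/
def pointDet (num : ℕ → ℕ → ℕ → ℝ) (α β : ℕ) (p : ℕ → ℝ) (j γ : ℕ) : ℝ :=
  (p α - num 2 j α) * minor num j β γ - (p β - num 2 j β) * minor num j α γ +
    (p γ - num 2 j γ) * minor num j α β

theorem pointDet_congr {α β j γ : ℕ} {p q : ℕ → ℝ} (hα : α < d) (hβ : β < d) (hγ : γ < d)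
    (h : ∀ δ < d, p δ = q δ) : pointDet num α β p j γ = pointDet num α β q j γ := by
  simp only [pointDet, h α hα, h β hβ, h γ hγ]

theorem pointDet_linePoint (α β s j γ : ℕ) (l : ℝ) :
    pointDet num α β (linePoint num s l) j γ =
      (1 - l) * det num α β 0 s j γ + l * det num α β 1 s j γ := by
  simp only [pointDet, linePoint, det]; ring

/-- A plane is the zero set of the determinants. -/
theorem pointDet_eq_zero_iff {α β j : ℕ} (hα : α < d) (hβ : β < d) (hm : minor num j α β ≠ 0)
    (p : ℕ → ℝ) :
    (∀ γ < d, pointDet num α β p j γ = 0) ↔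
      ∃ x y : ℝ, ∀ γ < d, p γ = num 2 j γ + x * num 3 j γ + y * num 4 j γ := by
  constructor
  · intro h
    -- Cramer's rule for the coordinates `α` and `β`.
    refine ⟨((p α - num 2 j α) * num 4 j β - (p β - num 2 j β) * num 4 j α) / minor num j α β,
      ((p β - num 2 j β) * num 3 j α - (p α - num 2 j α) * num 3 j β) / minor num j α β,
      fun γ hγ => ?_⟩
    have h1 := h γ hγ
    field_simp
    simp only [pointDet, minor] at h1 ⊢
    linear_combination h1
  · rintro ⟨x, y, h⟩ γ hγ
    simp only [pointDet, minor, h α hα, h β hβ, h γ hγ]; ring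

/-- Points of a plane are determined by two coordinates. -/
theorem eq_of_pointDet {α β j : ℕ} (hm : minor num j α β ≠ 0) {p q : ℕ → ℝ}
    (hp : ∀ γ < d, pointDet num α β p j γ = 0) (hq : ∀ γ < d, pointDet num α β q j γ = 0)
    (h1 : p α = q α) (h2 : p β = q β) : ∀ γ < d, p γ = q γ := by
  intro γ hγ
  have h3 := hp γ hγ
  have h4 := hq γ hγ
  simp only [pointDet, h1, h2] at h3 h4
  have : (p γ - q γ) * minor num j α β = 0 := by linear_combination h3 - h4
  have := (mul_eq_zero.1 this).resolve_right hm
  linarith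

theorem ends_eq_zero {x y l l' : ℝ} (hl : l ≠ l') (h : (1 - l) * x + l * y = 0)
    (h' : (1 - l') * x + l' * y = 0) : x = 0 ∧ y = 0 := by
  have h1 : (l - l') * (y - x) = 0 := by linear_combination h - h'
  have h2 := (mul_eq_zero.1 h1).resolve_left (sub_ne_zero.2 hl)
  have h3 : y = x := by linarith
  subst h3
  constructor <;> linarith

section

variable {T : Mem} (hax : ∀ j < k, T 5 j 0 < d ∧ T 6 j 0 < d ∧ minor num j (T 5 j 0) (T 6 j 0) ≠ 0)

theorem InPlane.pointDet {s j : ℕ} (h : InPlane num d T s j) (l : ℝ) :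
    ∀ γ < d, pointDet num (T 5 j 0) (T 6 j 0) (linePoint num s l) j γ = 0 := by
  intro γ hγ
  rw [pointDet_linePoint, (h γ hγ).1, (h γ hγ).2]; ring

theorem inPlane_of_two_points {s j : ℕ} {l l' : ℝ} (hl : l ≠ l')
    (h : ∀ γ < d, Algorithm.pointDet num (T 5 j 0) (T 6 j 0) (linePoint num s l) j γ = 0)
    (h' : ∀ γ < d, Algorithm.pointDet num (T 5 j 0) (T 6 j 0) (linePoint num s l') j γ = 0) :
    InPlane num d T s j := by
  intro γ hγ
  have h1 := h γ hγ
  have h2 := h' γ hγ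
  rw [pointDet_linePoint] at h1 h2
  exact ends_eq_zero hl h1 h2

theorem segPoint_planePoint (α β s : ℕ) (l : ℝ) :
    segPoint (planePoint num α β 0 s) (planePoint num α β 1 s) l =
      (linePoint num s l α, linePoint num s l β) := rfl

theorem disjSeg_of_orderRel {a s t : ℕ} (hα : T 5 (T 4 s 0) 0 < d) (hβ : T 6 (T 4 s 0) 0 < d)
    (h : OrderRel num T a s t) : DisjSeg num d s t := by
  intro l hl m hm
  have := h.2.ne hl hm
  rw [segPoint_planePoint, segPoint_planePoint, Ne, Prod.ext_iff, not_and_or] at this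
  rcases this with h | h
  · exact ⟨_, hα, h⟩
  · exact ⟨_, hβ, h⟩

theorem exists_orderRel {s t : ℕ} (hm : minor num (T 4 s 0) (T 5 (T 4 s 0) 0) (T 6 (T 4 s 0) 0) ≠ 0)
    (hst : T 4 s 0 = T 4 t 0) (hs : InPlane num d T s (T 4 s 0)) (ht : InPlane num d T t (T 4 t 0))
    (h : DisjSeg num d s t) : ∃ a < 4, OrderRel num T a s t ∨ OrderRel num T a t s := by
  set j := T 4 s 0 with hj
  obtain ⟨a, ha, hor⟩ := exists_order (a := planePoint num (T 5 j 0) (T 6 j 0) 0 s)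
    (b := planePoint num (T 5 j 0) (T 6 j 0) 1 s) (c := planePoint num (T 5 j 0) (T 6 j 0) 0 t)
    (d := planePoint num (T 5 j 0) (T 6 j 0) 1 t) (by
      intro l hl m hm' he
      rw [segPoint_planePoint, segPoint_planePoint, Prod.ext_iff] at he
      obtain ⟨δ, hδ, hne⟩ := h l hl m hm'
      rw [← hst] at ht
      exact hne (eq_of_pointDet hm (hs.pointDet l) (ht.pointDet m) he.1 he.2 δ hδ))
  refine ⟨a, ha, hor.imp (fun h => ⟨hst, h⟩) fun h => ⟨hst.symm, ?_⟩⟩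
  rw [← hst]
  exact h

/-- A segment that is not contained in the plane of the segment `t` meets `t` if and only if its
intersection point with that plane is on `t`. -/
theorem crossAt_iff {s t : ℕ} (hα : T 5 (T 4 t 0) 0 < d) (hβ : T 6 (T 4 t 0) 0 < d)
    (ht : InPlane num d T t (T 4 t 0)) (hs : ¬ InPlane num d T s (T 4 t 0)) :
    (∃ γ < d, CrossAt num d T s t γ) ↔ ¬ DisjSeg num d s t := by
  rw [not_disjSeg_iff]
  constructor
  · rintro ⟨γ, hγ, ⟨hne, hle⟩, hon⟩
    set x := endDet num T 0 s t γ
    set y := endDet num T 1 s t γ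
    have hxy : x - y ≠ 0 := sub_ne_zero.2 hne
    have hsq : 0 < (x - y) ^ 2 := by positivity
    -- Weakly opposite signs at the ends put the zero of the affine function into the unit interval.
    have h0 : 0 ≤ x / (x - y) := by
      rw [show x / (x - y) = (x * (x - y)) / (x - y) ^ 2 by field_simp]
      exact div_nonneg (by nlinarith) hsq.le
    have h1 : x / (x - y) ≤ 1 := by
      rw [show x / (x - y) = (x * (x - y)) / (x - y) ^ 2 by field_simp, div_le_one hsq]
      nlinarith
    refine ⟨_, ⟨h0, h1⟩, ?_⟩
    change ∃ m ∈ _, ∀ δ < d, crossing num x y s δ = linePoint num t m δ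
    set p := crossing num x y s
    -- If `t` is a single point, the sign condition of `OnSegment` says that a square is
    -- nonpositive. Otherwise a coordinate in which the ends of `t` differ determines the parameter.
    by_cases hdeg : ∀ ε < d, num 1 t ε = num 0 t ε
    · refine ⟨0, by simp, fun δ hδ => ?_⟩
      have h2 := (hon δ hδ δ hδ).2
      rw [hdeg δ hδ] at h2
      have h3 : p δ - num 0 t δ = 0 := by
        apply pow_eq_zero_iff (two_ne_zero) |>.1
        nlinarith [sq_nonneg (p δ - num 0 t δ)]
      simp only [linePoint]
      linarith
    · push Not at hdeg
      obtain ⟨ε, hε, hneε⟩ := hdeg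
      have hw : num 1 t ε - num 0 t ε ≠ 0 := sub_ne_zero.2 hneε
      have hsq' : 0 < (num 1 t ε - num 0 t ε) ^ 2 := by positivity
      have h2 := (hon ε hε ε hε).2
      refine ⟨(p ε - num 0 t ε) / (num 1 t ε - num 0 t ε), ⟨?_, ?_⟩, fun δ hδ => ?_⟩
      · rw [show (p ε - num 0 t ε) / (num 1 t ε - num 0 t ε) = ((p ε - num 0 t ε) *
          (num 1 t ε - num 0 t ε)) / (num 1 t ε - num 0 t ε) ^ 2 by field_simp]
        exact div_nonneg (by nlinarith [sq_nonneg (p ε - num 0 t ε)]) hsq'.le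
      · rw [show (p ε - num 0 t ε) / (num 1 t ε - num 0 t ε) = ((p ε - num 0 t ε) *
          (num 1 t ε - num 0 t ε)) / (num 1 t ε - num 0 t ε) ^ 2 by field_simp, div_le_one hsq']
        nlinarith [sq_nonneg (p ε - num 1 t ε)]
      · have h3 := (hon δ hδ ε hε).1
        simp only [linePoint]
        field_simp
        linear_combination h3
  · rintro ⟨l, ⟨hl0, hl1⟩, m, ⟨hm0, hm1⟩, heq⟩
    have hz : ∀ γ < d, (1 - l) * endDet num T 0 s t γ + l * endDet num T 1 s t γ = 0 := by
      intro γ hγ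
      have := ht.pointDet m γ hγ
      rw [← pointDet_congr hα hβ hγ heq, pointDet_linePoint] at this
      exact this
    simp only [InPlane, not_forall] at hs
    obtain ⟨γ, hγ, hns⟩ := hs
    change ¬ (endDet num T 0 s t γ = 0 ∧ endDet num T 1 s t γ = 0) at hns
    have hzγ := hz γ hγ
    refine ⟨γ, hγ, ?_⟩
    unfold CrossAt
    set x := endDet num T 0 s t γ
    set y := endDet num T 1 s t γ
    -- A determinant that is constant along `s` and vanishes at the common point would vanish at
    -- both ends, against the choice of `γ`.
    have hne : x ≠ y := by
      intro h
      rw [← h] at hzγ hns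
      have : x = 0 := by linarith
      exact hns ⟨this, this⟩
    have hxy : x - y ≠ 0 := sub_ne_zero.2 hne
    have hlx : x / (x - y) = l := by
      rw [div_eq_iff hxy]; linarith
    refine ⟨⟨hne, ?_⟩, fun δ hδ ε hε => ?_⟩
    · have hx : x = l * (x - y) := by linarith
      have hy : y = -((1 - l) * (x - y)) := by linarith
      have : x * y = -(l * (1 - l) * (x - y) ^ 2) := by
        calc x * y = (l * (x - y)) * (-((1 - l) * (x - y))) := by rw [← hx, ← hy]
          _ = _ := by ring
      rw [this, neg_nonpos]
      exact mul_nonneg (mul_nonneg hl0 (by linarith)) (sq_nonneg _)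
    · have hp : ∀ δ < d, crossing num x y s δ = linePoint num t m δ := by
        intro δ hδ
        rw [← heq δ hδ]
        simp only [crossing, hlx, linePoint]
      unfold OnSegment
      rw [hp δ hδ, hp ε hε]
      simp only [linePoint]
      refine ⟨by ring, ?_⟩
      have : (num 0 t δ + m * (num 1 t δ - num 0 t δ) - num 0 t δ) *
          (num 0 t δ + m * (num 1 t δ - num 0 t δ) - num 1 t δ) =
          -(m * (1 - m) * (num 1 t δ - num 0 t δ) ^ 2) := by ring
      rw [this, neg_nonpos]
      exact mul_nonneg (mul_nonneg hm0 (by linarith)) (sq_nonneg _)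

/-- Two segments in a plane that meet a segment not contained in the plane meet each other. -/
theorem not_disjSeg_trans {s t t' : ℕ} (hα : T 5 (T 4 t 0) 0 < d) (hβ : T 6 (T 4 t 0) 0 < d)
    (ht : InPlane num d T t (T 4 t 0)) (ht' : InPlane num d T t' (T 4 t 0))
    (hs : ¬ InPlane num d T s (T 4 t 0)) (h : ¬ DisjSeg num d s t) (h' : ¬ DisjSeg num d s t') :
    ¬ DisjSeg num d t t' := by
  rw [not_disjSeg_iff] at *
  obtain ⟨l, hl, m, hm, he⟩ := h
  obtain ⟨l', hl', m', hm', he'⟩ := h'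
  -- Two different parameters of `s` in the plane would put all of `s` into it.
  have hll : l = l' := by
    by_contra hne
    refine hs (inPlane_of_two_points hne (fun γ hγ => ?_) (fun γ hγ => ?_))
    · rw [pointDet_congr hα hβ hγ he]; exact ht.pointDet m γ hγ
    · rw [pointDet_congr hα hβ hγ he']; exact ht'.pointDet m' γ hγ
  subst hll
  exact ⟨m, hm, m', hm', fun δ hδ => (he δ hδ).symm.trans (he' δ hδ)⟩

include hax in
theorem tables_of_geometry (hn : T 0 0 1 = n) (hk : T 0 0 2 = k)
    (hcl : ∀ t < n, T 4 t 0 < k ∧ InPlane num d T t (T 4 t 0) ∧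
      ∀ j < k, T 4 t 0 < j → ¬ InPlane num d T t j)
    (hrel : ∀ a s t, a < 4 → s < n → t < n → (Rel n T a s t ↔ OrderRel num T a s t))
    (hmeet : ∀ s t, s < n → t < n → (0 < T 8 s t ↔ ∃ γ < d, CrossAt num d T s t γ)) :
    Tables n k (DisjSeg num d) T where
  segs := hn
  planes := hk
  class_lt t ht := (hcl t ht).1
  strict a ha i := by
    constructor
    · intro t ht hr
      exact Order.irrefl ((hrel a t t ha ht.1 ht.1).1 hr).2
    · intro s t u hs ht hu h1 h2
      have g1 := (hrel a s t ha hs.1 ht.1).1 h1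
      have g2 := (hrel a t u ha ht.1 hu.1).1 h2
      refine (hrel a s u ha hs.1 hu.1).2 ⟨g1.1.trans g2.1, ?_⟩
      have h3 := g1.2
      have h4 := g2.2
      rw [hs.2] at h3 ⊢
      rw [ht.2] at h4
      exact h3.trans h4
  disj_of_rel a ha s hs t ht _ h := by
    have := hax _ (hcl s hs).1
    exact disjSeg_of_orderRel this.1 this.2.1 ((hrel a s t ha hs ht).1 h)
  rel_of_disj s hs t ht hst h := by
    obtain ⟨a, ha, h⟩ := exists_orderRel (hax _ (hcl s hs).1).2.2 hst (hcl s hs).2.1 (hcl t ht).2.1 h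
    exact ⟨a, ha, h.imp (hrel a s t ha hs ht).2 (hrel a t s ha ht hs).2⟩
  meets_iff s hs t ht hst := by
    have := hax _ (hcl t ht).1
    rw [hmeet s t hs ht]
    exact crossAt_iff this.1 this.2.1 (hcl t ht).2.1 ((hcl s hs).2.2 _ (hcl t ht).1 hst)
  star s hs t ht t' ht' hst htt h h' := by
    have := hax _ (hcl t ht).1
    exact not_disjSeg_trans this.1 this.2.1 (hcl t ht).2.1 (htt ▸ (hcl t' ht').2.1)
      ((hcl s hs).2.2 _ (hcl t ht).1 hst) h h'
  symm s t h := h.symm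

end

end Algorithm

end Geom

/-! ### Correctness of the whole algorithm. -/

namespace Geom

open Machine

namespace Algorithm

variable {I : Input ℝ}

theorem entry_of_lt {m d : ℕ} (f : Fin m → Fin d → ℝ) (i : Fin m) (j : Fin d) :
    Input.entry f i j = f i j := by
  simp [Input.entry]

theorem mem_seg_iff (s : Fin I.n) (p : EuclideanSpace ℝ (Fin I.d)) :
    p ∈ I.seg (RingHom.id ℝ) s ↔
      ∃ l ∈ Set.Icc (0 : ℝ) 1, ∀ δ : Fin I.d, p δ = linePoint I.initial.num s l δ := by
  simp only [Input.seg, segment_eq_image', Set.mem_image]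
  refine exists_congr fun l => and_congr_right fun _ => ?_
  constructor
  · rintro rfl δ
    simp [linePoint, Input.initial, entry_of_lt, Input.point]
  · intro h
    ext δ
    simp [h δ, linePoint, Input.initial, entry_of_lt, Input.point]

theorem disjoint_seg_iff (s t : Fin I.n) :
    Disjoint (I.seg (RingHom.id ℝ) s) (I.seg (RingHom.id ℝ) t) ↔
      DisjSeg I.initial.num I.d s t := by
  rw [← not_iff_not, not_disjSeg_iff, Set.not_disjoint_iff]
  simp only [mem_seg_iff]
  constructor
  · rintro ⟨p, ⟨l, hl, h⟩, m, hm, h'⟩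
    exact ⟨l, hl, m, hm, fun δ hδ => (h ⟨δ, hδ⟩).symm.trans (h' ⟨δ, hδ⟩)⟩
  · rintro ⟨l, hl, m, hm, h⟩
    exact ⟨WithLp.toLp 2 fun δ => linePoint I.initial.num s l δ, ⟨l, hl, fun δ => rfl⟩,
      m, hm, fun δ => h δ δ.2⟩

theorem mem_plane_iff (j : Fin I.k) (p : EuclideanSpace ℝ (Fin I.d)) :
    p ∈ I.plane (RingHom.id ℝ) j ↔ ∃ x y : ℝ, ∀ δ : Fin I.d,
      p δ = I.initial.num 2 j δ + x * I.initial.num 3 j δ + y * I.initial.num 4 j δ := by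
  rw [Input.plane, AffineSubspace.mem_mk', vsub_eq_sub, Submodule.mem_span_pair]
  refine exists_congr fun x => exists_congr fun y => ?_
  constructor
  · intro h δ
    have := congrArg (fun v : EuclideanSpace ℝ (Fin I.d) => v δ) h
    simp only [Input.point, RingHom.id_apply, PiLp.add_apply, PiLp.smul_apply, smul_eq_mul,
      PiLp.sub_apply] at this
    simp only [Input.initial, entry_of_lt]
    linarith
  · intro h
    ext δ
    have := h δ
    simp only [Input.initial, entry_of_lt] at this
    simp only [Input.point, RingHom.id_apply, PiLp.add_apply, PiLp.smul_apply, smul_eq_mul,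
      PiLp.sub_apply]
    linarith

/-- If all minors vanish, the two vectors are proportional and span at most a line. -/
theorem exists_minor_ne_zero {d : ℕ} {u v : EuclideanSpace ℝ (Fin d)}
    (h : Module.finrank ℝ (Submodule.span ℝ {u, v}) = 2) :
    ∃ α β : Fin d, u α * v β - u β * v α ≠ 0 := by
  by_contra! hc
  have hle : ∃ w : EuclideanSpace ℝ (Fin d), Submodule.span ℝ {u, v} ≤ Submodule.span ℝ {w} := by
    by_cases hu : u = 0
    · exact ⟨v, by rw [hu, Submodule.span_insert_zero]⟩
    · obtain ⟨α, hα⟩ : ∃ α, u α ≠ 0 := by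
        by_contra! h0
        exact hu (by ext α; simpa using h0 α)
      refine ⟨u, Submodule.span_le.2 ?_⟩
      rintro w (rfl | rfl)
      · exact Submodule.mem_span_singleton_self _
      · refine Submodule.mem_span_singleton.2 ⟨w α / u α, ?_⟩
        ext β
        have := hc α β
        simp only [PiLp.smul_apply, smul_eq_mul]
        field_simp
        linarith
  obtain ⟨w, hw⟩ := hle
  have h1 := Submodule.finrank_mono hw
  have h2 := finrank_span_le_card (R := ℝ) ({w} : Set (EuclideanSpace ℝ (Fin d)))
  simp at h2
  omega

theorem exists_axes {j : Fin I.k} (h : IsPlane (I.plane (RingHom.id ℝ) j)) :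
    ∃ α < I.d, ∃ β < I.d, minor I.initial.num j α β ≠ 0 := by
  rw [IsPlane, Input.plane, AffineSubspace.direction_mk'] at h
  obtain ⟨α, β, h⟩ := exists_minor_ne_zero h
  refine ⟨α, α.2, β, β.2, ?_⟩
  simpa [minor, Input.initial, entry_of_lt, Input.point] using h

/-- Pigeonhole: of the `k + 1` distinct parameters `1 / (i + 1)` two give points of the same plane,
and by affinity of the determinants this plane contains the segment. The argument is about
parameters, so it also covers degenerate segments. -/
theorem exists_inPlane {T : Mem} (hax : ∀ j < I.k, T 5 j 0 < I.d ∧ T 6 j 0 < I.d ∧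
      minor I.initial.num j (T 5 j 0) (T 6 j 0) ≠ 0) (s : Fin I.n)
    (h : I.seg (RingHom.id ℝ) s ⊆
      ⋃ j, (I.plane (RingHom.id ℝ) j : Set (EuclideanSpace ℝ (Fin I.d)))) :
    ∃ j < I.k, InPlane I.initial.num I.d T s j := by
  have hmem : ∀ i : Fin (I.k + 1), ∃ j : Fin I.k, ∀ γ < I.d,
      pointDet I.initial.num (T 5 j 0) (T 6 j 0)
        (linePoint I.initial.num s (1 / ((i : ℝ) + 1))) j γ = 0 := by
    intro i
    have hp : WithLp.toLp 2 (fun δ : Fin I.d => linePoint I.initial.num s (1 / ((i : ℝ) + 1)) δ) ∈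
        I.seg (RingHom.id ℝ) s := by
      refine (mem_seg_iff s _).2 ⟨1 / ((i : ℝ) + 1), ⟨by positivity, ?_⟩, fun δ => rfl⟩
      rw [div_le_one (by positivity)]
      exact le_add_of_nonneg_left (Nat.cast_nonneg _)
    obtain ⟨j, hj⟩ := Set.mem_iUnion.1 (h hp)
    obtain ⟨x, y, hxy⟩ := (mem_plane_iff j _).1 hj
    have := hax j j.2
    exact ⟨j, (pointDet_eq_zero_iff this.1 this.2.1 this.2.2 _).2
      ⟨x, y, fun γ hγ => hxy ⟨γ, hγ⟩⟩⟩
  choose f hf using hmem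
  obtain ⟨i, i', hne, he⟩ := Fintype.exists_ne_map_eq_of_card_lt f (by simp)
  have hf' := hf i'
  rw [← he] at hf'
  refine ⟨f i, (f i).2, inPlane_of_two_points (fun h => hne ?_) (hf i) hf'⟩
  rw [one_div, one_div, inv_inj, add_left_inj, Nat.cast_inj] at h
  exact Fin.ext h

/-- The preparatory phases of the algorithm. -/
def prepare : Code := .seq axes (.seq classes (.seq orders meets))

theorem prepare_spec (hpl : ∀ i, IsPlane (I.plane (RingHom.id ℝ) i))
    (hseg : ∀ i, I.seg (RingHom.id ℝ) i ⊆
      ⋃ j, (I.plane (RingHom.id ℝ) j : Set (EuclideanSpace ℝ (Fin I.d)))) {c : ℕ} {T₀ : Mem}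
    (hc : I.d + I.n + I.k + 5 ≤ c) (e₀ : T₀ 0 = I.initial.nat 0)
    (z₀ : ∀ a ∈ [1, 2, 3, 7, 8, 10, 16], ∀ i j, T₀ a i j = 0) :
    Tables I.n I.k (DisjSeg I.initial.num I.d) (prepare.exec I.initial.num c T₀) ∧
      ∀ a ∈ [1, 2, 3, 10, 16], ∀ i j, prepare.exec I.initial.num c T₀ a i j = 0 := by
  set num := I.initial.num with hnum
  have hd₀ : T₀ 0 0 0 = I.d := by rw [e₀]; rfl
  have hn₀ : T₀ 0 0 1 = I.n := by rw [e₀]; rfl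
  have hk₀ : T₀ 0 0 2 = I.k := by rw [e₀]; rfl
  have hex : ∀ j < I.k, ∃ α < I.d, ∃ β < I.d, minor num j α β ≠ 0 :=
    fun j hj => exists_axes (hpl ⟨j, hj⟩)
  obtain ⟨T₁, hT₁⟩ : ∃ T, axes.exec num c T₀ = T := ⟨_, rfl⟩
  obtain ⟨T₂, hT₂⟩ : ∃ T, classes.exec num c T₁ = T := ⟨_, rfl⟩
  obtain ⟨T₃, hT₃⟩ : ∃ T, orders.exec num c T₂ = T := ⟨_, rfl⟩
  obtain ⟨T₄, hT₄⟩ : ∃ T, meets.exec num c T₃ = T := ⟨_, rfl⟩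
  have hprep : prepare.exec num c T₀ = T₄ := by
    rw [← hT₄, ← hT₃, ← hT₂, ← hT₁]; rfl
  rw [hprep]
  have f₁ : ∀ a ∈ [0, 1, 2, 3, 7, 8, 10, 16], T₁ a = T₀ a := fun a ha => by
    rw [← hT₁]
    refine Code.exec_frame _ _ _ _ ?_
    revert a; decide
  have f₂ : ∀ a ∈ [0, 1, 2, 3, 5, 6, 7, 8, 10, 16], T₂ a = T₁ a := fun a ha => by
    rw [← hT₂]
    refine Code.exec_frame _ _ _ _ ?_
    revert a; decide
  have f₃ : ∀ a ∈ [0, 1, 2, 3, 4, 5, 6, 8, 10, 16], T₃ a = T₂ a := fun a ha => by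
    rw [← hT₃]
    refine Code.exec_frame _ _ _ _ ?_
    revert a; decide
  have f₄ : ∀ a ∈ [0, 1, 2, 3, 4, 5, 6, 7, 10, 16], T₄ a = T₃ a := fun a ha => by
    rw [← hT₄]
    refine Code.exec_frame _ _ _ _ ?_
    revert a; decide
  have i₁ := f₁ 0 (by simp)
  have i₂ := (f₂ 0 (by simp)).trans i₁
  have i₃ := (f₃ 0 (by simp)).trans i₂
  have i₄ := (f₄ 0 (by simp)).trans i₃
  have hax : ∀ j < I.k, T₁ 5 j 0 < I.d ∧ T₁ 6 j 0 < I.d ∧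
      minor num j (T₁ 5 j 0) (T₁ 6 j 0) ≠ 0 := by
    intro j hj
    rw [← hT₁]
    exact axes_spec T₀ hd₀ hk₀ (by omega) hex j hj
  have hcl := classes_spec (num := num) (c := c) T₁ (i₁ ▸ hd₀) (i₁ ▸ hn₀) (i₁ ▸ hk₀) (by omega)
    fun t ht => exists_inPlane hax ⟨t, ht⟩ (hseg ⟨t, ht⟩)
  have hrel := orders_spec (num := num) (c := c) T₂ (i₂ ▸ hn₀) (by omega)
    (by rw [f₂ 7 (by simp), f₁ 7 (by simp)]; exact z₀ 7 (by simp))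
  have hmeet := meets_spec (num := num) (c := c) T₃ (i₃ ▸ hd₀) (i₃ ▸ hn₀) (by omega)
    (by rw [f₃ 8 (by simp), f₂ 8 (by simp), f₁ 8 (by simp)]; exact z₀ 8 (by simp))
  rw [hT₂] at hcl
  rw [hT₃] at hrel
  rw [hT₄] at hmeet
  have p₅ : T₂ 5 = T₁ 5 := f₂ 5 (by simp)
  have p₆ : T₂ 6 = T₁ 6 := f₂ 6 (by simp)
  have q₄ : T₃ 4 = T₂ 4 := f₃ 4 (by simp)
  have q₅ : T₃ 5 = T₂ 5 := f₃ 5 (by simp)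
  have q₆ : T₃ 6 = T₂ 6 := f₃ 6 (by simp)
  have r₄ : T₄ 4 = T₃ 4 := f₄ 4 (by simp)
  have r₅ : T₄ 5 = T₃ 5 := f₄ 5 (by simp)
  have r₆ : T₄ 6 = T₃ 6 := f₄ 6 (by simp)
  have r₇ : T₄ 7 = T₃ 7 := f₄ 7 (by simp)
  refine ⟨tables_of_geometry ?_ (i₄ ▸ hn₀) (i₄ ▸ hk₀) ?_ ?_ ?_, ?_⟩
  · rw [r₅, q₅, p₅, r₆, q₆, p₆]; exact hax
  · simpa only [InPlane, r₄, q₄, r₅, q₅, p₅, r₆, q₆, p₆] using hcl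
  · simpa only [OrderRel, Rel, r₄, q₄, r₅, q₅, r₆, q₆, r₇] using hrel
  · simpa only [CrossAt, endDet, r₄, r₅, r₆] using hmeet
  · intro a ha
    have ha' : a ∈ [1, 2, 3, 7, 8, 10, 16] ∧ a ∈ [0, 1, 2, 3, 7, 8, 10, 16] ∧
        a ∈ [0, 1, 2, 3, 5, 6, 7, 8, 10, 16] ∧ a ∈ [0, 1, 2, 3, 4, 5, 6, 8, 10, 16] ∧
        a ∈ [0, 1, 2, 3, 4, 5, 6, 7, 10, 16] := by
      revert a; decide
    rw [f₄ a ha'.2.2.2.2, f₃ a ha'.2.2.2.1, f₂ a ha'.2.2.1, f₁ a ha'.2.1]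
    exact z₀ a ha'.1

/-- The algorithm. -/
def main : Code := .seq prepare colorAll

theorem main_wellFormed : main.WellFormed := by
  refine ⟨⟨?_, ?_, ?_, ?_⟩, ?_⟩
  · simp [axes, axesBody, cond, setArr, Code.WellFormed, Code.writes, NatExpr.IsInput, planeE, dimE]
  · simp [classes, classesBody, classesFlag, cond, setArr, setCell, Code.WellFormed, Code.writes,
      NatExpr.IsInput, segE, planeE, dimE]
  · simp [orders, ordersBody, cond, Code.WellFormed, Code.writes, NatExpr.IsInput, segE]
  · simp [meets, meetsBody, meetsFlag, cond, setCell, Code.WellFormed, Code.writes,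
      NatExpr.IsInput, segE, dimE]
  · simp [colorAll, stage, markStage, heights, heightsBody, maxHeight, maxHeightBody, chain,
      chainBody, colorStage, colorBody, star, starBody, stars, starsBody, addBase, cond, setArr,
      setCell, Code.WellFormed, Code.writes, NatExpr.IsInput, segE, planeE]

theorem main_correct (hI : I.IsValid (RingHom.id ℝ)) : I.IsCorrect (RingHom.id ℝ)
    ⟨main.exec I.initial.num I.capacity I.start, I.initial.num⟩ := by
  obtain ⟨-, hk, hpl, hseg⟩ := hI
  have hcap : I.capacity = I.n * I.n * (I.n * I.n) + I.k * I.n + I.n + I.k + I.d + 5 := rfl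
  obtain ⟨htab, hz⟩ := prepare_spec (c := I.capacity) (T₀ := I.start) hpl hseg (by omega)
    (update_of_ne _ (by decide) _ _ _) (by
      intro a ha i j
      have ha' : a ≠ 9 ∧ a ≠ 0 := by revert a; decide
      rw [Input.start, update_of_ne _ ha'.1]
      match a, ha'.2 with
      | a + 1, _ => rfl)
  obtain ⟨K, hK, hKn, hcliq, hproper, hlt⟩ := colorAll_spec (num := I.initial.num)
    (c := I.capacity) htab hk (by omega) hz
  rw [show main.exec I.initial.num I.capacity I.start = colorAll.exec I.initial.num I.capacity
    (prepare.exec I.initial.num I.capacity I.start) by rw [main, Code.exec]]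
  generalize colorAll.exec I.initial.num I.capacity
    (prepare.exec I.initial.num I.capacity I.start) = T at *
  have hmem : ∀ i : Fin I.n, i ∈ I.outputClique ⟨T, I.initial.num⟩ ↔ (i : ℕ) ∈ K := by
    intro i
    simp only [Input.outputClique, Finset.mem_filter, Finset.mem_univ, true_and]
    rw [← hK, Nat.pos_iff_ne_zero]
  have hcard : (I.outputClique ⟨T, I.initial.num⟩).card = K.card := by
    rw [← Finset.card_map Fin.valEmbedding]
    congr 1
    ext t
    simp only [Finset.mem_map, hmem, Fin.valEmbedding_apply]
    exact ⟨fun ⟨i, hi, e⟩ => e ▸ hi, fun h => ⟨⟨t, hKn t h⟩, h, rfl⟩⟩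
  refine ⟨?_, ?_, ?_⟩
  · intro i hi j hj hij
    rw [Finset.mem_coe, hmem] at hi hj
    exact ⟨hij, (disjoint_seg_iff i j).2 (hcliq i hi j hj fun h => hij (Fin.ext h))⟩
  · intro i j hij
    exact hproper i i.2 j j.2 ((disjoint_seg_iff i j).1 hij.2)
  · intro i
    rw [hcard]
    exact hlt i i.2

end Algorithm

end Geom

/-! ### The bound on the chromatic number, for arbitrary families. -/

namespace Geom

open Machine

theorem exists_span_pair {E : Type*} [AddCommGroup E] [Module ℝ E] {W : Submodule ℝ E}
    (h : Module.finrank ℝ W = 2) : ∃ u v : E, W = Submodule.span ℝ {u, v} := by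
  have : Module.Finite ℝ W := Module.finite_of_finrank_pos (by omega)
  let b := Module.finBasisOfFinrankEq ℝ W h
  refine ⟨b 0, b 1, ?_⟩
  have hb := congrArg (Submodule.map W.subtype) b.span_eq
  rw [Submodule.map_subtype_top, Submodule.map_span, ← Set.range_comp] at hb
  refine hb.symm.trans (congrArg _ ?_)
  ext x
  simp [eq_comm]

theorem exists_mk'_span_pair {E : Type*} [AddCommGroup E] [Module ℝ E] {π : AffineSubspace ℝ E}
    (h : IsPlane π) : ∃ p u v : E, π = AffineSubspace.mk' p (Submodule.span ℝ {u, v}) := by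
  obtain ⟨p, hp⟩ : (π : Set E).Nonempty := by
    rw [AffineSubspace.nonempty_iff_ne_bot]
    rintro rfl
    rw [IsPlane, AffineSubspace.direction_bot, finrank_bot] at h
    omega
  obtain ⟨u, v, huv⟩ := exists_span_pair h
  exact ⟨p, u, v, by rw [← huv, AffineSubspace.mk'_eq hp]⟩

/-- The output of the algorithm, for finitely many segments. -/
theorem exists_clique_coloring {d k n : ℕ} (hd : 2 < d) (hk : 1 ≤ k)
    {s : Fin n → Set (EuclideanSpace ℝ (Fin d))}
    {π : Fin k → AffineSubspace ℝ (EuclideanSpace ℝ (Fin d))} (hs : ∀ i, IsSegment (s i))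
    (hπ : ∀ j, IsPlane (π j))
    (h : ∀ i, s i ⊆ ⋃ j, (π j : Set (EuclideanSpace ℝ (Fin d)))) :
    ∃ (K : Finset (Fin n)) (f : Fin n → ℕ), (disjointnessGraph s).IsClique (K : Set (Fin n)) ∧
      (∀ i j, (disjointnessGraph s).Adj i j → f i ≠ f j) ∧
      ∀ i, f i < (k - 1) * K.card + K.card ^ 4 := by
  choose x y hxy using hs
  choose p u v hpuv using fun j => exists_mk'_span_pair (hπ j)
  -- Existence is obtained by running the algorithm on the real coordinates of the data.
  let I : Input ℝ :=
    { d := d, n := n, k := k, left := fun i j => x i j, right := fun i j => y i j,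
      base := fun i j => p i j, dir₁ := fun i j => u i j, dir₂ := fun i j => v i j }
  have hseg : I.seg (RingHom.id ℝ) = s := funext fun i => (hxy i).symm
  have hplane : I.plane (RingHom.id ℝ) = π := funext fun j => (hpuv j).symm
  have hI : I.IsValid (RingHom.id ℝ) := by
    refine ⟨hd, hk, ?_, ?_⟩
    · rw [hplane]; exact hπ
    · rw [hplane, hseg]; exact h
  obtain ⟨h1, h2, h3⟩ := Algorithm.main_correct hI
  rw [hseg] at h1 h2
  exact ⟨_, _, h1, h2, h3⟩

theorem disjointnessGraph_comp {ι κ E : Type*} (s : ι → Set E) (e : κ ↪ ι) :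
    disjointnessGraph (s ∘ e) = (disjointnessGraph s).comap e := by
  ext i j
  simp [disjointnessGraph]

theorem le_cliqueNumber {V : Type*} {G : SimpleGraph V} {K : Finset V}
    (h : G.IsClique (K : Set V)) : (K.card : ℕ∞) ≤ cliqueNumber G :=
  le_iSup (fun K : {K : Finset V // G.IsClique (K : Set V)} => (K.1.card : ℕ∞)) ⟨K, h⟩

/-- The theorem of de Bruijn and Erdős. -/
theorem colorable_of_finite {V : Type*} {G : SimpleGraph V} {N : ℕ}
    (h : ∀ (n : ℕ) (e : Fin n ↪ V), (G.comap e).Colorable N) : G.Colorable N := by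
  refine SimpleGraph.nonempty_hom_of_forall_finite_subgraph_hom fun G' hG' => ?_
  have := hG'.fintype
  let e := Fintype.equivFin G'.verts
  have f := (h _ (e.symm.toEmbedding.trans (Function.Embedding.subtype _))).some
  refine f.comp ⟨e, fun {a b} hab => ?_⟩
  simpa using G'.adj_sub hab

/-- An infinite clique number makes the bound trivial. Otherwise every finite subfamily is colored
with a number of colors governed by a clique of its own, hence by the clique number of the whole
graph, and compactness applies. -/
theorem chromaticNumber_le {d k : ℕ} (hd : 2 < d) (hk : 1 ≤ k) {ι : Type*}
    {s : ι → Set (EuclideanSpace ℝ (Fin d))}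
    {π : Fin k → AffineSubspace ℝ (EuclideanSpace ℝ (Fin d))} (hs : ∀ i, IsSegment (s i))
    (hπ : ∀ j, IsPlane (π j))
    (h : ∀ i, s i ⊆ ⋃ j, (π j : Set (EuclideanSpace ℝ (Fin d)))) :
    (disjointnessGraph s).chromaticNumber ≤
      ((k - 1 : ℕ) : ℕ∞) * cliqueNumber (disjointnessGraph s) +
        cliqueNumber (disjointnessGraph s) ^ 4 := by
  by_cases hω : cliqueNumber (disjointnessGraph s) = ⊤
  · simp [hω]
  obtain ⟨ω, hω⟩ := ENat.ne_top_iff_exists.1 hω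
  rw [← hω]
  norm_cast
  rw [SimpleGraph.chromaticNumber_le_iff_colorable]
  refine colorable_of_finite fun n e => ?_
  obtain ⟨K, f, hK, hf, hlt⟩ := exists_clique_coloring hd hk (s := s ∘ e) (fun i => hs _) hπ
    fun i => h _
  rw [disjointnessGraph_comp] at hK hf
  have hle : K.card ≤ ω := by
    have : ((K.map e).card : ℕ∞) ≤ cliqueNumber (disjointnessGraph s) := by
      refine le_cliqueNumber ?_
      rw [Finset.coe_map]
      rintro _ ⟨i, hi, rfl⟩ _ ⟨j, hj, rfl⟩ hij
      exact hK hi hj fun h => hij (h ▸ rfl)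
    rw [Finset.card_map, ← hω] at this
    exact_mod_cast this
  refine ⟨SimpleGraph.Coloring.mk (fun i => (⟨f i, (hlt i).trans_le ?_⟩ : Fin _)) ?_⟩
  · gcongr
  · intro i j hij he
    exact hf i j hij (Fin.ext_iff.1 he)

end Geom

theorem theorem3p1 :
    (∀ (d k : ℕ), 2 < d → 1 ≤ k →
      ∀ (ι : Type*) (s : ι → Set (EuclideanSpace ℝ (Fin d)))
        (π : Fin k → AffineSubspace ℝ (EuclideanSpace ℝ (Fin d))),
        (∀ i, Geom.IsSegment (s i)) → (∀ j, Geom.IsPlane (π j)) →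
        (∀ i, s i ⊆ ⋃ j, (π j : Set (EuclideanSpace ℝ (Fin d)))) →
        (Geom.disjointnessGraph s).chromaticNumber ≤
          ((k - 1 : ℕ) : ℕ∞) * Geom.cliqueNumber (Geom.disjointnessGraph s) +
            Geom.cliqueNumber (Geom.disjointnessGraph s) ^ 4) ∧
    ∃ (P : Machine.Program) (p : Polynomial ℕ),
      Geom.SolvesInTime (RingHom.id ℝ) Machine.realCost P p ∧
      Geom.SolvesInTime (Rat.castHom ℝ) Machine.ratCost P p := by
  refine ⟨fun d k hd hk ι s π hs hπ h => Geom.chromaticNumber_le hd hk hs hπ h, ?_⟩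
  obtain ⟨p, hp⟩ := Geom.exists_solvesInTime Geom.Algorithm.main Geom.Algorithm.main_wellFormed
    fun I => Geom.Algorithm.main_correct
  exact ⟨_, p, hp ℝ _ _ strictMono_id Machine.isCost_realCost,
    hp ℚ _ _ Rat.cast_strictMono Machine.isCost_ratCost⟩
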